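/- **Problem.** Let $N,n,m,p\ge 0$ be integers, $A_k\in\mathbb R^{n\times n}$, $B_k\in\mathbb R^{n\times m}$, $G_k\in\mathbb R^{n\times p}$, $Q_k\succeq 0$, $R_k\succ 0$ ($0\le k<N$), $\mu_{\rm init},\mu_{\rm fin}\in\mathbb R^n$ and $P_{\rm init},P_{\rm fin}\succ 0$. Let $x_0\sim\mathcal N(\mu_{\rm init},P_{\rm init})$ and let $w_0,\dots,w_{N-1}$ be standard Gaussian vectors in $\mathbb R^p$, independent of each other and of $x_0$. For a controller $(v_k,K_k)_{k<N}$, $v_k\in\mathbb R^m$, $K_k\in\mathbb R^{m\times n}$, let $$x_{k+1}=A_kx_k+B_ku_k+G_kw_k,\qquad u_k=v_k+K_k(x_k-\mathbb E x_k).$$ The covariance steering problem (without chance constraints, with expectation-of-quadratic cost) is to minimize $\sum_{k<N}\mathbb E[x_k^\top Q_kx_k+u_k^\top R_ku_k]$ over all controllers with $\mathbb E x_N=\mu_{\rm fin}$ and $\mathrm{Cov}(x_N)\preceq P_{\rm fin}$. For $P\succ0$ let $P^{1/2}$ be its Cholesky factor (lower triangular, positive diagonal). For a matrix $M$ of full column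 rank let $\mathrm{qr}(M)$ be the upper triangular factor, with positive diagonal, of its economy-size QR decomposition. The square root formulation has variables $z=(v,L,\mu,S)$ with $L_k\in\mathbb R^{m\times n}$ (representing $K_kS_k$), $\mu_k\in\mathbb R^n$ and $S_k\in\mathbb R^{n\times n}$. It is to minimize $$J(z)=\sum_{k<N}\mu_k^\top Q_k\mu_k+v_k^\top R_kv_k+\mathrm{tr}(Q_kS_kS_k^\top)+\mathrm{tr}(R_kL_kL_k^\top)$$ subject to the convex constraints: $S_k$ is lower triangular with nonnegative diagonal, $\mu_{k+1}=A_k\mu_k+B_kv_k$, $\mu_0=\mu_{\rm init}$, $S_0=P_{\rm init}^{1/2}$, $\mu_N=\mu_{\rm fin}$, $\|P_{\rm fin}^{-1/2}S_N\|_2\le1$; and the nonconvex dynamics $S_{k+1}=\mathrm{qr}(X_{k+1}^\top)^\top$, where $X_{k+1}=[A_kS_k+B_kL_k,\ G_k]$ has full row rank. Gains are recovered by $K_k=L_kS_k^{-1}$. Call $z$ *globally optimal* if $z$ is a global minimizer of the square root formulation, the controller $(v,K)$ is optimal for the covariance steering problem among all its controllers, and $\mathbb E x_k=\mu_k$, $\mathrm{Cov}(x_k)^{1/2}=S_k$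 for all $k$. **Algorithm 1** (successive convexification). The data of an iteration are a reference point $\bar z$, multipliers $\lambda_k$, a penalty weight $w>0$, a threshold $\delta$ and a trust region radius $r$. At the start $\bar z$ is an initial guess satisfying the convex constraints, $\lambda=0$, $w=w_{\rm init}>0$, $\delta=\infty$, $r=r_{\rm init}\in[r_{\min},r_{\max}]$ with $r_{\min}>0$. Put $P(\xi)=\sum_k\lambda_k^\top\xi_k+\frac w2\|\xi_k\|^2$, and let $\tilde\xi(z)$ have as blocks the lower triangular parts of $S_{k+1}-\mathrm{qr}(X_{k+1}^\top)^\top$. An iteration takes a minimizer $(z^*,\xi^*)$ of $J(z)+P(\xi)$ subject to the convex constraints, the dynamics with $\mathrm{qr}$ replaced by its first-order Taylor approximation at $\bar z$ and with slack $\xi_k$ (on the lower triangular part), and the trust region $|D_X(X_{k+1}-\bar X_{k+1})|\le r$ (entrywise; $D_X$ is a fixed scaling matrix). With $\mathcal J(z)=J(z)+P(\tilde\xi(z))$ put $\Delta J=\mathcal J(\bar z)-\mathcal J(z^*)$, $\Delta L=\mathcal J(\bar z)-J(z^*)-P(\xi^*)$, $\chi=\|\tilde\xi(z^*)\|$, and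 $\rho=\Delta J/\Delta L$ ($\rho=1$ if $\Delta L=0$). If $\rho\ge\rho_0$ (with fixed $\rho_0>0$), the step is accepted: $\bar z$ becomes $z^*$ and, if moreover $|\Delta J|<\delta$, $(\lambda,\delta,w)$ is updated. Finally $r$ is updated. The update rules may be any that keep $w>0$ and $r\in[r_{\min},r_{\max}]$. The loop stops when $|\Delta J|\le\epsilon_{\rm opt}$ and $\chi\le\epsilon_{\rm feas}$. In a run of the algorithm all matrices $X_{k+1}$ formed at reference points and at subproblem solutions have full row rank, so that the QR decompositions are defined. **Theorem.** 1. Every local minimizer of the square root formulation is globally optimal. 2. If Algorithm 1, run with $\epsilon_{\rm opt}=\epsilon_{\rm feas}=0$, stops at an accepted step, then the solution $z^*$ it returns is globally optimal. 3. Suppose that some controller satisfies $\mathbb E x_N=\mu_{\rm fin}$ and $\mathrm{Cov}(x_N)\prec P_{\rm fin}$. If the reference points of an infinite run of Algorithm 1 (continued without stopping) converge to $z=(v,L,\mu,S)$, where all $S_k$ have positive diagonals, and if for all $\epsilon_{\rm opt},\epsilon_{\rm feas}>0$ the stopping test is met at infinitely many accepted steps, then $z$ is globally optimal. -/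

import Mathlib

open Matrix MeasureTheory ProbabilityTheory Filter Topology

namespace CovSteer

noncomputable section

/-! ## The stochastic covariance steering problem -/

/-- Data of the finite-horizon covariance steering problem with expectation-of-quadratic cost
and without chance constraints. -/
structure Problem (N n m p : ℕ) where
  A : Fin N → Matrix (Fin n) (Fin n) ℝ
  B : Fin N → Matrix (Fin n) (Fin m) ℝ
  G : Fin N → Matrix (Fin n) (Fin p) ℝ
  Q : Fin N → Matrix (Fin n) (Fin n) ℝ
  R : Fin N → Matrix (Fin m) (Fin m) ℝ
  muInit : Fin n → ℝ
  muFin : Fin n → ℝ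
  PInit : Matrix (Fin n) (Fin n) ℝ
  PFin : Matrix (Fin n) (Fin n) ℝ
  Q_posSemidef : ∀ k, (Q k).PosSemidef
  R_posDef : ∀ k, (R k).PosDef
  PInit_posDef : PInit.PosDef
  PFin_posDef : PFin.PosDef

/-- The random data: `x₀` is Gaussian with mean `muInit` and covariance `PInit`, and the `w k` are
standard Gaussian vectors, independent of each other and of `x₀`. -/
structure IsNoise {N n m p : ℕ} (D : Problem N n m p) {Ω : Type*} [MeasurableSpace Ω]
    (P : Measure Ω) (x₀ : Ω → Fin n → ℝ) (w : Fin N → Ω → Fin p → ℝ) : Prop where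
  law_init : HasLaw (fun ω => WithLp.toLp 2 (x₀ ω))
    (multivariateGaussian (WithLp.toLp 2 D.muInit) D.PInit) P
  law_noise : ∀ k, HasLaw (fun ω => WithLp.toLp 2 (w k ω))
    (stdGaussian (EuclideanSpace ℝ (Fin p))) P
  indep_noise : iIndepFun w P
  indep_init : IndepFun x₀ (fun ω k => w k ω) P

section Stochastic

variable {Ω : Type*} [MeasurableSpace Ω]

/-- Mean vector of a random vector. -/
def meanVec {d : ℕ} (P : Measure Ω) (X : Ω → Fin d → ℝ) : Fin d → ℝ :=
  fun i => ∫ ω, X ω i ∂P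

/-- Covariance matrix of a random vector. -/
def covMat {d : ℕ} (P : Measure Ω) (X : Ω → Fin d → ℝ) : Matrix (Fin d) (Fin d) ℝ :=
  Matrix.of fun i j => cov[fun ω => X ω i, fun ω => X ω j; P]

/-- The affine feedback law `u = v + K (x - 𝔼 x)`. -/
def control {n m : ℕ} (P : Measure Ω) (v : Fin m → ℝ) (K : Matrix (Fin m) (Fin n) ℝ)
    (X : Ω → Fin n → ℝ) : Ω → Fin m → ℝ :=
  fun ω => v + K *ᵥ (X ω - meanVec P X)

variable {N n m p : ℕ}

/-- The closed-loop state process: `x_{k+1} = A_k x_k + B_k u_k + G_k w_k`. -/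
def state (D : Problem N n m p) (P : Measure Ω) (x₀ : Ω → Fin n → ℝ)
    (w : Fin N → Ω → Fin p → ℝ) (v : Fin N → Fin m → ℝ)
    (K : Fin N → Matrix (Fin m) (Fin n) ℝ) : Fin (N + 1) → Ω → Fin n → ℝ :=
  fun k => Fin.induction (motive := fun _ => Ω → Fin n → ℝ) x₀
    (fun k X ω => D.A k *ᵥ X ω + D.B k *ᵥ control P (v k) (K k) X ω + D.G k *ᵥ w k ω) k

/-- The cost `∑_k 𝔼[x_kᵀ Q_k x_k + u_kᵀ R_k u_k]`. -/
def cost (D : Problem N n m p) (P : Measure Ω) (x₀ : Ω → Fin n → ℝ)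
    (w : Fin N → Ω → Fin p → ℝ) (v : Fin N → Fin m → ℝ)
    (K : Fin N → Matrix (Fin m) (Fin n) ℝ) : ℝ :=
  ∑ k : Fin N, ∫ ω,
    (state D P x₀ w v K k.castSucc ω ⬝ᵥ D.Q k *ᵥ state D P x₀ w v K k.castSucc ω
      + control P (v k) (K k) (state D P x₀ w v K k.castSucc) ω ⬝ᵥ
          D.R k *ᵥ control P (v k) (K k) (state D P x₀ w v K k.castSucc) ω) ∂P

/-- The controller `(v, K)` meets the terminal conditions
`𝔼 x_N = muFin` and `PFin ⪰ Cov x_N`. -/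
def Admissible (D : Problem N n m p) (P : Measure Ω) (x₀ : Ω → Fin n → ℝ)
    (w : Fin N → Ω → Fin p → ℝ) (v : Fin N → Fin m → ℝ)
    (K : Fin N → Matrix (Fin m) (Fin n) ℝ) : Prop :=
  meanVec P (state D P x₀ w v K (Fin.last N)) = D.muFin ∧
    (D.PFin - covMat P (state D P x₀ w v K (Fin.last N))).PosSemidef

/-- Some controller meets the terminal covariance bound strictly. -/
def StrictlyFeasible (D : Problem N n m p) (P : Measure Ω) (x₀ : Ω → Fin n → ℝ)
    (w : Fin N → Ω → Fin p → ℝ) : Prop :=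
  ∃ (v : Fin N → Fin m → ℝ) (K : Fin N → Matrix (Fin m) (Fin n) ℝ),
    meanVec P (state D P x₀ w v K (Fin.last N)) = D.muFin ∧
      (D.PFin - covMat P (state D P x₀ w v K (Fin.last N))).PosDef

end Stochastic

/-! ## Cholesky and QR factors -/

/-- `S` is lower triangular. -/
def IsLT {n : ℕ} (S : Matrix (Fin n) (Fin n) ℝ) : Prop := ∀ i j, i < j → S i j = 0

/-- `S` is the Cholesky factor of `P`. -/
structure IsCholesky {n : ℕ} (P S : Matrix (Fin n) (Fin n) ℝ) : Prop where
  lower : IsLT S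
  diag_pos : ∀ i, 0 < S i i
  eq : P = S * Sᵀ

/-- `P^{1/2}`, the Cholesky factor (meaningful for positive definite `P`). -/
def chol {n : ℕ} (P : Matrix (Fin n) (Fin n) ℝ) : Matrix (Fin n) (Fin n) ℝ :=
  Classical.epsilon (IsCholesky P)

/-- `M = Q R` is an economy-size QR decomposition with positive diagonal of `R`. -/
structure IsQR {ι : Type*} [Fintype ι] {n : ℕ} (M Q : Matrix ι (Fin n) ℝ)
    (R : Matrix (Fin n) (Fin n) ℝ) : Prop where
  orth : Qᵀ * Q = 1
  upper : ∀ i j, j < i → R i j = 0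
  diag_pos : ∀ i, 0 < R i i
  eq : M = Q * R

/-- The QR decomposition (meaningful for `M` of full column rank, where it exists uniquely). -/
def qrPair {ι : Type*} [Fintype ι] {n : ℕ} (M : Matrix ι (Fin n) ℝ) :
    Matrix ι (Fin n) ℝ × Matrix (Fin n) (Fin n) ℝ :=
  Classical.epsilon fun T => IsQR M T.1 T.2

/-- The orthonormal factor of the QR decomposition. -/
def qrQ {ι : Type*} [Fintype ι] {n : ℕ} (M : Matrix ι (Fin n) ℝ) : Matrix ι (Fin n) ℝ :=
  (qrPair M).1

/-- The upper triangular factor `qr(M)` of the QR decomposition. -/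
def qrR {ι : Type*} [Fintype ι] {n : ℕ} (M : Matrix ι (Fin n) ℝ) :
    Matrix (Fin n) (Fin n) ℝ :=
  (qrPair M).2

/-- The strictly lower triangular part of a matrix. -/
def strictLower {n : ℕ} (W : Matrix (Fin n) (Fin n) ℝ) : Matrix (Fin n) (Fin n) ℝ :=
  Matrix.of fun i j => if j < i then W i j else 0

/-- The derivative of the factor `R` of `M = Q R` in the direction `dM`:
`dR = Qᵀ dM - (Qᵀ dQ) R`, where `Qᵀ dQ` is the skew-symmetric matrix with the same strictly lower
triangular part as `Qᵀ dM R⁻¹`. -/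
def dR {ι : Type*} [Fintype ι] {n : ℕ} (dM Q : Matrix ι (Fin n) ℝ)
    (R : Matrix (Fin n) (Fin n) ℝ) : Matrix (Fin n) (Fin n) ℝ :=
  Qᵀ * dM - (strictLower (Qᵀ * dM * R⁻¹) - (strictLower (Qᵀ * dM * R⁻¹))ᵀ) * R

/-! ## The deterministic problem in square root form -/

/-- The decision variables `(v, L, μ, S)`. -/
abbrev Vars (N n m : ℕ) : Type :=
  (Fin N → Fin m → ℝ) × (Fin N → Matrix (Fin m) (Fin n) ℝ) ×
    (Fin (N + 1) → Fin n → ℝ) × (Fin (N + 1) → Matrix (Fin n) (Fin n) ℝ)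

section Deterministic

variable {N n m p : ℕ}

/-- The nominal controls. -/
def Vars.v (z : Vars N n m) : Fin N → Fin m → ℝ := z.1

/-- The variables `L_k = K_k S_k`. -/
def Vars.L (z : Vars N n m) : Fin N → Matrix (Fin m) (Fin n) ℝ := z.2.1

/-- The means. -/
def Vars.mu (z : Vars N n m) : Fin (N + 1) → Fin n → ℝ := z.2.2.1

/-- The square roots of the covariances. -/
def Vars.S (z : Vars N n m) : Fin (N + 1) → Matrix (Fin n) (Fin n) ℝ := z.2.2.2

/-- The recovered feedback gains `K_k = L_k S_k⁻¹`. -/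
def Vars.K (z : Vars N n m) : Fin N → Matrix (Fin m) (Fin n) ℝ :=
  fun k => z.L k * (z.S k.castSucc)⁻¹

/-- `X_{k+1} = [A_k S_k + B_k L_k, G_k]`. -/
def X (D : Problem N n m p) (z : Vars N n m) (k : Fin N) :
    Matrix (Fin n) (Fin n ⊕ Fin p) ℝ :=
  Matrix.fromCols (D.A k * z.S k.castSucc + D.B k * z.L k) (D.G k)

/-- The deterministic form of the expectation-of-quadratic cost. -/
def detCost (D : Problem N n m p) (z : Vars N n m) : ℝ :=
  ∑ k : Fin N, (z.mu k.castSucc ⬝ᵥ D.Q k *ᵥ z.mu k.castSucc + z.v k ⬝ᵥ D.R k *ᵥ z.v k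
    + (D.Q k * (z.S k.castSucc * (z.S k.castSucc)ᵀ)).trace
    + (D.R k * (z.L k * (z.L k)ᵀ)).trace)

/-- The convex constraints: structure of `S`, mean dynamics, initial and terminal conditions
(the norm in `terminal_cov` is the spectral norm). -/
structure ConvexFeasible (D : Problem N n m p) (z : Vars N n m) : Prop where
  lower : ∀ k, IsLT (z.S k)
  diag_nonneg : ∀ k i, 0 ≤ z.S k i i
  mean_dyn : ∀ k : Fin N, z.mu k.succ = D.A k *ᵥ z.mu k.castSucc + D.B k *ᵥ z.v k
  init_mean : z.mu 0 = D.muInit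
  init_cov : z.S 0 = chol D.PInit
  terminal_mean : z.mu (Fin.last N) = D.muFin
  terminal_cov : ‖Matrix.toEuclideanCLM (n := Fin n) (𝕜 := ℝ)
    ((chol D.PFin)⁻¹ * z.S (Fin.last N))‖ - 1 ≤ 0

/-- The feasible set of the nonconvex problem: the convex constraints and the square root
covariance dynamics `S_{k+1} = qr(X_{k+1}ᵀ)ᵀ`. -/
def detFeasible (D : Problem N n m p) : Set (Vars N n m) :=
  {z | ConvexFeasible D z ∧ ∀ k : Fin N, ∃ Q, IsQR (X D z k)ᵀ Q (z.S k.succ)ᵀ}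

/-- `z = (v, L, μ, S)` is globally optimal: the controller `(v, K)` with `K_k = L_k S_k⁻¹` is
optimal among all controllers for the stochastic problem, `μ` and `S` are the means and the
Cholesky factors of the covariances of the resulting states, and `z` is a global minimizer of the
deterministic problem. -/
structure GloballyOptimal (D : Problem N n m p) {Ω : Type*} [MeasurableSpace Ω]
    (P : Measure Ω) (x₀ : Ω → Fin n → ℝ) (w : Fin N → Ω → Fin p → ℝ)
    (z : Vars N n m) : Prop where
  admissible : Admissible D P x₀ w z.v z.K
  optimal : ∀ (v' : Fin N → Fin m → ℝ) (K' : Fin N → Matrix (Fin m) (Fin n) ℝ),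
    Admissible D P x₀ w v' K' → cost D P x₀ w z.v z.K ≤ cost D P x₀ w v' K'
  mean_eq : ∀ k, meanVec P (state D P x₀ w z.v z.K k) = z.mu k
  cov_eq : ∀ k, IsCholesky (covMat P (state D P x₀ w z.v z.K k)) (z.S k)
  det_feasible : z ∈ detFeasible D
  det_optimal : IsMinOn (detCost D) (detFeasible D) z

end Deterministic

/-! ## The successive convexification algorithm -/

/-- Index set of the lower triangular part of an `n × n` matrix. -/
abbrev TrilIdx (n : ℕ) : Type := {e : Fin n × Fin n // e.2 ≤ e.1}

/-- The vector of entries of the lower triangular part. -/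
def vectril {n : ℕ} (M : Matrix (Fin n) (Fin n) ℝ) : TrilIdx n → ℝ := fun e => M e.1.1 e.1.2

/-- Slack variables and multipliers of the square root dynamics. -/
abbrev Slack (N n : ℕ) : Type := Fin N → TrilIdx n → ℝ

/-- The Euclidean norm of a slack vector. -/
def slackNorm {N n : ℕ} (ξ : Slack N n) : ℝ := √(∑ k, ∑ e, ξ k e ^ 2)

/-- The augmented Lagrangian penalty `∑_k λ_kᵀ ξ_k + (wt / 2) ‖ξ_k‖²`. -/
def penalty {N n : ℕ} (ξ : Slack N n) (wt : ℝ) (lam : Slack N n) : ℝ :=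
  ∑ k, (∑ e, lam k e * ξ k e + wt / 2 * ∑ e, ξ k e ^ 2)

/-- Numerical parameters of the algorithm: acceptance threshold, bounds and initial value of the
trust region radius, initial penalty weight, trust region scaling matrix. -/
structure Params (n : ℕ) where
  rho0 : ℝ
  rMin : ℝ
  rMax : ℝ
  rInit : ℝ
  wInit : ℝ
  DX : Matrix (Fin n) (Fin n) ℝ
  rho0_pos : 0 < rho0
  rMin_pos : 0 < rMin
  rMin_le : rMin ≤ rInit
  le_rMax : rInit ≤ rMax
  wInit_pos : 0 < wInit

/-- Rules for updating the multipliers, the threshold `δ` and the penalty weight (from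
`(λ, δ, w)`, the infeasibility and the cost change of an accepted step) and for updating the trust
region radius (from the radius and the acceptance ratio). They may be arbitrary as long as the
weight stays positive and the radius stays between its bounds. -/
structure UpdateRules (N : ℕ) {n : ℕ} (prm : Params n) where
  mult : Slack N n × EReal × ℝ → Slack N n → ℝ → Slack N n × EReal × ℝ
  radius : ℝ → ℝ → ℝ
  weight_pos : ∀ s ξ dJ, 0 < s.2.2 → 0 < (mult s ξ dJ).2.2
  radius_mem : ∀ r ρ, r ∈ Set.Icc prm.rMin prm.rMax → radius r ρ ∈ Set.Icc prm.rMin prm.rMax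

/-- The standard rules: `λ ← λ + w ξ`, `w ← β w`, `δ ← γ δ` (or `|ΔJ|` if `δ = ∞`), and shrinking,
keeping or enlarging the radius according to the thresholds `ρ₁ < ρ₂`. -/
def standardRules (N : ℕ) {n : ℕ} (prm : Params n) (rho1 rho2 a1 a2 b c : ℝ)
    (ha1 : 1 < a1) (ha2 : 1 < a2) (hb : 1 < b) : UpdateRules N prm where
  mult s ξ dJ :=
    (fun k e => s.1 k e + s.2.2 * ξ k e,
      if s.2.1 = ⊤ then ((|dJ| : ℝ) : EReal) else (c : EReal) * s.2.1, b * s.2.2)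
  radius r ρ :=
    if ρ < rho1 then max (r / a1) prm.rMin
    else if ρ < rho2 then r else min (a2 * r) prm.rMax
  weight_pos s ξ dJ h := mul_pos (by linarith) h
  radius_mem r ρ h := by
    have h0 := prm.rMin_pos
    have h1 := h.1
    have h2 := h.2
    have hr : r / a1 ≤ r := div_le_self (by linarith) ha1.le
    have hr' : r ≤ a2 * r := by nlinarith
    split_ifs
    · exact ⟨le_max_right _ _, max_le (by linarith) (by linarith)⟩
    · exact h
    · exact ⟨le_min (by linarith) (by linarith), min_le_right _ _⟩

/-- The data carried from one iteration to the next: reference point, multipliers, threshold,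
penalty weight, trust region radius. -/
structure AlgState (N n m : ℕ) where
  ref : Vars N n m
  lam : Slack N n
  delta : EReal
  wt : ℝ
  r : ℝ

section Algorithm

variable {N n m p : ℕ}

/-- The infeasibility `ξ̃(z)` of the square root dynamics. -/
def infeas (D : Problem N n m p) (z : Vars N n m) : Slack N n :=
  fun k => vectril (z.S k.succ - (qrR (X D z k)ᵀ)ᵀ)

/-- The augmented cost of the convex subproblem. -/
def augLin (D : Problem N n m p) (z : Vars N n m) (ξ : Slack N n) (wt : ℝ)
    (lam : Slack N n) : ℝ :=
  detCost D z + penalty ξ wt lam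

/-- The augmented cost penalizing the infeasibility of the nonlinear dynamics. -/
def augNonlin (D : Problem N n m p) (z : Vars N n m) (wt : ℝ) (lam : Slack N n) : ℝ :=
  detCost D z + penalty (infeas D z) wt lam

/-- Constraints of the convex subproblem at the state `s`: the convex constraints, the linearized
dynamics with slack `ξ`, and the trust region (entrywise maximum norm). -/
structure SubFeasible (D : Problem N n m p) (prm : Params n) (s : AlgState N n m)
    (y : Vars N n m × Slack N n) : Prop where
  convex : ConvexFeasible D y.1
  linearized : ∀ k : Fin N,
    vectril (y.1.S k.succ - (qrR (X D s.ref k)ᵀ)ᵀ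
      - (dR (X D y.1 k - X D s.ref k)ᵀ (qrQ (X D s.ref k)ᵀ) (qrR (X D s.ref k)ᵀ))ᵀ) = y.2 k
  trust : ∀ (k : Fin N) (i : Fin n) (j : Fin n ⊕ Fin p),
    |(prm.DX * (X D y.1 k - X D s.ref k)) i j| ≤ s.r

/-- `y` solves the convex subproblem at the state `s`. -/
def SolvesSub (D : Problem N n m p) (prm : Params n) (s : AlgState N n m)
    (y : Vars N n m × Slack N n) : Prop :=
  SubFeasible D prm s y ∧
    IsMinOn (fun y' : Vars N n m × Slack N n => augLin D y'.1 y'.2 s.wt s.lam)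
      {y' | SubFeasible D prm s y'} y

/-- The actual cost reduction `ΔJ`. -/
def deltaJ (D : Problem N n m p) (s : AlgState N n m) (y : Vars N n m × Slack N n) : ℝ :=
  augNonlin D s.ref s.wt s.lam - augNonlin D y.1 s.wt s.lam

/-- The predicted cost reduction `ΔL`. -/
def deltaL (D : Problem N n m p) (s : AlgState N n m) (y : Vars N n m × Slack N n) : ℝ :=
  augNonlin D s.ref s.wt s.lam - augLin D y.1 y.2 s.wt s.lam

/-- The norm `χ` of the nonlinear infeasibility of the subproblem solution. -/
def chi (D : Problem N n m p) (y : Vars N n m × Slack N n) : ℝ :=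
  slackNorm (infeas D y.1)

open Classical in
/-- The acceptance ratio `ρ = ΔJ / ΔL`, set to `1` if `ΔL = 0`. -/
def ratio (D : Problem N n m p) (s : AlgState N n m) (y : Vars N n m × Slack N n) : ℝ :=
  if deltaL D s y = 0 then 1 else deltaJ D s y / deltaL D s y

/-- The step is accepted. -/
def Accepted (D : Problem N n m p) (prm : Params n) (s : AlgState N n m)
    (y : Vars N n m × Slack N n) : Prop :=
  prm.rho0 ≤ ratio D s y

/-- The stopping test with tolerances `epsOpt`, `epsFeas`. -/
def Stops (D : Problem N n m p) (epsOpt epsFeas : ℝ) (s : AlgState N n m)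
    (y : Vars N n m × Slack N n) : Prop :=
  |deltaJ D s y| ≤ epsOpt ∧ chi D y ≤ epsFeas

open Classical in
/-- One pass through the loop body, from the state `s` to the state `s'`, with `y` the solution of
the subproblem. The rank conditions say that the QR decompositions in use are defined. -/
structure Step (D : Problem N n m p) (prm : Params n) (rules : UpdateRules N prm)
    (s : AlgState N n m) (y : Vars N n m × Slack N n) (s' : AlgState N n m) : Prop where
  rank_ref : ∀ k, (X D s.ref k).rank = n
  rank_sol : ∀ k, (X D y.1 k).rank = n
  solves : SolvesSub D prm s y
  ref_eq : s'.ref = if Accepted D prm s y then y.1 else s.ref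
  mult_eq : (s'.lam, s'.delta, s'.wt) =
    if Accepted D prm s y ∧ ((|deltaJ D s y| : ℝ) : EReal) < s.delta
    then rules.mult (s.lam, s.delta, s.wt) (infeas D y.1) (deltaJ D s y)
    else (s.lam, s.delta, s.wt)
  radius_eq : s'.r = rules.radius s.r (ratio D s y)

/-- Initialization: the initial guess satisfies the convex constraints of the subproblem, the
multipliers vanish, the threshold is infinite. -/
structure IsInit (D : Problem N n m p) (prm : Params n) (s : AlgState N n m) : Prop where
  convex : ConvexFeasible D s.ref
  lam_eq : s.lam = 0
  delta_eq : s.delta = ⊤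
  wt_eq : s.wt = prm.wInit
  r_eq : s.r = prm.rInit

/-- The loop, run with tolerances zero, stops at iteration `T` with an accepted step; the
variables returned are `(y T).1`. -/
structure TerminatesAt (D : Problem N n m p) (prm : Params n) (rules : UpdateRules N prm)
    (s : ℕ → AlgState N n m) (y : ℕ → Vars N n m × Slack N n) (T : ℕ) : Prop where
  init : IsInit D prm (s 0)
  step : ∀ i ≤ T, Step D prm rules (s i) (y i) (s (i + 1))
  accepted : Accepted D prm (s T) (y T)
  stops : Stops D 0 0 (s T) (y T)

/-- The iteration converges to `z`: the reference points converge to `z`, and however small the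
tolerances are, the stopping test is met at accepted steps with arbitrarily large index. -/
structure ConvergesTo (D : Problem N n m p) (prm : Params n) (rules : UpdateRules N prm)
    (s : ℕ → AlgState N n m) (y : ℕ → Vars N n m × Slack N n) (z : Vars N n m) : Prop where
  init : IsInit D prm (s 0)
  step : ∀ i, Step D prm rules (s i) (y i) (s (i + 1))
  tendsto : Tendsto (fun i => (s i).ref) atTop (𝓝 z)
  stops : ∀ epsOpt > 0, ∀ epsFeas > 0,
    ∃ᶠ i in atTop, Accepted D prm (s i) (y i) ∧ Stops D epsOpt epsFeas (s i) (y i)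

end Algorithm

end

end CovSteer

namespace CovSteer

noncomputable section

/-! ## Triangular matrices and Cholesky factors -/

section Triangular

variable {n : ℕ} {S T : Matrix (Fin n) (Fin n) ℝ}

/-! The covariance steering problem is not convex in the gains, but it has a hidden convexity in the
pairs of covariances `C` and products `K C`. Mix two controllers by averaging the nominal controls,
the covariances and the products `K C`, and let `mixGain` be the quotient of the averaged product by
the averaged covariance. By a variance decomposition (`mix_identity`), the mixed controller has
covariances below the averaged ones (`covSeq_mix_le`) and costs at most the averaged cost
(`ctrlCost_mix_le`). The terminal bound is an inequality, so it survives.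

The feasible points of the square root formulation are exactly the admissible controllers with
positive definite covariances (`isCholesky_covSeq`, `ofController_mem`). Hence from a feasible `z`
there starts, towards any admissible controller, a curve `mixPath` of feasible points on which the
cost falls at least linearly in `t` if that controller is cheaper. A local minimizer can therefore
not be beaten.

For termination with tolerances zero, `ΔJ = 0` and acceptance force `ΔL = 0`, so the reference point
already attains the optimal value of its subproblem. Strict convexity in `(v, L, ξ)`, together with
the recursions for `μ` and `S`, shows that the solution is the reference point (`SolvesSub.eq_ref`).
Since the `R` factor has the first-order expansion `IsQR.expansion`, the curve leaves only a slack
`O(t²)` in the linearized dynamics. A cheaper controller would thus gain order `t` in the subproblem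
at a penalty of order `t²`, which is impossible.

For limits, weights and multipliers may be unbounded, so small slacks need not have small penalties.
The competitor is instead `linVars`, which follows the linearized dynamics with the very slack of
the subproblem solution, so that the penalties cancel. It deviates from the curve by `O(t²)`, which
could violate the terminal bound; a strictly feasible target (`exists_strict_better`) supplies a
margin of order `t`. With `t` fixed, all constraints of the competitor hold strictly or identically
and persist near the limit, where its lower cost is a contradiction. -/

theorem isLT_iff_blockTriangular : IsLT S ↔ S.BlockTriangular OrderDual.toDual :=
  Iff.rfl

theorem IsLT.mul (hS : IsLT S) (hT : IsLT T) : IsLT (S * T) :=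
  isLT_iff_blockTriangular.2 (BlockTriangular.mul hS hT)

theorem IsLT.mul_diag (hS : IsLT S) (hT : IsLT T) (i : Fin n) :
    (S * T) i i = S i i * T i i := by
  rw [Matrix.mul_apply]
  refine Finset.sum_eq_single i (fun j _ hj => ?_) (by simp)
  rcases lt_or_gt_of_ne hj with h | h
  · rw [hT j i h, mul_zero]
  · rw [hS i j h, zero_mul]

theorem IsLT.det (hS : IsLT S) : S.det = ∏ i, S i i :=
  det_of_isLowerTriangular S hS

theorem IsLT.isUnit_det (hS : IsLT S) (hd : ∀ i, S i i ≠ 0) : IsUnit S.det := by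
  rw [hS.det]
  exact isUnit_iff_ne_zero.2 (Finset.prod_ne_zero_iff.2 fun i _ => hd i)

theorem IsLT.inv (hS : IsLT S) (hu : IsUnit S.det) : IsLT S⁻¹ := by
  have := S.invertibleOfIsUnitDet hu
  exact blockTriangular_inv_of_blockTriangular (b := OrderDual.toDual) hS

theorem IsLT.diagonal (d : Fin n → ℝ) : IsLT (diagonal d) :=
  fun _ _ h => diagonal_apply_ne _ h.ne

/-- The inverse is lower triangular and equals the upper triangular transpose, so the matrix is
diagonal with square one. -/
theorem IsLT.eq_one (hS : IsLT S) (hd : ∀ i, 0 ≤ S i i) (h : S * Sᵀ = 1) : S = 1 := by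
  have hu : IsUnit S.det := by
    have := congrArg Matrix.det h
    rw [det_mul, det_transpose, det_one] at this
    exact IsUnit.of_mul_eq_one _ this
  have hinv : S⁻¹ = Sᵀ := inv_eq_right_inv h
  have hT : IsLT Sᵀ := hinv ▸ hS.inv hu
  ext i j
  rcases lt_trichotomy i j with hij | rfl | hij
  · rw [hS i j hij, one_apply_ne hij.ne]
  · have h1 := hS.mul_diag hT i
    rw [h, one_apply_eq, transpose_apply] at h1
    rw [one_apply_eq]
    nlinarith [hd i]
  · rw [one_apply_ne hij.ne', ← transpose_apply S, hT j i hij]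

/-- Uniqueness of the Cholesky factor, among triangular factors with nonnegative diagonal. -/
theorem IsLT.eq_of_mul_transpose_eq (hS : IsLT S) (hSd : ∀ i, 0 < S i i) (hT : IsLT T)
    (hTd : ∀ i, 0 ≤ T i i) (h : T * Tᵀ = S * Sᵀ) : T = S := by
  have hu : IsUnit S.det := hS.isUnit_det fun i => (hSd i).ne'
  have hW : IsLT (S⁻¹ * T) := (hS.inv hu).mul hT
  have hSW : S * (S⁻¹ * T) = T := mul_nonsing_inv_cancel_left _ _ hu
  -- `S⁻¹ T` is triangular and orthogonal, with nonnegative diagonal.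
  have h1 : S⁻¹ * T = 1 := by
    refine hW.eq_one (fun i => ?_) ?_
    · have h2 := hS.mul_diag hW i
      rw [hSW] at h2
      exact nonneg_of_mul_nonneg_right (h2 ▸ hTd i) (hSd i)
    · rw [transpose_mul, transpose_nonsing_inv, Matrix.mul_assoc, ← Matrix.mul_assoc T, h,
        Matrix.mul_assoc, mul_nonsing_inv _ (by rwa [det_transpose]), Matrix.mul_one,
        nonsing_inv_mul _ hu]
  rw [← hSW, h1, Matrix.mul_one]

theorem IsCholesky.isUnit_det {P : Matrix (Fin n) (Fin n) ℝ} (hS : IsCholesky P S) :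
    IsUnit S.det :=
  hS.lower.isUnit_det fun i => (hS.diag_pos i).ne'

theorem posDef_mul_transpose_of_isUnit (hu : IsUnit S.det) : (S * Sᵀ).PosDef := by
  have := PosDef.mul_conjTranspose_self S
    (Matrix.vecMul_injective_iff_isUnit.2 ((Matrix.isUnit_iff_isUnit_det S).2 hu))
  rwa [conjTranspose_eq_transpose_of_trivial] at this

theorem IsCholesky.posDef {P : Matrix (Fin n) (Fin n) ℝ} (hS : IsCholesky P S) : P.PosDef :=
  hS.eq ▸ posDef_mul_transpose_of_isUnit hS.isUnit_det

/-- Rescaling the columns of the triangular factor in the LDL decomposition absorbs the square root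
of the diagonal part. -/
theorem exists_isCholesky {P : Matrix (Fin n) (Fin n) ℝ} (hP : P.PosDef) :
    ∃ S, IsCholesky P S := by
  have hlow : IsLT (LDL.lowerInv hP) := fun i j h => LDL.lowerInv_triangular hP h
  have hu : IsUnit (LDL.lowerInv hP).det := (Matrix.isUnit_iff_isUnit_det _).1
    (isUnit_of_invertible _)
  have hdiag : (LDL.diag hP).PosDef := by
    rw [LDL.diag_eq_lowerInv_conj]
    exact hP.mul_mul_conjTranspose_same
      (Matrix.vecMul_injective_iff_isUnit.2 (isUnit_of_invertible _))
  have hpos : ∀ i, 0 < LDL.diagEntries hP i := posDef_diagonal_iff.1 hdiag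
  set L := LDL.lower hP with hL
  have hLlt : IsLT L := hlow.inv hu
  have hLu : L.det ≠ 0 := by
    rw [hL, LDL.lower, det_nonsing_inv]
    rw [Ring.inverse_eq_inv']
    exact inv_ne_zero hu.ne_zero
  have hLd : ∀ i, L i i ≠ 0 := by
    rw [hLlt.det] at hLu
    exact fun i => Finset.prod_ne_zero_iff.1 hLu i (Finset.mem_univ i)
  -- The signs make the new diagonal positive and drop out of `d i * d i`; nothing about the
  -- diagonal of `L` is needed except that it does not vanish.
  set d : Fin n → ℝ := fun i => √(LDL.diagEntries hP i) * SignType.sign (L i i) with hd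
  refine ⟨L * diagonal d, hLlt.mul (IsLT.diagonal d), fun i => ?_, ?_⟩
  · rw [hLlt.mul_diag (IsLT.diagonal d), diagonal_apply_eq, hd]
    have h1 : L i i * (SignType.sign (L i i) : ℝ) = |L i i| := by
      rw [mul_comm, sign_mul_self]
    calc (0:ℝ) < √(LDL.diagEntries hP i) * |L i i| :=
          mul_pos (Real.sqrt_pos.2 (hpos i)) (abs_pos.2 (hLd i))
      _ = _ := by rw [← h1]; ring
  · rw [transpose_mul, diagonal_transpose, Matrix.mul_assoc, ← Matrix.mul_assoc (diagonal d),
      diagonal_mul_diagonal]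
    have h2 : (fun i => d i * d i) = LDL.diagEntries hP := by
      ext i
      have h3 : (SignType.sign (L i i) : ℝ) * SignType.sign (L i i) = 1 := by
        rcases lt_or_gt_of_ne (hLd i) with h | h
        · simp [sign_neg h]
        · simp [sign_pos h]
      have h4 := Real.mul_self_sqrt (hpos i).le
      calc d i * d i = (√(LDL.diagEntries hP i) * √(LDL.diagEntries hP i)) *
            ((SignType.sign (L i i) : ℝ) * SignType.sign (L i i)) := by rw [hd]; ring
        _ = _ := by rw [h3, h4, mul_one]
    rw [h2]
    have h5 := LDL.lower_conj_diag hP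
    rw [conjTranspose_eq_transpose_of_trivial, Matrix.mul_assoc] at h5
    exact h5.symm

theorem isCholesky_chol {P : Matrix (Fin n) (Fin n) ℝ} (hP : P.PosDef) :
    IsCholesky P (chol P) :=
  Classical.epsilon_spec (exists_isCholesky hP)

end Triangular

/-! ## Topology of matrices, entrywise -/

section Topology

variable {α : Type*} {l : Filter α}

theorem tendsto_matrix_iff {m n : Type*} {f : α → Matrix m n ℝ} {M : Matrix m n ℝ} :
    Tendsto f l (𝓝 M) ↔ ∀ i j, Tendsto (fun a => f a i j) l (𝓝 (M i j)) := by
  exact tendsto_pi_nhds.trans (forall_congr' fun i => tendsto_pi_nhds)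

theorem tendsto_mul {m n k : Type*} [Fintype n] {f : α → Matrix m n ℝ} {g : α → Matrix n k ℝ}
    {M : Matrix m n ℝ} {M' : Matrix n k ℝ} (hf : Tendsto f l (𝓝 M)) (hg : Tendsto g l (𝓝 M')) :
    Tendsto (fun a => f a * g a) l (𝓝 (M * M')) :=
  ((continuous_fst.matrix_mul continuous_snd).tendsto (M, M')).comp (hf.prodMk_nhds hg)

theorem tendsto_transpose {m n : Type*} {f : α → Matrix m n ℝ} {M : Matrix m n ℝ}
    (hf : Tendsto f l (𝓝 M)) : Tendsto (fun a => (f a)ᵀ) l (𝓝 Mᵀ) :=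
  (continuous_id.matrix_transpose.tendsto M).comp hf

theorem tendsto_matrix_inv {n : Type*} [Fintype n] [DecidableEq n] {f : α → Matrix n n ℝ}
    {M : Matrix n n ℝ} (hf : Tendsto f l (𝓝 M)) (hM : IsUnit M.det) :
    Tendsto (fun a => (f a)⁻¹) l (𝓝 M⁻¹) := by
  have hdet : Tendsto (fun a => (f a).det) l (𝓝 M.det) :=
    (continuous_id.matrix_det.tendsto M).comp hf
  have hadj : Tendsto (fun a => (f a).adjugate) l (𝓝 M.adjugate) :=
    (continuous_id.matrix_adjugate.tendsto M).comp hf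
  have := (hdet.inv₀ hM.ne_zero).smul hadj
  simpa only [Matrix.inv_def, Ring.inverse_eq_inv'] using this

theorem tendsto_mulVec {m n : Type*} [Fintype n] {f : α → Matrix m n ℝ} {g : α → n → ℝ}
    {M : Matrix m n ℝ} {x : n → ℝ} (hf : Tendsto f l (𝓝 M)) (hg : Tendsto g l (𝓝 x)) :
    Tendsto (fun a => f a *ᵥ g a) l (𝓝 (M *ᵥ x)) :=
  ((continuous_fst.matrix_mulVec continuous_snd).tendsto (M, x)).comp (hf.prodMk_nhds hg)

/-- Positive semidefiniteness passes to limits. -/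
theorem posSemidef_of_tendsto {n : Type*} [Fintype n] [l.NeBot] {f : α → Matrix n n ℝ}
    {M : Matrix n n ℝ} (hf : Tendsto f l (𝓝 M)) (h : ∀ᶠ a in l, (f a).PosSemidef) :
    M.PosSemidef := by
  refine .of_dotProduct_mulVec_nonneg ?_ fun x => ?_
  · have h1 := tendsto_transpose hf
    refine tendsto_nhds_unique_of_eventuallyEq h1 hf (h.mono fun a ha => ?_)
    have := ha.1
    rwa [IsHermitian, conjTranspose_eq_transpose_of_trivial] at this
  · have h1 : Tendsto (fun a => star x ⬝ᵥ (f a *ᵥ x)) l (𝓝 (star x ⬝ᵥ (M *ᵥ x))) :=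
      ((continuous_const.dotProduct
        (continuous_id.matrix_mulVec continuous_const)).tendsto M).comp hf
    exact ge_of_tendsto h1 (h.mono fun a ha => ha.dotProduct_mulVec_nonneg x)

/-- Positive definiteness is an open condition among symmetric matrices. -/
theorem eventually_posDef {n : Type*} [Fintype n] {f : α → Matrix n n ℝ}
    {M : Matrix n n ℝ} (hf : Tendsto f l (𝓝 M)) (hM : M.PosDef)
    (hsymm : ∀ᶠ a in l, (f a).IsHermitian) : ∀ᶠ a in l, (f a).PosDef := by
  have hK : IsCompact (Metric.sphere (0 : n → ℝ) 1) := isCompact_sphere 0 1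
  have hc : Continuous fun q : Matrix n n ℝ × (n → ℝ) => q.2 ⬝ᵥ (q.1 *ᵥ q.2) :=
    continuous_snd.dotProduct (continuous_fst.matrix_mulVec continuous_snd)
  -- Compactness of the unit sphere gives one neighbourhood of `M` that works for all unit vectors;
  -- homogeneity does the rest.
  have h1 : ∀ᶠ A in 𝓝 M, ∀ x ∈ Metric.sphere (0 : n → ℝ) 1, 0 < x ⬝ᵥ (A *ᵥ x) := by
    refine hK.eventually_forall_of_forall_eventually fun x hx => ?_
    refine hc.continuousAt.eventually_const_lt ?_
    have := hM.dotProduct_mulVec_pos (x := x) (by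
      rintro rfl
      simp at hx)
    simpa using this
  filter_upwards [hf.eventually h1, hsymm] with a ha hs
  refine .of_dotProduct_mulVec_pos hs fun x hx => ?_
  have hn : 0 < ‖x‖ := norm_pos_iff.2 hx
  have h2 := ha (‖x‖⁻¹ • x) (by simp [norm_smul, hn.ne'])
  rw [mulVec_smul, dotProduct_smul, smul_dotProduct, smul_eq_mul, smul_eq_mul] at h2
  have h3 : 0 < ‖x‖⁻¹ := inv_pos.2 hn
  simpa using pos_of_mul_pos_right (pos_of_mul_pos_right h2 h3.le) h3.le

/-- Continuity of the Cholesky factor. -/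
theorem tendsto_of_mul_transpose {n : ℕ} {f : α → Matrix (Fin n) (Fin n) ℝ}
    {S : Matrix (Fin n) (Fin n) ℝ} (hS : IsLT S) (hSd : ∀ i, 0 < S i i)
    (hf : ∀ᶠ a in l, IsLT (f a) ∧ ∀ i, 0 ≤ f a i i)
    (hlim : Tendsto (fun a => f a * (f a)ᵀ) l (𝓝 (S * Sᵀ))) : Tendsto f l (𝓝 S) := by
  -- The summand 1 makes `c` strictly larger than each diagonal entry, and `1 ≤ c` turns `x² < c`
  -- into `|x| ≤ c`.
  set c : ℝ := ∑ i, |(S * Sᵀ) i i| + 1 with hc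
  have hc1 : 1 ≤ c := by
    have : 0 ≤ ∑ i, |(S * Sᵀ) i i| := Finset.sum_nonneg fun i _ => abs_nonneg _
    linarith
  let K : Set (Matrix (Fin n) (Fin n) ℝ) :=
    Set.pi Set.univ fun _ => Set.pi Set.univ fun _ => Set.Icc (-c) c
  have hK : IsCompact K := isCompact_univ_pi fun _ => isCompact_univ_pi fun _ => isCompact_Icc
  have hbd : ∀ᶠ a in l, f a ∈ K := by
    have h1 : ∀ᶠ a in l, ∀ i, (f a * (f a)ᵀ) i i < c := by
      refine eventually_all.2 fun i => ?_
      refine (tendsto_matrix_iff.1 hlim i i).eventually_lt_const ?_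
      have h3 := Finset.single_le_sum (f := fun i => |(S * Sᵀ) i i|)
        (fun i _ => abs_nonneg _) (Finset.mem_univ i)
      have h4 := le_abs_self ((S * Sᵀ) i i)
      exact (h4.trans h3).trans_lt (by linarith)
    filter_upwards [h1] with a ha i _ j _
    have h2 : f a i j ^ 2 ≤ (f a * (f a)ᵀ) i i := by
      rw [Matrix.mul_apply]
      have := Finset.single_le_sum (f := fun k => f a i k * (f a)ᵀ k i)
        (fun k _ => mul_self_nonneg (f a i k)) (Finset.mem_univ j)
      simpa [sq] using this
    have h3 := ha i
    exact abs_le.1 (abs_le_of_sq_le_sq (by nlinarith) (by linarith))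
  -- The values stay in a compact box, and a cluster point is again a triangular factor of `S * Sᵀ`
  -- with nonnegative diagonal, hence equals `S`.
  refine hK.tendsto_nhds_of_unique_mapClusterPt hbd fun T _ hT => ?_
  have hsq : T * Tᵀ = S * Sᵀ := by
    have hcont : Continuous fun A : Matrix (Fin n) (Fin n) ℝ => A * Aᵀ :=
      continuous_id.matrix_mul continuous_id.matrix_transpose
    have h1 : MapClusterPt (T * Tᵀ) l (fun a => f a * (f a)ᵀ) :=
      hT.continuousAt_comp (f := fun A : Matrix (Fin n) (Fin n) ℝ => A * Aᵀ) hcont.continuousAt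
    have : (𝓝 (T * Tᵀ) ⊓ 𝓝 (S * Sᵀ)).NeBot := NeBot.mono h1 (inf_le_inf_left _ hlim)
    exact eq_of_nhds_neBot this
  have hclosed : IsClosed {A : Matrix (Fin n) (Fin n) ℝ | IsLT A ∧ ∀ i, 0 ≤ A i i} := by
    have hcc : ∀ i j, Continuous fun A : Matrix (Fin n) (Fin n) ℝ => A i j :=
      fun i j => continuous_id.matrix_elem i j
    simp only [IsLT, Set.ofPred_and, Set.ofPred_forall]
    refine IsClosed.inter ?_ (isClosed_iInter fun i => isClosed_le continuous_const (hcc i i))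
    exact isClosed_iInter fun i => isClosed_iInter fun j => isClosed_iInter fun _ =>
      isClosed_eq (hcc i j) continuous_const
  have hTm : IsLT T ∧ ∀ i, 0 ≤ T i i :=
    hclosed.mem_of_mapClusterPt hT hf
  exact hS.eq_of_mul_transpose_eq hSd hTm.1 hTm.2 hsq

end Topology

/-! ## QR factors -/

section QR

variable {ι : Type*} [Fintype ι] {n : ℕ} {M Q : Matrix ι (Fin n) ℝ}
  {R : Matrix (Fin n) (Fin n) ℝ}

theorem IsQR.isLT (h : IsQR M Q R) : IsLT Rᵀ :=
  fun i j hij => h.upper j i hij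

theorem IsQR.gram (h : IsQR M Q R) : Mᵀ * M = Rᵀ * R := by
  rw [h.eq, transpose_mul, Matrix.mul_assoc, ← Matrix.mul_assoc Qᵀ, h.orth, Matrix.one_mul]

theorem IsQR.isUnit_det (h : IsQR M Q R) : IsUnit R.det := by
  rw [← det_transpose]
  exact h.isLT.isUnit_det fun i => (h.diag_pos i).ne'

theorem IsQR.eq_mul_inv (h : IsQR M Q R) : Q = M * R⁻¹ := by
  rw [h.eq, mul_nonsing_inv_cancel_right _ _ h.isUnit_det]

theorem IsQR.unique {Q' : Matrix ι (Fin n) ℝ} {R' : Matrix (Fin n) (Fin n) ℝ}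
    (h : IsQR M Q R) (h' : IsQR M Q' R') : Q' = Q ∧ R' = R := by
  have hR : R' = R := by
    refine transpose_injective (h.isLT.eq_of_mul_transpose_eq h.diag_pos h'.isLT
      (fun i => (h'.diag_pos i).le) ?_)
    rw [transpose_transpose, transpose_transpose, ← h.gram, ← h'.gram]
  exact ⟨by rw [h.eq_mul_inv, h'.eq_mul_inv, hR], hR⟩

theorem IsQR.isQR_qrPair (h : IsQR M Q R) : IsQR M (qrQ M) (qrR M) :=
  Classical.epsilon_spec (p := fun T : Matrix ι (Fin n) ℝ × Matrix (Fin n) (Fin n) ℝ =>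
    IsQR M T.1 T.2) ⟨(Q, R), h⟩

theorem IsQR.qrQ_eq (h : IsQR M Q R) : qrQ M = Q := (h.unique h.isQR_qrPair).1

theorem IsQR.qrR_eq (h : IsQR M Q R) : qrR M = R := (h.unique h.isQR_qrPair).2

/-- The orthonormal factor can only be `M Sᵀ⁻¹`, and the Gram identity says exactly that its columns
are orthonormal. So `R` factors are transposed Cholesky factors of Gram matrices. -/
theorem isQR_of_gram {S : Matrix (Fin n) (Fin n) ℝ} (hS : IsLT S) (hd : ∀ i, 0 < S i i)
    (h : Mᵀ * M = S * Sᵀ) : IsQR M (M * Sᵀ⁻¹) Sᵀ := by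
  have hu : IsUnit S.det := hS.isUnit_det fun i => (hd i).ne'
  have hu' : IsUnit Sᵀ.det := by rwa [det_transpose]
  refine ⟨?_, fun i j hij => hS j i hij, hd, ?_⟩
  · rw [transpose_mul, transpose_nonsing_inv, transpose_transpose, Matrix.mul_assoc,
      ← Matrix.mul_assoc Mᵀ, h, Matrix.mul_assoc, mul_nonsing_inv _ hu', Matrix.mul_one,
      nonsing_inv_mul _ hu]
  · rw [nonsing_inv_mul_cancel_right _ _ hu']

theorem posDef_mul_transpose_of_rank {X : Matrix (Fin n) ι ℝ} (h : X.rank = n) :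
    (X * Xᵀ).PosDef := by
  have := PosDef.mul_conjTranspose_self X (by
    rw [vecMul_injective_iff]
    rw [linearIndependent_iff_card_eq_finrank_span, Set.finrank, ← rank_eq_finrank_span_row, h,
      Fintype.card_fin])
  rwa [conjTranspose_eq_transpose_of_trivial] at this

theorem isQR_qr_of_rank {X : Matrix (Fin n) ι ℝ} (h : X.rank = n) :
    IsQR Xᵀ (qrQ Xᵀ) (qrR Xᵀ) := by
  have hc := isCholesky_chol (posDef_mul_transpose_of_rank h)
  exact (isQR_of_gram hc.lower hc.diag_pos (by rw [transpose_transpose, ← hc.eq])).isQR_qrPair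

theorem strictLower_zero : strictLower (0 : Matrix (Fin n) (Fin n) ℝ) = 0 := by
  ext i j
  simp [strictLower]

theorem dR_zero : dR 0 Q R = 0 := by
  simp [dR, strictLower_zero]

theorem strictLower_sub (A B : Matrix (Fin n) (Fin n) ℝ) :
    strictLower (A - B) = strictLower A - strictLower B := by
  ext i j
  simp only [strictLower, of_apply, Matrix.sub_apply]
  split_ifs <;> simp

theorem dR_sub (M₁ M₂ : Matrix ι (Fin n) ℝ) : dR (M₁ - M₂) Q R = dR M₁ Q R - dR M₂ Q R := by
  simp only [dR, Matrix.mul_sub, Matrix.sub_mul, strictLower_sub, transpose_sub]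
  abel

theorem strictLower_smul (c : ℝ) (A : Matrix (Fin n) (Fin n) ℝ) :
    strictLower (c • A) = c • strictLower A := by
  ext i j
  simp [strictLower]

theorem dR_smul (c : ℝ) (M₁ : Matrix ι (Fin n) ℝ) : dR (c • M₁) Q R = c • dR M₁ Q R := by
  simp only [dR, Matrix.mul_smul, Matrix.smul_mul, strictLower_smul, transpose_smul, smul_sub,
    Matrix.sub_mul]

theorem tendsto_dR {α : Type*} {l : Filter α} {f g : α → Matrix ι (Fin n) ℝ}
    {r : α → Matrix (Fin n) (Fin n) ℝ} (hf : Tendsto f l (𝓝 M)) (hg : Tendsto g l (𝓝 Q))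
    (hr : Tendsto r l (𝓝 R)) (hR : IsUnit R.det) :
    Tendsto (fun a => dR (f a) (g a) (r a)) l (𝓝 (dR M Q R)) := by
  have h1 := tendsto_mul (tendsto_transpose hg) hf
  have h2 := tendsto_mul h1 (tendsto_matrix_inv hr hR)
  have h3 : Tendsto (fun a => strictLower ((g a)ᵀ * f a * (r a)⁻¹)) l
      (𝓝 (strictLower (Qᵀ * M * R⁻¹))) := by
    refine tendsto_matrix_iff.2 fun i j => ?_
    by_cases hij : j < i
    · simpa [strictLower, hij] using tendsto_matrix_iff.1 h2 i j
    · simpa [strictLower, hij] using tendsto_const_nhds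
  exact h1.sub (tendsto_mul (h3.sub (tendsto_transpose h3)) hr)

end QR

/-! ## Entrywise asymptotics -/

section Asymptotics

open Asymptotics

variable {α : Type*} {l : Filter α} {m n k : Type*}

/-- The entries of a matrix-valued function are `O(g)`. -/
def EntryO (l : Filter α) (f : α → Matrix m n ℝ) (g : α → ℝ) : Prop :=
  ∀ i j, (fun a => f a i j) =O[l] g

variable {f f' : α → Matrix m n ℝ} {g g' : α → ℝ}

theorem EntryO.add (hf : EntryO l f g) (hf' : EntryO l f' g) :
    EntryO l (fun a => f a + f' a) g :=
  fun i j => (hf i j).add (hf' i j)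

theorem EntryO.sub (hf : EntryO l f g) (hf' : EntryO l f' g) :
    EntryO l (fun a => f a - f' a) g :=
  fun i j => (hf i j).sub (hf' i j)

theorem EntryO.transpose (hf : EntryO l f g) : EntryO l (fun a => (f a)ᵀ) g :=
  fun i j => hf j i

theorem EntryO.trans (hf : EntryO l f g) (hg : g =O[l] g') : EntryO l f g' :=
  fun i j => (hf i j).trans hg

theorem EntryO.mul_mul [Fintype n] {h : α → Matrix n k ℝ} (hf : EntryO l f g)
    (hh : EntryO l h g') : EntryO l (fun a => f a * h a) (fun a => g a * g' a) := by
  intro i j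
  simp only [Matrix.mul_apply]
  exact IsBigO.fun_sum fun s _ => (hf i s).mul (hh s j)

theorem EntryO.of_tendsto {M : Matrix m n ℝ} (hf : Tendsto f l (𝓝 M)) :
    EntryO l f (fun _ => 1) :=
  fun i j => (tendsto_matrix_iff.1 hf i j).isBigO_one ℝ

theorem EntryO.mul_tendsto [Fintype n] {h : α → Matrix n k ℝ} {M : Matrix n k ℝ}
    (hf : EntryO l f g) (hh : Tendsto h l (𝓝 M)) : EntryO l (fun a => f a * h a) g := by
  simpa using hf.mul_mul (EntryO.of_tendsto hh)

theorem EntryO.tendsto_mul [Fintype n] {h : α → Matrix n k ℝ} {M : Matrix m n ℝ}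
    (hh : EntryO l h g) (hf : Tendsto f l (𝓝 M)) : EntryO l (fun a => f a * h a) g := by
  simpa using (EntryO.of_tendsto hf).mul_mul hh

theorem EntryO.mul_const [Fintype n] (hf : EntryO l f g) (A : Matrix n k ℝ) :
    EntryO l (fun a => f a * A) g :=
  hf.mul_tendsto tendsto_const_nhds

theorem EntryO.const_mul [Fintype m] (hf : EntryO l f g) (A : Matrix k m ℝ) :
    EntryO l (fun a => A * f a) g :=
  hf.tendsto_mul tendsto_const_nhds

theorem EntryO.tendsto_zero (hf : EntryO l f g) (hg : Tendsto g l (𝓝 0)) :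
    Tendsto f l (𝓝 0) :=
  tendsto_matrix_iff.2 fun i j => (hf i j).trans_tendsto hg

theorem EntryO.congr' (hf : EntryO l f g) (h : f =ᶠ[l] f') : EntryO l f' g :=
  fun i j => (hf i j).congr' (h.mono fun a ha => by simp only [ha]) EventuallyEq.rfl

end Asymptotics

/-! ## First-order expansion of the QR factor -/

section Expansion

open Asymptotics

variable {n : ℕ}

/-- The linear map inverting `F ↦ F + Fᵀ` on upper triangular matrices. -/
def upperHalf (H : Matrix (Fin n) (Fin n) ℝ) : Matrix (Fin n) (Fin n) ℝ :=
  Matrix.of fun i j => if i < j then H i j else if i = j then H i i / 2 else 0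

theorem upperHalf_add_transpose {F : Matrix (Fin n) (Fin n) ℝ} (hF : IsLT Fᵀ) :
    upperHalf (F + Fᵀ) = F := by
  ext i j
  simp only [upperHalf, of_apply, Matrix.add_apply, transpose_apply]
  split_ifs with h1 h2
  · rw [← transpose_apply F i j, hF i j h1, add_zero]
  · subst h2; ring
  · exact (hF j i (lt_of_le_of_ne (not_lt.1 h1) (Ne.symm h2))).symm

/-- This links the skew-symmetric correction in `dR` with solving the linearized Gram equation for a
triangular unknown. -/
theorem upperHalf_add_transpose' (C : Matrix (Fin n) (Fin n) ℝ) :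
    upperHalf (C + Cᵀ) = C - (strictLower C - (strictLower C)ᵀ) := by
  ext i j
  simp only [upperHalf, strictLower, of_apply, Matrix.add_apply, Matrix.sub_apply, transpose_apply]
  rcases lt_trichotomy i j with h | h | h
  · simp [h, h.not_gt]
  · subst h; simp
  · simp [h, h.not_gt, h.ne']

theorem upperHalf_add (A B : Matrix (Fin n) (Fin n) ℝ) :
    upperHalf (A + B) = upperHalf A + upperHalf B := by
  ext i j
  simp only [upperHalf, of_apply, Matrix.add_apply]
  split_ifs <;> ring

theorem upperHalf_sub (A B : Matrix (Fin n) (Fin n) ℝ) :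
    upperHalf (A - B) = upperHalf A - upperHalf B := by
  ext i j
  simp only [upperHalf, of_apply, Matrix.sub_apply]
  split_ifs <;> ring

theorem EntryO.upperHalf {α : Type*} {l : Filter α} {f : α → Matrix (Fin n) (Fin n) ℝ}
    {g : α → ℝ} (hf : EntryO l f g) : EntryO l (fun a => upperHalf (f a)) g := by
  intro i j
  simp only [CovSteer.upperHalf, of_apply]
  split_ifs
  · exact hf i j
  · simpa [div_eq_inv_mul] using (hf i i).const_mul_left (2⁻¹ : ℝ)
  · exact isBigO_zero _ _

/-- A triangular matrix function tending to zero is controlled by its linear part. -/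
theorem EntryO.of_eq_sub_quadratic {α : Type*} {l : Filter α}
    {F E : α → Matrix (Fin n) (Fin n) ℝ} {g : α → ℝ} (hF : Tendsto F l (𝓝 0))
    (hE : EntryO l E g)
    (h : ∀ᶠ a in l, F a = E a - CovSteer.upperHalf ((F a)ᵀ * F a)) : EntryO l F g := by
  set φ : α → ℝ := fun a => ∑ i, ∑ j, |F a i j| with hφ
  have hle : ∀ a i j, |F a i j| ≤ φ a := fun a i j =>
    (Finset.single_le_sum (f := fun j => |F a i j|) (fun _ _ => abs_nonneg _)
      (Finset.mem_univ j)).trans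
    (Finset.single_le_sum (f := fun i => ∑ j, |F a i j|)
      (fun _ _ => Finset.sum_nonneg fun _ _ => abs_nonneg _) (Finset.mem_univ i))
  have hφ0 : ∀ a, 0 ≤ φ a :=
    fun a => Finset.sum_nonneg fun _ _ => Finset.sum_nonneg fun _ _ => abs_nonneg _
  have hFφ : EntryO l F φ := fun i j => IsBigO.of_bound 1 (Eventually.of_forall fun a => by
    rw [Real.norm_eq_abs, Real.norm_eq_abs, abs_of_nonneg (hφ0 a), one_mul]
    exact hle a i j)
  have hφlim : Tendsto φ l (𝓝 0) := by
    have : Tendsto φ l (𝓝 (∑ _i : Fin n, ∑ _j : Fin n, |(0 : ℝ)|)) :=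
      tendsto_finsetSum _ fun i _ => tendsto_finsetSum _ fun j _ =>
        (tendsto_matrix_iff.1 hF i j).abs
    simpa using this
  have hN : EntryO l (fun a => CovSteer.upperHalf ((F a)ᵀ * F a)) (fun a => φ a * φ a) :=
    (hFφ.transpose.mul_mul hFφ).upperHalf
  -- Since `F` tends to zero, its quadratic term is negligible against `F` itself and can be
  -- absorbed into the left side.
  have hsq : (fun a => φ a * φ a) =o[l] φ := by
    have h1 : φ =o[l] (fun _ => (1 : ℝ)) := (isLittleO_one_iff ℝ).2 hφlim
    simpa using h1.mul_isBigO (isBigO_refl φ l)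
  have hν : (fun a => ∑ i, ∑ j, |CovSteer.upperHalf ((F a)ᵀ * F a) i j|) =o[l] φ :=
    IsLittleO.fun_sum fun i _ => IsLittleO.fun_sum fun j _ =>
      ((hN i j).trans_isLittleO hsq).abs_left
  have hp : (fun a => ∑ i, ∑ j, |E a i j|) =O[l] g :=
    IsBigO.fun_sum fun i _ => IsBigO.fun_sum fun j _ => (hE i j).abs_left
  have hφp : φ =O[l] fun a => ∑ i, ∑ j, |E a i j| := by
    -- The quadratic term is at most half of `φ`, hence the constant 2.
    refine IsBigO.of_bound 2 ?_
    filter_upwards [h, hν.bound (show (0 : ℝ) < 1 / 2 by norm_num)] with a ha hb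
    have h0 : 0 ≤ ∑ i, ∑ j, |E a i j| :=
      Finset.sum_nonneg fun _ _ => Finset.sum_nonneg fun _ _ => abs_nonneg _
    have h1 : φ a ≤ ∑ i, ∑ j, |E a i j| +
        ∑ i, ∑ j, |CovSteer.upperHalf ((F a)ᵀ * F a) i j| := by
      rw [← Finset.sum_add_distrib]
      refine Finset.sum_le_sum fun i _ => ?_
      rw [← Finset.sum_add_distrib]
      refine Finset.sum_le_sum fun j _ => ?_
      have h2 : F a i j = E a i j - CovSteer.upperHalf ((F a)ᵀ * F a) i j :=
        congrFun (congrFun ha i) j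
      rw [h2]
      exact abs_sub _ _
    rw [Real.norm_eq_abs, Real.norm_eq_abs, abs_of_nonneg (hφ0 a)] at hb ⊢
    rw [abs_of_nonneg h0]
    have h3 := le_abs_self (∑ i, ∑ j, |CovSteer.upperHalf ((F a)ᵀ * F a) i j|)
    linarith
  exact hFφ.trans (hφp.trans hp)

/-- First-order expansion of the triangular factor along a curve of matrices. -/
theorem IsQR.expansion {ι α : Type*} [Fintype ι] {l : Filter α} {M₀ Q₀ : Matrix ι (Fin n) ℝ}
    {R₀ : Matrix (Fin n) (Fin n) ℝ} (h₀ : IsQR M₀ Q₀ R₀) {M : α → Matrix ι (Fin n) ℝ}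
    {R : α → Matrix (Fin n) (Fin n) ℝ} {g : α → ℝ}
    (hR : ∀ᶠ a in l, IsLT (R a)ᵀ ∧ (∀ i, 0 ≤ R a i i) ∧ (R a)ᵀ * R a = (M a)ᵀ * M a)
    (hg : Tendsto g l (𝓝 0)) (hM : EntryO l (fun a => M a - M₀) g) :
    EntryO l (fun a => R a - R₀) g ∧
      EntryO l (fun a => R a - R₀ - dR (M a - M₀) Q₀ R₀) (fun a => g a * g a) := by
  have hu := h₀.isUnit_det
  have hMlim : Tendsto M l (𝓝 M₀) := by
    have := (hM.tendsto_zero hg).add_const M₀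
    simpa using this
  -- No differentiability is presupposed: continuity of the Cholesky factor yields `F → 0`, which
  -- starts the absorption argument.
  have hRlim : Tendsto R l (𝓝 R₀) := by
    have h1 : Tendsto (fun a => (R a)ᵀ) l (𝓝 R₀ᵀ) := by
      refine tendsto_of_mul_transpose h₀.isLT h₀.diag_pos
        (hR.mono fun a ha => ⟨ha.1, ha.2.1⟩) ?_
      have h2 : Tendsto (fun a => (M a)ᵀ * M a) l (𝓝 (M₀ᵀ * M₀)) :=
        CovSteer.tendsto_mul (tendsto_transpose hMlim) hMlim
      rw [h₀.gram] at h2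
      rw [transpose_transpose]
      refine h2.congr' (hR.mono fun a ha => ?_)
      simp only [transpose_transpose, ha.2.2]
    simpa using tendsto_transpose h1
  set F : α → Matrix (Fin n) (Fin n) ℝ := fun a => R a * R₀⁻¹ - 1 with hF
  set Dm : α → Matrix ι (Fin n) ℝ := fun a => (M a - M₀) * R₀⁻¹ with hDm
  set C : α → Matrix (Fin n) (Fin n) ℝ := fun a => Q₀ᵀ * Dm a with hC
  have hF0 : Tendsto F l (𝓝 0) := by
    have := (CovSteer.tendsto_mul hRlim (tendsto_const_nhds (x := R₀⁻¹))).sub_const 1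
    rwa [mul_nonsing_inv _ hu, sub_self] at this
  have hDO : EntryO l Dm g := hM.mul_const _
  have hCO : EntryO l C g := hDO.const_mul _
  have hinvLT : IsLT R₀⁻¹ᵀ := by
    rw [transpose_nonsing_inv]
    exact h₀.isLT.inv (by rwa [det_transpose])
  have hFeq : ∀ᶠ a in l, F a = (CovSteer.upperHalf (C a + (C a)ᵀ) +
      CovSteer.upperHalf ((Dm a)ᵀ * Dm a)) - CovSteer.upperHalf ((F a)ᵀ * F a) := by
    filter_upwards [hR] with a ha
    have hFLT : IsLT (F a)ᵀ := by
      intro i j hij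
      have h1 : IsLT (R a * R₀⁻¹)ᵀ := by
        rw [transpose_mul]
        exact hinvLT.mul ha.1
      simp only [hF, transpose_sub, transpose_one, Matrix.sub_apply]
      rw [h1 i j hij, one_apply_ne hij.ne, sub_zero]
    have hMa : M a * R₀⁻¹ = Q₀ + Dm a := by
      simp only [hDm]
      rw [Matrix.sub_mul, ← h₀.eq_mul_inv]
      abel
    have hE : R a * R₀⁻¹ = 1 + F a := by simp [hF]
    -- The Gram identity after normalization by `R₀⁻¹`. As `F` is upper triangular, `upperHalf`
    -- solves it for `F`, up to the quadratic term `Fᵀ F`.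
    have h2 : (1 + F a)ᵀ * (1 + F a) = (Q₀ + Dm a)ᵀ * (Q₀ + Dm a) := by
      rw [← hE, ← hMa, transpose_mul, transpose_mul, Matrix.mul_assoc, Matrix.mul_assoc,
        ← Matrix.mul_assoc _ (R a), ← Matrix.mul_assoc _ (M a), ha.2.2]
    have h3 : F a + (F a)ᵀ = (C a + (C a)ᵀ) + (Dm a)ᵀ * Dm a - (F a)ᵀ * F a := by
      simp only [transpose_add, transpose_one, Matrix.add_mul, Matrix.mul_add, Matrix.one_mul,
        Matrix.mul_one, h₀.orth] at h2
      simp only [hC, transpose_mul, transpose_transpose]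
      have h4 := sub_eq_zero.2 h2
      rw [← sub_eq_zero]
      rw [← h4]
      abel
    conv_lhs => rw [← upperHalf_add_transpose hFLT, h3, upperHalf_sub, upperHalf_add]
  have hg2 : (fun a => g a * g a) =O[l] g := by
    have h1 : g =O[l] (fun _ => (1 : ℝ)) := hg.isBigO_one ℝ
    simpa using h1.mul (isBigO_refl g l)
  have hDD : EntryO l (fun a => CovSteer.upperHalf ((Dm a)ᵀ * Dm a)) (fun a => g a * g a) :=
    (hDO.transpose.mul_mul hDO).upperHalf
  have hFO : EntryO l F g := by
    refine EntryO.of_eq_sub_quadratic hF0 ?_ hFeq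
    exact (hCO.add hCO.transpose).upperHalf.add (hDD.trans hg2)
  have hRF : ∀ a, R a - R₀ = F a * R₀ := by
    intro a
    simp only [hF]
    rw [Matrix.sub_mul, nonsing_inv_mul_cancel_right _ _ hu, Matrix.one_mul]
  refine ⟨?_, ?_⟩
  · simp only [hRF]
    exact hFO.mul_const _
  -- The remainder consists of the two quadratic terms; the linear term is `dR`.
  · have h5 : EntryO l (fun a => (CovSteer.upperHalf ((Dm a)ᵀ * Dm a) -
        CovSteer.upperHalf ((F a)ᵀ * F a)) * R₀) (fun a => g a * g a) :=
      (hDD.sub (hFO.transpose.mul_mul hFO).upperHalf).mul_const _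
    refine h5.congr' (hFeq.mono fun a ha => ?_)
    have h6 : dR (M a - M₀) Q₀ R₀ = CovSteer.upperHalf (C a + (C a)ᵀ) * R₀ := by
      rw [upperHalf_add_transpose', dR, Matrix.sub_mul]
      simp only [hC, hDm]
      rw [← Matrix.mul_assoc, Matrix.sub_mul, Matrix.sub_mul, nonsing_inv_mul_cancel_right _ _ hu]
    simp only
    rw [hRF, h6, ← Matrix.sub_mul]
    conv_rhs => rw [ha]
    congr 1
    abel

end Expansion

/-! ## The terminal covariance bound -/

section Terminal

variable {n : ℕ}

/-- `W` and `Wᵀ` have the same norm, and the quadratic form of `1 - W Wᵀ` is `‖x‖² - ‖Wᵀ x‖²`. -/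
theorem norm_toEuclideanCLM_le_one_iff (W : Matrix (Fin n) (Fin n) ℝ) :
    ‖Matrix.toEuclideanCLM (n := Fin n) (𝕜 := ℝ) W‖ ≤ 1 ↔ (1 - W * Wᵀ).PosSemidef := by
  have hstar : ‖Matrix.toEuclideanCLM (n := Fin n) (𝕜 := ℝ) W‖ =
      ‖Matrix.toEuclideanCLM (n := Fin n) (𝕜 := ℝ) Wᵀ‖ := by
    rw [← conjTranspose_eq_transpose_of_trivial, ← star_eq_conjTranspose, map_star,
      ContinuousLinearMap.star_eq_adjoint, LinearIsometryEquiv.norm_map]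
  have hx : ∀ x : Fin n → ℝ, x ⬝ᵥ ((1 - W * Wᵀ) *ᵥ x) = x ⬝ᵥ x - (Wᵀ *ᵥ x) ⬝ᵥ (Wᵀ *ᵥ x) := by
    intro x
    rw [sub_mulVec, one_mulVec, dotProduct_sub, ← mulVec_mulVec, dotProduct_mulVec x W,
      ← mulVec_transpose]
  have hn : ∀ x : EuclideanSpace ℝ (Fin n), ‖x‖ ^ 2 = x.ofLp ⬝ᵥ x.ofLp := by
    intro x
    rw [EuclideanSpace.real_norm_sq_eq]
    simp [dotProduct, sq]
  rw [hstar]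
  constructor
  · intro h
    refine .of_dotProduct_mulVec_nonneg ?_ fun x => ?_
    · rw [IsHermitian, conjTranspose_eq_transpose_of_trivial]
      simp
    · have h1 := (Matrix.toEuclideanCLM (n := Fin n) (𝕜 := ℝ) Wᵀ).le_of_opNorm_le h
        (WithLp.toLp 2 x)
      rw [one_mul, Matrix.toEuclideanCLM_toLp] at h1
      have h2 := pow_le_pow_left₀ (norm_nonneg _) h1 2
      rw [hn, hn] at h2
      simpa [hx] using h2
  · intro h
    refine ContinuousLinearMap.opNorm_le_bound _ zero_le_one fun x => ?_
    rw [one_mul]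
    refine (sq_le_sq₀ (norm_nonneg _) (norm_nonneg _)).1 ?_
    have h1 := h.dotProduct_mulVec_nonneg x.ofLp
    simp only [star_trivial, hx] at h1
    rw [hn, hn, Matrix.ofLp_toEuclideanCLM]
    linarith

/-- Congruence by the Cholesky factor of `P` carries `1 - W Wᵀ` to `P - S Sᵀ`. In this form the
bound is linear in the covariance, as the mixing argument requires. -/
theorem terminal_norm_iff {P S : Matrix (Fin n) (Fin n) ℝ} (hP : P.PosDef) :
    ‖Matrix.toEuclideanCLM (n := Fin n) (𝕜 := ℝ) ((chol P)⁻¹ * S)‖ - 1 ≤ 0 ↔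
      (P - S * Sᵀ).PosSemidef := by
  have hc := isCholesky_chol hP
  have hu := hc.isUnit_det
  have hu' : IsUnit (chol P)ᵀ.det := by rwa [det_transpose]
  rw [sub_nonpos, norm_toEuclideanCLM_le_one_iff]
  have h1 : P - S * Sᵀ =
      chol P * (1 - (chol P)⁻¹ * S * ((chol P)⁻¹ * S)ᵀ) * (chol P)ᵀ := by
    rw [Matrix.mul_sub, Matrix.sub_mul, Matrix.mul_one, ← hc.eq, transpose_mul,
      transpose_nonsing_inv, Matrix.mul_assoc, Matrix.mul_assoc, Matrix.mul_assoc,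
      Matrix.mul_assoc, nonsing_inv_mul _ hu', Matrix.mul_one, mul_nonsing_inv_cancel_left _ _ hu]
  rw [h1, ← conjTranspose_eq_transpose_of_trivial (chol P)]
  exact (((Matrix.isUnit_iff_isUnit_det _).2 hu).posSemidef_star_right_conjugate_iff).symm

end Terminal

set_option linter.unusedSectionVars false

/-! ## Second moments of affine images of random vectors -/

section Moments

variable {Ω : Type*} [MeasurableSpace Ω] {P : Measure Ω} [IsProbabilityMeasure P]
  {d e f : ℕ}

/-- All coordinates are square integrable. -/
def SqInt (P : Measure Ω) (X : Ω → Fin d → ℝ) : Prop := ∀ i, MemLp (fun ω => X ω i) 2 P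

/-- The cross-covariance matrix of two random vectors. -/
def crossCov (P : Measure Ω) (X : Ω → Fin d → ℝ) (Y : Ω → Fin e → ℝ) :
    Matrix (Fin d) (Fin e) ℝ :=
  Matrix.of fun i j => cov[fun ω => X ω i, fun ω => Y ω j; P]

theorem crossCov_self (X : Ω → Fin d → ℝ) : crossCov P X X = covMat P X := rfl

theorem crossCov_transpose (X : Ω → Fin d → ℝ) (Y : Ω → Fin e → ℝ) :
    (crossCov P X Y)ᵀ = crossCov P Y X := by
  ext i j
  exact covariance_comm _ _

theorem sqInt_mulVec (F : Matrix (Fin e) (Fin d) ℝ) {X : Ω → Fin d → ℝ} (hX : SqInt P X) :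
    SqInt P (fun ω => F *ᵥ X ω) := by
  intro i
  simp only [mulVec, dotProduct]
  exact memLp_finsetSum _ fun j _ => (hX j).const_mul (F i j)

theorem sqInt_add {X Y : Ω → Fin d → ℝ} (hX : SqInt P X) (hY : SqInt P Y) :
    SqInt P (fun ω => X ω + Y ω) :=
  fun i => (hX i).add (hY i)

theorem sqInt_const (c : Fin d → ℝ) : SqInt P (fun _ => c) :=
  fun i => memLp_const (c i)

theorem meanVec_add {X Y : Ω → Fin d → ℝ} (hX : SqInt P X) (hY : SqInt P Y) :
    meanVec P (fun ω => X ω + Y ω) = meanVec P X + meanVec P Y := by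
  ext i
  exact integral_add ((hX i).integrable (by simp)) ((hY i).integrable (by simp))

theorem meanVec_const (c : Fin d → ℝ) : meanVec P (fun _ => c) = c := by
  ext i
  simp [meanVec]

theorem meanVec_mulVec (F : Matrix (Fin e) (Fin d) ℝ) {X : Ω → Fin d → ℝ} (hX : SqInt P X) :
    meanVec P (fun ω => F *ᵥ X ω) = F *ᵥ meanVec P X := by
  ext i
  simp only [meanVec, mulVec, dotProduct]
  rw [integral_finsetSum _ fun j _ => ((hX j).const_mul (F i j)).integrable (by simp)]
  exact Finset.sum_congr rfl fun j _ => integral_const_mul _ _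

theorem crossCov_add_left {X Y : Ω → Fin d → ℝ} {Z : Ω → Fin e → ℝ} (hX : SqInt P X)
    (hY : SqInt P Y) (hZ : SqInt P Z) :
    crossCov P (fun ω => X ω + Y ω) Z = crossCov P X Z + crossCov P Y Z := by
  ext i j
  exact covariance_add_left (hX i) (hY i) (hZ j)

theorem crossCov_const_left (c : Fin d → ℝ) (Z : Ω → Fin e → ℝ) :
    crossCov P (fun _ => c) Z = 0 := by
  ext i j
  exact covariance_const_left (c i)

theorem crossCov_mulVec_left (F : Matrix (Fin f) (Fin d) ℝ) {X : Ω → Fin d → ℝ}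
    {Z : Ω → Fin e → ℝ} (hX : SqInt P X) (hZ : SqInt P Z) :
    crossCov P (fun ω => F *ᵥ X ω) Z = F * crossCov P X Z := by
  ext i j
  simp only [crossCov, of_apply, mulVec, dotProduct, Matrix.mul_apply]
  rw [covariance_fun_sum_left (fun k => (hX k).const_mul (F i k)) (hZ j)]
  exact Finset.sum_congr rfl fun k _ => covariance_const_mul_left _

/-- Expectation of a quadratic form. -/
theorem integral_quadratic (Q : Matrix (Fin d) (Fin d) ℝ) {X : Ω → Fin d → ℝ}
    (hX : SqInt P X) :
    Integrable (fun ω => X ω ⬝ᵥ Q *ᵥ X ω) P ∧ ∫ ω, X ω ⬝ᵥ Q *ᵥ X ω ∂P =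
      meanVec P X ⬝ᵥ Q *ᵥ meanVec P X + (Q * covMat P X).trace := by
  have hexp : ∀ x : Fin d → ℝ, x ⬝ᵥ Q *ᵥ x = ∑ i, ∑ j, Q i j * (x j * x i) := by
    intro x
    simp only [dotProduct, mulVec, Finset.mul_sum]
    exact Finset.sum_congr rfl fun i _ => Finset.sum_congr rfl fun j _ => by ring
  have hint : ∀ i j, Integrable (fun ω => Q i j * (X ω j * X ω i)) P :=
    fun i j => ((hX j).integrable_mul (hX i)).const_mul _
  have hcov : ∀ i j, ∫ ω, X ω j * X ω i ∂P =
      covMat P X j i + meanVec P X j * meanVec P X i := by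
    intro i j
    have := covariance_eq_sub (hX j) (hX i)
    simp only [covMat, of_apply, meanVec]
    rw [this]
    simp only [Pi.mul_apply]
    ring
  simp only [hexp]
  refine ⟨integrable_finsetSum _ fun i _ => integrable_finsetSum _ fun j _ => hint i j, ?_⟩
  rw [integral_finsetSum _ fun i _ => integrable_finsetSum _ fun j _ => hint i j]
  simp only [Matrix.trace, Matrix.diag, Matrix.mul_apply, ← Finset.sum_add_distrib]
  refine Finset.sum_congr rfl fun i _ => ?_
  rw [integral_finsetSum _ fun j _ => hint i j]
  refine Finset.sum_congr rfl fun j _ => ?_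
  rw [integral_const_mul, hcov]
  ring

theorem sqInt_of_hasLaw {X : Ω → Fin d → ℝ} {μ : EuclideanSpace ℝ (Fin d)}
    {S : Matrix (Fin d) (Fin d) ℝ}
    (h : HasLaw (fun ω => WithLp.toLp 2 (X ω)) (multivariateGaussian μ S) P)
    (hS : S.PosSemidef) :
    SqInt P X ∧ meanVec P X = μ.ofLp ∧ covMat P X = S := by
  have hid : MemLp (fun x : EuclideanSpace ℝ (Fin d) => x) 2 (multivariateGaussian μ S) :=
    IsGaussian.memLp_two_id
  have hi : ∀ i, MemLp (fun x : EuclideanSpace ℝ (Fin d) => x i) 2 (multivariateGaussian μ S) :=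
    fun i => hid.eval_piLp i
  refine ⟨fun i => ?_, ?_, ?_⟩
  · have h1 := hi i
    rw [← h.map_eq] at h1
    exact h1.comp_of_map h.aemeasurable
  · ext i
    have h1 := h.integral_comp (f := fun x : EuclideanSpace ℝ (Fin d) => x i)
      (hi i).aestronglyMeasurable
    have h2 := eval_integral_piLp (fun i => (hi i).integrable (by simp)) i
    simp only [integral_id_multivariateGaussian] at h2
    rw [h2]
    exact h1
  · ext i j
    have h1 := h.covariance_comp (f := fun x : EuclideanSpace ℝ (Fin d) => x i)
      (g := fun x : EuclideanSpace ℝ (Fin d) => x j) (by fun_prop) (by fun_prop)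
    rw [covariance_eval_multivariateGaussian hS] at h1
    exact h1

theorem crossCov_eq_zero_of_indepFun {X : Ω → Fin d → ℝ} {Y : Ω → Fin e → ℝ} (hX : SqInt P X)
    (hY : SqInt P Y) (h : IndepFun X Y P) : crossCov P X Y = 0 := by
  ext i j
  exact (h.comp (measurable_pi_apply i) (measurable_pi_apply j)).covariance_eq_zero (hX i) (hY j)

end Moments

/-! ## Reduction to a deterministic problem -/

section Reduction

variable {N n m p : ℕ}

/-- The means under the nominal controls `v`. -/
def meanSeq (D : Problem N n m p) (v : Fin N → Fin m → ℝ) : Fin (N + 1) → Fin n → ℝ :=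
  fun k => Fin.induction (motive := fun _ => Fin n → ℝ) D.muInit
    (fun k x => D.A k *ᵥ x + D.B k *ᵥ v k) k

/-- The covariances under the gains `K`. -/
def covSeq (D : Problem N n m p) (K : Fin N → Matrix (Fin m) (Fin n) ℝ) :
    Fin (N + 1) → Matrix (Fin n) (Fin n) ℝ :=
  fun k => Fin.induction (motive := fun _ => Matrix (Fin n) (Fin n) ℝ) D.PInit
    (fun k C => (D.A k + D.B k * K k) * C * (D.A k + D.B k * K k)ᵀ + D.G k * (D.G k)ᵀ) k

variable (D : Problem N n m p)

@[simp]
theorem meanSeq_zero (v : Fin N → Fin m → ℝ) : meanSeq D v 0 = D.muInit := rfl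

theorem meanSeq_succ (v : Fin N → Fin m → ℝ) (k : Fin N) :
    meanSeq D v k.succ = D.A k *ᵥ meanSeq D v k.castSucc + D.B k *ᵥ v k := rfl

@[simp]
theorem covSeq_zero (K : Fin N → Matrix (Fin m) (Fin n) ℝ) : covSeq D K 0 = D.PInit := rfl

theorem covSeq_succ (K : Fin N → Matrix (Fin m) (Fin n) ℝ) (k : Fin N) :
    covSeq D K k.succ = (D.A k + D.B k * K k) * covSeq D K k.castSucc *
      (D.A k + D.B k * K k)ᵀ + D.G k * (D.G k)ᵀ := rfl

/-- The cost in terms of means and covariances. -/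
def ctrlCost (v : Fin N → Fin m → ℝ) (K : Fin N → Matrix (Fin m) (Fin n) ℝ) : ℝ :=
  ∑ k : Fin N, (meanSeq D v k.castSucc ⬝ᵥ D.Q k *ᵥ meanSeq D v k.castSucc +
    v k ⬝ᵥ D.R k *ᵥ v k + (D.Q k * covSeq D K k.castSucc).trace +
    (D.R k * (K k * covSeq D K k.castSucc * (K k)ᵀ)).trace)

variable {Ω : Type*} [MeasurableSpace Ω] {P : Measure Ω} [IsProbabilityMeasure P]

theorem control_eq (v : Fin m → ℝ) (K : Matrix (Fin m) (Fin n) ℝ) (X : Ω → Fin n → ℝ) :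
    control P v K X = fun ω => (v - K *ᵥ meanVec P X) + K *ᵥ X ω := by
  ext1 ω
  rw [control, mulVec_sub]
  abel

theorem control_moments (v : Fin m → ℝ) (K : Matrix (Fin m) (Fin n) ℝ) {X : Ω → Fin n → ℝ}
    (hX : SqInt P X) : SqInt P (control P v K X) ∧ meanVec P (control P v K X) = v ∧
      covMat P (control P v K X) = K * covMat P X * Kᵀ := by
  rw [control_eq]
  have hK := sqInt_mulVec K hX
  have hc := sqInt_const (P := P) (v - K *ᵥ meanVec P X)
  have hU := sqInt_add hc hK
  refine ⟨hU, ?_, ?_⟩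
  · rw [meanVec_add hc hK, meanVec_const, meanVec_mulVec K hX, sub_add_cancel]
  · have h1 : ∀ {e : ℕ} {Z : Ω → Fin e → ℝ}, SqInt P Z →
        crossCov P (fun ω => (v - K *ᵥ meanVec P X) + K *ᵥ X ω) Z = K * crossCov P X Z := by
      intro e Z hZ
      rw [crossCov_add_left hc hK hZ, crossCov_const_left, zero_add, crossCov_mulVec_left K hX hZ]
    rw [← crossCov_self, h1 hU, ← crossCov_transpose, h1 hX, transpose_mul,
      crossCov_transpose, crossCov_self, Matrix.mul_assoc]

/-- One step of the closed loop. -/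
theorem step_moments (A : Matrix (Fin n) (Fin n) ℝ) (B : Matrix (Fin n) (Fin m) ℝ)
    (G : Matrix (Fin n) (Fin p) ℝ) (v : Fin m → ℝ) (K : Matrix (Fin m) (Fin n) ℝ)
    {X : Ω → Fin n → ℝ} {W : Ω → Fin p → ℝ} (hX : SqInt P X) (hW : SqInt P W)
    (hW0 : meanVec P W = 0) (hW1 : covMat P W = 1) (hXW : crossCov P X W = 0)
    {Y : Ω → Fin n → ℝ} (hY : Y = fun ω => A *ᵥ X ω + B *ᵥ control P v K X ω + G *ᵥ W ω) :
    SqInt P Y ∧ meanVec P Y = A *ᵥ meanVec P X + B *ᵥ v ∧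
      covMat P Y = (A + B * K) * covMat P X * (A + B * K)ᵀ + G * Gᵀ ∧
      ∀ {e : ℕ} {Z : Ω → Fin e → ℝ}, SqInt P Z → crossCov P X Z = 0 → crossCov P W Z = 0 →
        crossCov P Y Z = 0 := by
  have hY' : Y = fun ω => (B *ᵥ (v - K *ᵥ meanVec P X) + (A + B * K) *ᵥ X ω) + G *ᵥ W ω := by
    rw [hY]
    ext1 ω
    rw [control_eq]
    simp only [mulVec_add, add_mulVec, ← mulVec_mulVec]
    abel
  have hc := sqInt_const (P := P) (B *ᵥ (v - K *ᵥ meanVec P X))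
  have hF := sqInt_mulVec (A + B * K) hX
  have hG := sqInt_mulVec G hW
  have hcF := sqInt_add hc hF
  have hYs : SqInt P Y := hY' ▸ sqInt_add hcF hG
  have h1 : ∀ {e : ℕ} {Z : Ω → Fin e → ℝ}, SqInt P Z →
      crossCov P Y Z = (A + B * K) * crossCov P X Z + G * crossCov P W Z := by
    intro e Z hZ
    rw [hY', crossCov_add_left hcF hG hZ, crossCov_add_left hc hF hZ, crossCov_const_left,
      zero_add, crossCov_mulVec_left _ hX hZ, crossCov_mulVec_left _ hW hZ]
  refine ⟨hYs, ?_, ?_, fun {e Z} hZ hXZ hWZ => ?_⟩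
  · rw [hY', meanVec_add hcF hG, meanVec_add hc hF, meanVec_const, meanVec_mulVec _ hX,
      meanVec_mulVec _ hW, hW0]
    simp only [mulVec_sub, add_mulVec, ← mulVec_mulVec, mulVec_zero]
    abel
  · have hWX : crossCov P W X = 0 := by rw [← crossCov_transpose, hXW, transpose_zero]
    have hXY : crossCov P X Y = covMat P X * (A + B * K)ᵀ := by
      rw [← crossCov_transpose, h1 hX, hWX, Matrix.mul_zero, add_zero, transpose_mul,
        crossCov_transpose, crossCov_self]
    have hWY : crossCov P W Y = Gᵀ := by
      rw [← crossCov_transpose, h1 hW, hXW, Matrix.mul_zero, zero_add, crossCov_self, hW1,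
        Matrix.mul_one]
    rw [← crossCov_self, h1 hYs, hXY, hWY, Matrix.mul_assoc]
  · rw [h1 hZ, hXZ, hWZ, Matrix.mul_zero, Matrix.mul_zero, add_zero]

variable {D}
variable {x₀ : Ω → Fin n → ℝ} {w : Fin N → Ω → Fin p → ℝ}

theorem IsNoise.noise_moments (h : IsNoise D P x₀ w) (k : Fin N) :
    SqInt P (w k) ∧ meanVec P (w k) = 0 ∧ covMat P (w k) = 1 := by
  have h1 := h.law_noise k
  rw [← multivariateGaussian_zero_one] at h1
  exact sqInt_of_hasLaw h1 PosSemidef.one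

/-- The induction carries only the first two moments and the vanishing correlation with the current
and later noises; independence is used for nothing else. -/
theorem IsNoise.state_moments (h : IsNoise D P x₀ w) (v : Fin N → Fin m → ℝ)
    (K : Fin N → Matrix (Fin m) (Fin n) ℝ) (k : Fin (N + 1)) :
    SqInt P (state D P x₀ w v K k) ∧ meanVec P (state D P x₀ w v K k) = meanSeq D v k ∧
      covMat P (state D P x₀ w v K k) = covSeq D K k ∧
      ∀ j : Fin N, k ≤ j.castSucc → crossCov P (state D P x₀ w v K k) (w j) = 0 := by
  induction k using Fin.induction with
  | zero =>
    obtain ⟨h1, h2, h3⟩ := sqInt_of_hasLaw h.law_init D.PInit_posDef.posSemidef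
    refine ⟨h1, h2, h3, fun j _ => ?_⟩
    exact crossCov_eq_zero_of_indepFun h1 (h.noise_moments j).1
      (h.indep_init.comp measurable_id (measurable_pi_apply j))
  | succ k ih =>
    obtain ⟨h1, h2, h3, h4⟩ := ih
    obtain ⟨hw1, hw2, hw3⟩ := h.noise_moments k
    obtain ⟨g1, g2, g3, g4⟩ := step_moments (D.A k) (D.B k) (D.G k) (v k) (K k) h1 hw1 hw2 hw3
      (h4 k le_rfl) (Y := state D P x₀ w v K k.succ) rfl
    refine ⟨g1, ?_, ?_, fun j hj => ?_⟩
    · rw [g2, h2, meanSeq_succ]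
    · rw [g3, h3, covSeq_succ]
    · have hkj : k < j := by
        rw [Fin.le_def] at hj
        rw [Fin.lt_def]
        simpa [Nat.succ_le_iff] using hj
      refine g4 (h.noise_moments j).1 (h4 j (Fin.castSucc_le_castSucc_iff.2 hkj.le)) ?_
      exact crossCov_eq_zero_of_indepFun hw1 (h.noise_moments j).1
        (h.indep_noise.indepFun hkj.ne)

theorem IsNoise.cost_eq (h : IsNoise D P x₀ w) (v : Fin N → Fin m → ℝ)
    (K : Fin N → Matrix (Fin m) (Fin n) ℝ) : cost D P x₀ w v K = ctrlCost D v K := by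
  refine Finset.sum_congr rfl fun k _ => ?_
  obtain ⟨h1, h2, h3, -⟩ := h.state_moments v K k.castSucc
  obtain ⟨g1, g2, g3⟩ := control_moments (v k) (K k) h1
  obtain ⟨i1, e1⟩ := integral_quadratic (D.Q k) h1
  obtain ⟨i2, e2⟩ := integral_quadratic (D.R k) g1
  rw [integral_add i1 i2, e1, e2, h2, h3, g2, g3, h3]
  ring

/-- Admissibility in terms of means and covariances. -/
theorem IsNoise.admissible_iff (h : IsNoise D P x₀ w) (v : Fin N → Fin m → ℝ)
    (K : Fin N → Matrix (Fin m) (Fin n) ℝ) : Admissible D P x₀ w v K ↔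
      meanSeq D v (Fin.last N) = D.muFin ∧
        (D.PFin - covSeq D K (Fin.last N)).PosSemidef := by
  obtain ⟨-, h2, h3, -⟩ := h.state_moments v K (Fin.last N)
  rw [Admissible, h2, h3]

end Reduction

/-! ## Square root variables and controllers -/

section Controllers

variable {N n m p : ℕ} {D : Problem N n m p}

theorem posSemidef_conj {d e : ℕ} {M : Matrix (Fin d) (Fin d) ℝ} (hM : M.PosSemidef)
    (F : Matrix (Fin e) (Fin d) ℝ) : (F * M * Fᵀ).PosSemidef := by
  have := hM.mul_mul_conjTranspose_same F
  rwa [conjTranspose_eq_transpose_of_trivial] at this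

theorem posSemidef_mul_transpose {d e : ℕ} (F : Matrix (Fin e) (Fin d) ℝ) :
    (F * Fᵀ).PosSemidef := by
  have := posSemidef_self_mul_conjTranspose F
  rwa [conjTranspose_eq_transpose_of_trivial] at this

theorem transpose_eq_of_posSemidef {d : ℕ} {M : Matrix (Fin d) (Fin d) ℝ}
    (hM : M.PosSemidef) : Mᵀ = M := by
  have := hM.1
  rwa [IsHermitian, conjTranspose_eq_transpose_of_trivial] at this

open scoped MatrixOrder Matrix.Norms.L2Operator in
-- With `Q = Bᴴ B`, the trace is that of the positive semidefinite matrix `B M Bᴴ`.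
theorem trace_mul_nonneg {d : ℕ} {Q M : Matrix (Fin d) (Fin d) ℝ} (hQ : Q.PosSemidef)
    (hM : M.PosSemidef) : 0 ≤ (Q * M).trace := by
  obtain ⟨B, rfl⟩ : ∃ B : Matrix (Fin d) (Fin d) ℝ, Q = Bᴴ * B :=
    CStarAlgebra.nonneg_iff_eq_star_mul_self.1 hQ.nonneg
  rw [Matrix.mul_assoc, trace_mul_comm]
  exact (hM.mul_mul_conjTranspose_same B).trace_nonneg

theorem covSeq_posSemidef (K : Fin N → Matrix (Fin m) (Fin n) ℝ) (k : Fin (N + 1)) :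
    (covSeq D K k).PosSemidef := by
  induction k using Fin.induction with
  | zero => exact D.PInit_posDef.posSemidef
  | succ k ih => exact (posSemidef_conj ih _).add (posSemidef_mul_transpose _)

theorem X_mul_transpose (z : Vars N n m) (k : Fin N) : X D z k * (X D z k)ᵀ =
    (D.A k * z.S k.castSucc + D.B k * z.L k) * (D.A k * z.S k.castSucc + D.B k * z.L k)ᵀ +
      D.G k * (D.G k)ᵀ := by
  rw [X, transpose_fromCols, fromCols_mul_fromRows]

theorem ConvexFeasible.meanSeq_eq {z : Vars N n m} (hz : ConvexFeasible D z) (k : Fin (N + 1)) :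
    meanSeq D z.v k = z.mu k := by
  induction k using Fin.induction with
  | zero => exact hz.init_mean.symm
  | succ k ih => rw [meanSeq_succ, ih, hz.mean_dyn]

theorem K_mul_S {z : Vars N n m} {k : Fin N} (hu : IsUnit (z.S k.castSucc).det) :
    z.K k * z.S k.castSucc = z.L k :=
  nonsing_inv_mul_cancel_right _ _ hu

/-- The Gram identity of the QR factorization is the closed-loop covariance recursion once `L = K
S`. The positive diagonal of each factor keeps `S` invertible, so that the gain of the next stage is
meaningful. -/
theorem isCholesky_covSeq {z : Vars N n m} (hz : z ∈ detFeasible D) (k : Fin (N + 1)) :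
    IsCholesky (covSeq D z.K k) (z.S k) := by
  induction k using Fin.induction with
  | zero =>
    rw [hz.1.init_cov]
    exact isCholesky_chol D.PInit_posDef
  | succ k ih =>
    obtain ⟨Q, hQ⟩ := hz.2 k
    refine ⟨hQ.isLT, hQ.diag_pos, ?_⟩
    have h1 := hQ.gram
    rw [transpose_transpose, transpose_transpose, X_mul_transpose] at h1
    rw [← h1, covSeq_succ, ih.eq, ← K_mul_S ih.isUnit_det, ← Matrix.mul_assoc (D.B k),
      ← Matrix.add_mul, transpose_mul]
    simp only [Matrix.mul_assoc]

theorem detCost_eq {z : Vars N n m} (hz : z ∈ detFeasible D) :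
    detCost D z = ctrlCost D z.v z.K := by
  refine Finset.sum_congr rfl fun k _ => ?_
  have hc := isCholesky_covSeq hz k.castSucc
  rw [hz.1.meanSeq_eq, hc.eq, ← K_mul_S hc.isUnit_det, transpose_mul]
  simp only [Matrix.mul_assoc]

/-- The terminal conditions in terms of means and covariances. -/
def TerminalOK (D : Problem N n m p) (v : Fin N → Fin m → ℝ)
    (K : Fin N → Matrix (Fin m) (Fin n) ℝ) : Prop :=
  meanSeq D v (Fin.last N) = D.muFin ∧ (D.PFin - covSeq D K (Fin.last N)).PosSemidef

theorem terminalOK_of_feasible {z : Vars N n m} (hz : z ∈ detFeasible D) :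
    TerminalOK D z.v z.K := by
  refine ⟨(hz.1.meanSeq_eq _).trans hz.1.terminal_mean, ?_⟩
  rw [(isCholesky_covSeq hz _).eq]
  exact (terminal_norm_iff D.PFin_posDef).1 hz.1.terminal_cov

/-- The square root variables of a controller. -/
def ofController (D : Problem N n m p) (v : Fin N → Fin m → ℝ)
    (K : Fin N → Matrix (Fin m) (Fin n) ℝ) : Vars N n m :=
  (v, fun k => K k * chol (covSeq D K k.castSucc), meanSeq D v, fun k => chol (covSeq D K k))

theorem ofController_X_mul_transpose {v : Fin N → Fin m → ℝ}
    {K : Fin N → Matrix (Fin m) (Fin n) ℝ} {k : Fin N} (h : (covSeq D K k.castSucc).PosDef) :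
    X D (ofController D v K) k * (X D (ofController D v K) k)ᵀ = covSeq D K k.succ := by
  rw [X_mul_transpose]
  change (D.A k * chol (covSeq D K k.castSucc) + D.B k * (K k * chol (covSeq D K k.castSucc))) *
    (D.A k * chol (covSeq D K k.castSucc) + D.B k * (K k * chol (covSeq D K k.castSucc)))ᵀ + _ = _
  rw [covSeq_succ]
  conv_rhs => rw [(isCholesky_chol h).eq]
  rw [← Matrix.mul_assoc (D.B k), ← Matrix.add_mul, transpose_mul]
  simp only [Matrix.mul_assoc]

/-- Positive definiteness is a genuine restriction: a controller may produce singular covariances,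
and then it corresponds to no feasible point. -/
theorem ofController_mem {v : Fin N → Fin m → ℝ} {K : Fin N → Matrix (Fin m) (Fin n) ℝ}
    (h : ∀ k, (covSeq D K k).PosDef) (ht : TerminalOK D v K) :
    ofController D v K ∈ detFeasible D := by
  have hc := fun k => isCholesky_chol (h k)
  refine ⟨⟨fun k => (hc k).lower, fun k i => ((hc k).diag_pos i).le, fun k => rfl, rfl, rfl,
    ht.1, ?_⟩, fun k => ⟨_, isQR_of_gram (hc k.succ).lower (hc k.succ).diag_pos ?_⟩⟩
  · refine (terminal_norm_iff D.PFin_posDef).2 ?_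
    have := ht.2
    rwa [(hc (Fin.last N)).eq] at this
  · rw [transpose_transpose, ofController_X_mul_transpose (h _)]
    exact (hc k.succ).eq

theorem detCost_ofController {v : Fin N → Fin m → ℝ} {K : Fin N → Matrix (Fin m) (Fin n) ℝ}
    (h : ∀ k, (covSeq D K k).PosDef) : detCost D (ofController D v K) = ctrlCost D v K := by
  refine Finset.sum_congr rfl fun k _ => ?_
  have hc := isCholesky_chol (h k.castSucc)
  change meanSeq D v k.castSucc ⬝ᵥ D.Q k *ᵥ meanSeq D v k.castSucc + v k ⬝ᵥ D.R k *ᵥ v k +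
    (D.Q k * (chol (covSeq D K k.castSucc) * (chol (covSeq D K k.castSucc))ᵀ)).trace +
    (D.R k * ((K k * chol (covSeq D K k.castSucc)) *
      (K k * chol (covSeq D K k.castSucc))ᵀ)).trace = _
  rw [transpose_mul, ← Matrix.mul_assoc (K k * chol (covSeq D K k.castSucc)),
    Matrix.mul_assoc (K k), ← hc.eq]

/-- A feasible point is globally optimal if no controller does better. -/
theorem globallyOptimal_of_le {Ω : Type*} [MeasurableSpace Ω] {P : Measure Ω}
    [IsProbabilityMeasure P] {x₀ : Ω → Fin n → ℝ} {w : Fin N → Ω → Fin p → ℝ}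
    (hnoise : IsNoise D P x₀ w) {z : Vars N n m} (hz : z ∈ detFeasible D)
    (h : ∀ v K, TerminalOK D v K → detCost D z ≤ ctrlCost D v K) :
    GloballyOptimal D P x₀ w z where
  admissible := (hnoise.admissible_iff _ _).2 (terminalOK_of_feasible hz)
  optimal v' K' h' := by
    rw [hnoise.cost_eq, hnoise.cost_eq, ← detCost_eq hz]
    exact h v' K' ((hnoise.admissible_iff _ _).1 h')
  mean_eq k := ((hnoise.state_moments _ _ k).2.1).trans (hz.1.meanSeq_eq k)
  cov_eq k := by
    rw [(hnoise.state_moments _ _ k).2.2.1]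
    exact isCholesky_covSeq hz k
  det_feasible := hz
  det_optimal := by
    intro z' hz'
    change detCost D z ≤ detCost D z'
    -- Every feasible point is itself a controller with the same cost, so the comparison with
    -- controllers also settles the deterministic problem.
    rw [detCost_eq hz']
    exact h _ _ (terminalOK_of_feasible hz')

end Controllers

/-! ## Mixing two controllers -/

section Mixing

variable {N n m p : ℕ}

/-- Convex combination of nominal controls. -/
def mixControl (v₁ v₂ : Fin N → Fin m → ℝ) (t : ℝ) : Fin N → Fin m → ℝ :=
  (1 - t) • v₁ + t • v₂

/-- Convex combination of the covariances of two controllers. -/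
def mixCov (D : Problem N n m p) (K₁ K₂ : Fin N → Matrix (Fin m) (Fin n) ℝ) (t : ℝ)
    (k : Fin (N + 1)) : Matrix (Fin n) (Fin n) ℝ :=
  (1 - t) • covSeq D K₁ k + t • covSeq D K₂ k

/-- The gains whose products with the mixed covariances are the mixtures of the products of gains
and covariances. -/
def mixGain (D : Problem N n m p) (K₁ K₂ : Fin N → Matrix (Fin m) (Fin n) ℝ) (t : ℝ) :
    Fin N → Matrix (Fin m) (Fin n) ℝ :=
  fun k => K₁ k + t • ((K₂ k - K₁ k) * covSeq D K₂ k.castSucc * (mixCov D K₁ K₂ t k.castSucc)⁻¹)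

/-- A matrix form of the decomposition of variance: the weighted deviations `E₁`, `E₂` have average
zero, so the cross terms cancel and only the spread remains. -/
theorem mix_identity {a b : ℕ} {C₁ C₂ : Matrix (Fin b) (Fin b) ℝ} {t : ℝ} (h₁ : C₁ᵀ = C₁)
    (h₂ : C₂ᵀ = C₂) {E₁ E₂ : Matrix (Fin a) (Fin b) ℝ} {c : ℕ}
    (h : (1 - t) • (E₁ * C₁) + t • (E₂ * C₂) = 0) (F : Matrix (Fin c) (Fin b) ℝ)
    (B : Matrix (Fin c) (Fin a) ℝ) :
    (1 - t) • ((F + B * E₁) * C₁ * (F + B * E₁)ᵀ) + t • ((F + B * E₂) * C₂ * (F + B * E₂)ᵀ) =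
      F * ((1 - t) • C₁ + t • C₂) * Fᵀ +
        B * ((1 - t) • (E₁ * C₁ * E₁ᵀ) + t • (E₂ * C₂ * E₂ᵀ)) * Bᵀ := by
  have h' : (1 - t) • (C₁ * E₁ᵀ) + t • (C₂ * E₂ᵀ) = 0 := by
    have := congrArg transpose h
    simpa [transpose_mul, h₁, h₂] using this
  have e₁ : B * ((1 - t) • (E₁ * C₁) + t • (E₂ * C₂)) * Fᵀ = 0 := by
    rw [h, Matrix.mul_zero, Matrix.zero_mul]
  have e₂ : F * ((1 - t) • (C₁ * E₁ᵀ) + t • (C₂ * E₂ᵀ)) * Bᵀ = 0 := by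
    rw [h', Matrix.mul_zero, Matrix.zero_mul]
  rw [← sub_eq_zero]
  refine Eq.trans ?_ ((congrArg₂ (· + ·) e₁ e₂).trans (add_zero 0))
  simp only [transpose_add, transpose_mul, Matrix.add_mul, Matrix.mul_add, Matrix.mul_smul,
    Matrix.smul_mul, smul_add, Matrix.mul_assoc]
  abel

variable {D : Problem N n m p} {K₁ K₂ : Fin N → Matrix (Fin m) (Fin n) ℝ}
  {v₁ v₂ : Fin N → Fin m → ℝ} {t : ℝ}

/-- Only the first controller must be nondegenerate. The target may have singular covariances, which
is why `t < 1` is required throughout. -/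
theorem mixCov_posDef (h₁ : ∀ k, (covSeq D K₁ k).PosDef) (ht0 : 0 ≤ t) (ht1 : t < 1)
    (k : Fin (N + 1)) : (mixCov D K₁ K₂ t k).PosDef :=
  ((h₁ k).smul (sub_pos.2 ht1)).add_posSemidef ((covSeq_posSemidef K₂ k).smul ht0)

/-- The deviations of the two gains from the mixed gain have weighted average zero, which is the
hypothesis of `mix_identity`. -/
theorem mixGain_mul (hP : (mixCov D K₁ K₂ t k.castSucc).PosDef) :
    (1 - t) • ((K₁ k - mixGain D K₁ K₂ t k) * covSeq D K₁ k.castSucc) +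
      t • ((K₂ k - mixGain D K₁ K₂ t k) * covSeq D K₂ k.castSucc) = 0 := by
  have h1 : mixGain D K₁ K₂ t k * mixCov D K₁ K₂ t k.castSucc =
      K₁ k * mixCov D K₁ K₂ t k.castSucc +
        t • ((K₂ k - K₁ k) * covSeq D K₂ k.castSucc) := by
    rw [mixGain, Matrix.add_mul, Matrix.smul_mul, nonsing_inv_mul_cancel_right]
    exact (Matrix.isUnit_iff_isUnit_det _).1 hP.isUnit
  have h2 : (1 - t) • ((K₁ k - mixGain D K₁ K₂ t k) * covSeq D K₁ k.castSucc) +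
      t • ((K₂ k - mixGain D K₁ K₂ t k) * covSeq D K₂ k.castSucc) =
      (K₁ k * mixCov D K₁ K₂ t k.castSucc +
        t • ((K₂ k - K₁ k) * covSeq D K₂ k.castSucc)) -
      mixGain D K₁ K₂ t k * mixCov D K₁ K₂ t k.castSucc := by
    simp only [mixCov, Matrix.mul_add, Matrix.sub_mul, Matrix.mul_smul, smul_sub]
    abel
  rw [h2, h1, sub_self]

/-- The covariance gap created by mixing two gains. -/
def mixGap (D : Problem N n m p) (K₁ K₂ : Fin N → Matrix (Fin m) (Fin n) ℝ) (t : ℝ)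
    (k : Fin N) : Matrix (Fin m) (Fin m) ℝ :=
  (1 - t) • ((K₁ k - mixGain D K₁ K₂ t k) * covSeq D K₁ k.castSucc *
      (K₁ k - mixGain D K₁ K₂ t k)ᵀ) +
    t • ((K₂ k - mixGain D K₁ K₂ t k) * covSeq D K₂ k.castSucc *
      (K₂ k - mixGain D K₁ K₂ t k)ᵀ)

theorem mixGap_posSemidef (ht0 : 0 ≤ t) (ht1 : t < 1) (k : Fin N) :
    (mixGap D K₁ K₂ t k).PosSemidef :=
  ((posSemidef_conj (covSeq_posSemidef _ _) _).smul (sub_nonneg.2 ht1.le)).add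
    ((posSemidef_conj (covSeq_posSemidef _ _) _).smul ht0)

/-- General `A` and `B` serve two purposes: the system matrices give the covariance recursion, while
`A = 0`, `B = 1` gives the covariance of the control. -/
theorem mix_expand (h₁ : ∀ k, (covSeq D K₁ k).PosDef) (ht0 : 0 ≤ t) (ht1 : t < 1) (k : Fin N)
    {c : ℕ} (A : Matrix (Fin c) (Fin n) ℝ) (B : Matrix (Fin c) (Fin m) ℝ) :
    (1 - t) • ((A + B * K₁ k) * covSeq D K₁ k.castSucc * (A + B * K₁ k)ᵀ) +
      t • ((A + B * K₂ k) * covSeq D K₂ k.castSucc * (A + B * K₂ k)ᵀ) =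
    (A + B * mixGain D K₁ K₂ t k) * mixCov D K₁ K₂ t k.castSucc *
      (A + B * mixGain D K₁ K₂ t k)ᵀ + B * mixGap D K₁ K₂ t k * Bᵀ := by
  have h := mix_identity (transpose_eq_of_posSemidef (covSeq_posSemidef K₁ k.castSucc))
    (transpose_eq_of_posSemidef (covSeq_posSemidef K₂ k.castSucc))
    (mixGain_mul (mixCov_posDef (K₂ := K₂) h₁ ht0 ht1 k.castSucc))
    (A + B * mixGain D K₁ K₂ t k) B
  have e : ∀ K : Matrix (Fin m) (Fin n) ℝ,
      A + B * mixGain D K₁ K₂ t k + B * (K - mixGain D K₁ K₂ t k) = A + B * K := by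
    intro K
    rw [Matrix.mul_sub]
    abel
  rw [e, e] at h
  exact h

/-- The covariances of the mixed controller are dominated by the mixed covariances. -/
theorem covSeq_mix_le (h₁ : ∀ k, (covSeq D K₁ k).PosDef) (ht0 : 0 ≤ t) (ht1 : t < 1)
    (k : Fin (N + 1)) : (mixCov D K₁ K₂ t k - covSeq D (mixGain D K₁ K₂ t) k).PosSemidef := by
  induction k using Fin.induction with
  | zero =>
    have : mixCov D K₁ K₂ t 0 - covSeq D (mixGain D K₁ K₂ t) 0 = 0 := by
      simp only [mixCov, covSeq_zero]
      rw [← add_smul, sub_add_cancel, one_smul, sub_self]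
    rw [this]
    exact .zero
  | succ k ih =>
    have h1 := posSemidef_conj ih (D.A k + D.B k * mixGain D K₁ K₂ t k)
    have h2 := posSemidef_conj (mixGap_posSemidef (D := D) (K₁ := K₁) (K₂ := K₂) ht0 ht1 k)
      (D.B k)
    have h3 := mix_expand (K₂ := K₂) h₁ ht0 ht1 k (D.A k) (D.B k)
    -- The excess of the averaged covariance propagates through the closed loop and grows by the
    -- spread of the gains; both contributions are positive semidefinite.
    have h4 : mixCov D K₁ K₂ t k.succ - covSeq D (mixGain D K₁ K₂ t) k.succ =
        (D.A k + D.B k * mixGain D K₁ K₂ t k) *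
          (mixCov D K₁ K₂ t k.castSucc - covSeq D (mixGain D K₁ K₂ t) k.castSucc) *
          (D.A k + D.B k * mixGain D K₁ K₂ t k)ᵀ +
        D.B k * mixGap D K₁ K₂ t k * (D.B k)ᵀ := by
      have h5 : mixCov D K₁ K₂ t k.succ =
          ((1 - t) • ((D.A k + D.B k * K₁ k) * covSeq D K₁ k.castSucc *
              (D.A k + D.B k * K₁ k)ᵀ) +
            t • ((D.A k + D.B k * K₂ k) * covSeq D K₂ k.castSucc *
              (D.A k + D.B k * K₂ k)ᵀ)) + D.G k * (D.G k)ᵀ := by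
        simp only [mixCov, covSeq_succ, smul_add]
        have : D.G k * (D.G k)ᵀ = (1 - t) • (D.G k * (D.G k)ᵀ) + t • (D.G k * (D.G k)ᵀ) := by
          rw [← add_smul, sub_add_cancel, one_smul]
        conv_rhs => rw [this]
        abel
      rw [h5, h3, covSeq_succ, Matrix.mul_sub, Matrix.sub_mul]
      abel
    rw [h4]
    exact h1.add h2

theorem meanSeq_mix (v₁ v₂ : Fin N → Fin m → ℝ) (t : ℝ) (k : Fin (N + 1)) :
    meanSeq D (mixControl v₁ v₂ t) k = (1 - t) • meanSeq D v₁ k + t • meanSeq D v₂ k := by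
  induction k using Fin.induction with
  | zero =>
    simp only [meanSeq_zero]
    rw [← add_smul, sub_add_cancel, one_smul]
  | succ k ih =>
    simp only [meanSeq_succ, ih]
    simp only [mixControl, Pi.add_apply, Pi.smul_apply, mulVec_add, mulVec_smul,
      smul_add]
    abel

theorem quadratic_convex {d : ℕ} {Q : Matrix (Fin d) (Fin d) ℝ} (hQ : Q.PosSemidef)
    (ht0 : 0 ≤ t) (ht1 : t < 1) (a b : Fin d → ℝ) :
    ((1 - t) • a + t • b) ⬝ᵥ Q *ᵥ ((1 - t) • a + t • b) ≤
      (1 - t) * (a ⬝ᵥ Q *ᵥ a) + t * (b ⬝ᵥ Q *ᵥ b) := by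
  have h := hQ.dotProduct_mulVec_nonneg (a - b)
  rw [star_trivial] at h
  simp only [mulVec_sub, dotProduct_sub, sub_dotProduct] at h
  simp only [mulVec_add, mulVec_smul, dotProduct_add, add_dotProduct, dotProduct_smul,
    smul_dotProduct, smul_eq_mul]
  have ht : 0 ≤ t * (1 - t) := mul_nonneg ht0 (sub_nonneg.2 ht1.le)
  nlinarith [mul_nonneg ht h]

/-- The mean part is convex in the nominal controls. The rest is linear and monotone in the
covariances of state and control, and mixing replaces the averages of these by smaller matrices. -/
theorem ctrlCost_mix_le (h₁ : ∀ k, (covSeq D K₁ k).PosDef) (ht0 : 0 ≤ t) (ht1 : t < 1) :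
    ctrlCost D (mixControl v₁ v₂ t) (mixGain D K₁ K₂ t) ≤
      (1 - t) * ctrlCost D v₁ K₁ + t * ctrlCost D v₂ K₂ := by
  simp only [ctrlCost, Finset.mul_sum, ← Finset.sum_add_distrib]
  refine Finset.sum_le_sum fun k _ => ?_
  have hm := quadratic_convex (D.Q_posSemidef k) ht0 ht1 (meanSeq D v₁ k.castSucc)
    (meanSeq D v₂ k.castSucc)
  have hv := quadratic_convex (D.R_posDef k).posSemidef ht0 ht1 (v₁ k) (v₂ k)
  have hle := covSeq_mix_le (K₂ := K₂) h₁ ht0 ht1 k.castSucc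
  have hQ := trace_mul_nonneg (D.Q_posSemidef k) hle
  have hR₁ := trace_mul_nonneg (D.R_posDef k).posSemidef
    (posSemidef_conj hle (mixGain D K₁ K₂ t k))
  have hR₂ := trace_mul_nonneg (D.R_posDef k).posSemidef
    (mixGap_posSemidef (D := D) (K₁ := K₁) (K₂ := K₂) ht0 ht1 k)
  have hex := mix_expand (K₂ := K₂) h₁ ht0 ht1 k (0 : Matrix (Fin m) (Fin n) ℝ) 1
  simp only [zero_add, Matrix.one_mul, transpose_one, Matrix.mul_one] at hex
  have hR₃ := congrArg (fun M => (D.R k * M).trace) hex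
  simp only [Matrix.mul_add, Matrix.mul_smul, trace_add, trace_smul, smul_eq_mul] at hR₃
  simp only [Matrix.mul_sub, Matrix.sub_mul, trace_sub] at hQ hR₁
  have hQ' : (D.Q k * mixCov D K₁ K₂ t k.castSucc).trace =
      (1 - t) * (D.Q k * covSeq D K₁ k.castSucc).trace +
        t * (D.Q k * covSeq D K₂ k.castSucc).trace := by
    simp only [mixCov, Matrix.mul_add, Matrix.mul_smul, trace_add, trace_smul, smul_eq_mul]
  rw [hQ'] at hQ
  rw [meanSeq_mix]
  simp only [mixControl, Pi.add_apply, Pi.smul_apply]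
  linarith

/-- Written in terms of the margins below `C`, so that nonstrict and strict terminal bounds for
mixtures both follow by adding matrices. -/
theorem posSemidef_sub_mix {C : Matrix (Fin n) (Fin n) ℝ} (h₁ : ∀ k, (covSeq D K₁ k).PosDef)
    (ht0 : 0 ≤ t) (ht1 : t < 1) (k : Fin (N + 1)) :
    ((C - covSeq D (mixGain D K₁ K₂ t) k) -
      ((1 - t) • (C - covSeq D K₁ k) + t • (C - covSeq D K₂ k))).PosSemidef := by
  have h := covSeq_mix_le (K₂ := K₂) h₁ ht0 ht1 k
  have e : (C - covSeq D (mixGain D K₁ K₂ t) k) -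
      ((1 - t) • (C - covSeq D K₁ k) + t • (C - covSeq D K₂ k)) =
      mixCov D K₁ K₂ t k - covSeq D (mixGain D K₁ K₂ t) k := by
    simp only [mixCov, sub_smul, one_smul, smul_sub]
    abel
  rwa [e]

theorem terminalOK_mix (h₁ : ∀ k, (covSeq D K₁ k).PosDef) (ht0 : 0 ≤ t) (ht1 : t < 1)
    (ho₁ : TerminalOK D v₁ K₁) (ho₂ : TerminalOK D v₂ K₂) :
    TerminalOK D (mixControl v₁ v₂ t) (mixGain D K₁ K₂ t) := by
  refine ⟨?_, ?_⟩
  · rw [meanSeq_mix, ho₁.1, ho₂.1, ← add_smul, sub_add_cancel, one_smul]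
  · have h := posSemidef_sub_mix (C := D.PFin) (K₂ := K₂) h₁ ht0 ht1 (Fin.last N)
    have h2 := h.add ((ho₁.2.smul (sub_nonneg.2 ht1.le)).add (ho₂.2.smul ht0))
    rwa [sub_add_cancel] at h2

end Mixing

/-! ## The curve of square root variables towards a controller -/

section Path

variable {N n m p : ℕ} {D : Problem N n m p}

/-- The square root variables of the mixtures of the controller of `z` with `(v, K)`. -/
def mixPath (D : Problem N n m p) (z : Vars N n m) (v : Fin N → Fin m → ℝ)
    (K : Fin N → Matrix (Fin m) (Fin n) ℝ) (t : ℝ) : Vars N n m :=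
  ofController D (mixControl z.v v t) (mixGain D z.K K t)

theorem tendsto_id_nhdsGT : Tendsto (fun t : ℝ => t) (𝓝[>] 0) (𝓝 0) :=
  tendsto_id.mono_left nhdsWithin_le_nhds

theorem eventually_mem_Ioo : ∀ᶠ t : ℝ in 𝓝[>] 0, 0 < t ∧ t < 1 :=
  Ioo_mem_nhdsGT one_pos

/-- The factor multiplying `t` converges, because the mixed covariance tends to an invertible
matrix. -/
theorem mixGain_sub_isBigO {K₁ : Fin N → Matrix (Fin m) (Fin n) ℝ}
    (K₂ : Fin N → Matrix (Fin m) (Fin n) ℝ) {k : Fin N} (h₁ : (covSeq D K₁ k.castSucc).PosDef) :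
    EntryO (𝓝[>] 0) (fun t : ℝ => mixGain D K₁ K₂ t k - K₁ k) (fun t => t) := by
  have hC : Tendsto (fun t : ℝ => mixCov D K₁ K₂ t k.castSucc) (𝓝[>] 0)
      (𝓝 (covSeq D K₁ k.castSucc)) := by
    have h1 : Tendsto (fun t : ℝ => (1 - t) • covSeq D K₁ k.castSucc +
        t • covSeq D K₂ k.castSucc) (𝓝[>] 0)
        (𝓝 ((1 - 0 : ℝ) • covSeq D K₁ k.castSucc + (0 : ℝ) • covSeq D K₂ k.castSucc)) :=
      ((tendsto_id_nhdsGT.const_sub 1).smul_const _).add (tendsto_id_nhdsGT.smul_const _)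
    simpa [mixCov] using h1
  have hM := tendsto_mul (tendsto_const_nhds (x := (K₂ k - K₁ k) * covSeq D K₂ k.castSucc))
    (tendsto_matrix_inv hC ((Matrix.isUnit_iff_isUnit_det _).1 h₁.isUnit))
  intro i j
  have h2 := (Asymptotics.isBigO_refl (fun t : ℝ => t) (𝓝[>] 0)).mul
    (EntryO.of_tendsto hM i j)
  simpa [mixGain] using h2

theorem EntryO.fromCols {α : Type*} {l : Filter α} {m₁ n₁ n₂ : Type*}
    {f : α → Matrix m₁ n₁ ℝ} {f' : α → Matrix m₁ n₂ ℝ} {g : α → ℝ} (hf : EntryO l f g)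
    (hf' : EntryO l f' g) : EntryO l (fun a => Matrix.fromCols (f a) (f' a)) g := by
  rintro i (j | j)
  · exact hf i j
  · exact hf' i j

theorem X_sub (z z' : Vars N n m) (k : Fin N) : X D z k - X D z' k =
    Matrix.fromCols (D.A k * (z.S k.castSucc - z'.S k.castSucc) +
      D.B k * (z.L k - z'.L k)) 0 := by
  ext i (j | j)
  · simp only [X, Matrix.sub_apply, fromCols_apply_inl, Matrix.mul_sub, Matrix.add_apply]
    ring
  · simp [X]

theorem X_sub_isBigO {α : Type*} {l : Filter α} {f f' : α → Vars N n m} {k : Fin N} {g : α → ℝ}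
    (hS : EntryO l (fun a => (f a).S k.castSucc - (f' a).S k.castSucc) g)
    (hL : EntryO l (fun a => (f a).L k - (f' a).L k) g) :
    EntryO l (fun a => X D (f a) k - X D (f' a) k) g := by
  simp only [X_sub]
  exact EntryO.fromCols ((hS.const_mul _).add (hL.const_mul _))
    fun i j => Asymptotics.isBigO_zero _ _

theorem tendsto_of_sub_isBigO {α : Type*} {l : Filter α} {m₁ n₁ : Type*}
    {f : α → Matrix m₁ n₁ ℝ} {M : Matrix m₁ n₁ ℝ} {g : α → ℝ}
    (hf : EntryO l (fun a => f a - M) g) (hg : Tendsto g l (𝓝 0)) : Tendsto f l (𝓝 M) := by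
  have := (hf.tendsto_zero hg).add_const M
  simpa using this

theorem feasible_isQR {z : Vars N n m} (hz : z ∈ detFeasible D) (k : Fin N) :
    IsQR (X D z k)ᵀ (qrQ (X D z k)ᵀ) (z.S k.succ)ᵀ := by
  obtain ⟨Q, hQ⟩ := hz.2 k
  rwa [hQ.qrQ_eq]

variable {z : Vars N n m}

theorem mixPath_L_sub_isBigO (hz : z ∈ detFeasible D) (v : Fin N → Fin m → ℝ)
    (K : Fin N → Matrix (Fin m) (Fin n) ℝ) {k : Fin N}
    (hS : EntryO (𝓝[>] 0) (fun t => (mixPath D z v K t).S k.castSucc - z.S k.castSucc)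
      (fun t => t)) :
    EntryO (𝓝[>] 0) (fun t => (mixPath D z v K t).L k - z.L k) (fun t => t) := by
  have hc := isCholesky_covSeq hz k.castSucc
  have h1 := (mixGain_sub_isBigO K hc.posDef).mul_tendsto
    (tendsto_of_sub_isBigO hS tendsto_id_nhdsGT)
  have h2 := hS.const_mul (z.K k)
  refine (h1.add h2).congr' (Eventually.of_forall fun t => ?_)
  change (mixGain D z.K K t k - z.K k) * (mixPath D z v K t).S k.castSucc +
    z.K k * ((mixPath D z v K t).S k.castSucc - z.S k.castSucc) =
    mixGain D z.K K t k * (mixPath D z v K t).S k.castSucc - z.L k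
  rw [← K_mul_S hc.isUnit_det, Matrix.sub_mul, Matrix.mul_sub]
  abel

/-- The induction step along the horizon. An `O(t)` change of `S` at one stage gives an `O(t)`
change of `X`. Its Gram matrix tends to a positive definite limit, so the next Cholesky factor is
defined for small `t`, and the expansion of the QR factor yields the next `O(t)` bound together with
the second-order defect. -/
theorem mixPath_step (hz : z ∈ detFeasible D) (v : Fin N → Fin m → ℝ)
    (K : Fin N → Matrix (Fin m) (Fin n) ℝ) {k : Fin N}
    (hpd : ∀ᶠ t in 𝓝[>] 0, (covSeq D (mixGain D z.K K t) k.castSucc).PosDef)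
    (hS : EntryO (𝓝[>] 0) (fun t => (mixPath D z v K t).S k.castSucc - z.S k.castSucc)
      (fun t => t)) :
    (∀ᶠ t in 𝓝[>] 0, (covSeq D (mixGain D z.K K t) k.succ).PosDef) ∧
    EntryO (𝓝[>] 0) (fun t => (mixPath D z v K t).S k.succ - z.S k.succ) (fun t => t) ∧
    EntryO (𝓝[>] 0) (fun t => (mixPath D z v K t).S k.succ - z.S k.succ -
      (dR (X D (mixPath D z v K t) k - X D z k)ᵀ (qrQ (X D z k)ᵀ) (qrR (X D z k)ᵀ))ᵀ)
      (fun t => t * t) := by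
  have hX := X_sub_isBigO (D := D) (f' := fun _ => z) hS (mixPath_L_sub_isBigO hz v K hS)
  have hQR := feasible_isQR hz k
  have hXlim := tendsto_of_sub_isBigO hX tendsto_id_nhdsGT
  have hlim : Tendsto (fun t => covSeq D (mixGain D z.K K t) k.succ) (𝓝[>] 0)
      (𝓝 (X D z k * (X D z k)ᵀ)) := by
    refine (tendsto_mul hXlim (tendsto_transpose hXlim)).congr' (hpd.mono fun t ht => ?_)
    exact ofController_X_mul_transpose ht
  have hgram := hQR.gram
  rw [transpose_transpose, transpose_transpose] at hgram
  have hpd' : ∀ᶠ t in 𝓝[>] 0, (covSeq D (mixGain D z.K K t) k.succ).PosDef := by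
    refine eventually_posDef hlim ?_ (Eventually.of_forall fun t => (covSeq_posSemidef _ _).1)
    rw [hgram, ← (isCholesky_covSeq hz k.succ).eq]
    exact (isCholesky_covSeq hz k.succ).posDef
  have hexp := hQR.expansion (l := 𝓝[>] 0) (M := fun t => (X D (mixPath D z v K t) k)ᵀ)
    (R := fun t => ((mixPath D z v K t).S k.succ)ᵀ) (g := fun t => t) (by
      filter_upwards [hpd, hpd'] with t ht ht'
      have hc := isCholesky_chol ht'
      refine ⟨hc.lower, fun i => (hc.diag_pos i).le, ?_⟩
      rw [transpose_transpose, transpose_transpose]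
      exact hc.eq.symm.trans (ofController_X_mul_transpose ht).symm)
    tendsto_id_nhdsGT (by simpa only [transpose_sub] using hX.transpose)
  refine ⟨hpd', ?_, ?_⟩
  · simpa only [transpose_sub, transpose_transpose] using hexp.1.transpose
  · rw [hQR.qrR_eq]
    simpa only [transpose_sub, transpose_transpose] using hexp.2.transpose

theorem mixPath_S (hz : z ∈ detFeasible D) (v : Fin N → Fin m → ℝ)
    (K : Fin N → Matrix (Fin m) (Fin n) ℝ) (k : Fin (N + 1)) :
    (∀ᶠ t in 𝓝[>] 0, (covSeq D (mixGain D z.K K t) k).PosDef) ∧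
    EntryO (𝓝[>] 0) (fun t => (mixPath D z v K t).S k - z.S k) (fun t => t) := by
  induction k using Fin.induction with
  | zero =>
    refine ⟨Eventually.of_forall fun t => D.PInit_posDef, fun i j => ?_⟩
    have : ∀ t, (mixPath D z v K t).S 0 - z.S 0 = 0 := by
      intro t
      rw [hz.1.init_cov]
      exact sub_self _
    simp only [this]
    exact Asymptotics.isBigO_zero _ _
  | succ k ih =>
    obtain ⟨h1, h2, -⟩ := mixPath_step hz v K ih.1 ih.2
    exact ⟨h1, h2⟩

theorem mixPath_posDef (hz : z ∈ detFeasible D) (K : Fin N → Matrix (Fin m) (Fin n) ℝ) :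
    ∀ᶠ t in 𝓝[>] 0, ∀ k, (covSeq D (mixGain D z.K K t) k).PosDef :=
  eventually_all.2 fun k => (mixPath_S hz (fun _ _ => 0) K k).1

theorem mixPath_L (hz : z ∈ detFeasible D) (v : Fin N → Fin m → ℝ)
    (K : Fin N → Matrix (Fin m) (Fin n) ℝ) (k : Fin N) :
    EntryO (𝓝[>] 0) (fun t => (mixPath D z v K t).L k - z.L k) (fun t => t) :=
  mixPath_L_sub_isBigO hz v K (mixPath_S hz v K _).2

theorem mixPath_X (hz : z ∈ detFeasible D) (v : Fin N → Fin m → ℝ)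
    (K : Fin N → Matrix (Fin m) (Fin n) ℝ) (k : Fin N) :
    EntryO (𝓝[>] 0) (fun t => X D (mixPath D z v K t) k - X D z k) (fun t => t) :=
  X_sub_isBigO (f' := fun _ => z) (mixPath_S hz v K _).2 (mixPath_L hz v K k)

theorem mixPath_defect (hz : z ∈ detFeasible D) (v : Fin N → Fin m → ℝ)
    (K : Fin N → Matrix (Fin m) (Fin n) ℝ) (k : Fin N) :
    EntryO (𝓝[>] 0) (fun t => (mixPath D z v K t).S k.succ - z.S k.succ -
      (dR (X D (mixPath D z v K t) k - X D z k)ᵀ (qrQ (X D z k)ᵀ) (qrR (X D z k)ᵀ))ᵀ)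
      (fun t => t * t) :=
  (mixPath_step hz v K (mixPath_S hz v K _).1 (mixPath_S hz v K _).2).2.2

theorem mixPath_v_tendsto (v : Fin N → Fin m → ℝ) :
    Tendsto (fun t => mixControl z.v v t) (𝓝[>] 0) (𝓝 z.v) := by
  have h1 : Tendsto (fun t : ℝ => (1 - t) • z.v + t • v) (𝓝[>] 0)
      (𝓝 ((1 - 0 : ℝ) • z.v + (0 : ℝ) • v)) :=
    ((tendsto_id_nhdsGT.const_sub 1).smul_const _).add (tendsto_id_nhdsGT.smul_const _)
  simpa [mixControl] using h1

theorem mixPath_mu_tendsto (hz : z ∈ detFeasible D) (v : Fin N → Fin m → ℝ) :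
    Tendsto (fun t => meanSeq D (mixControl z.v v t)) (𝓝[>] 0) (𝓝 z.mu) := by
  refine tendsto_pi_nhds.2 fun k => ?_
  simp only [meanSeq_mix, hz.1.meanSeq_eq]
  have h1 : Tendsto (fun t : ℝ => (1 - t) • z.mu k + t • meanSeq D v k) (𝓝[>] 0)
      (𝓝 ((1 - 0 : ℝ) • z.mu k + (0 : ℝ) • meanSeq D v k)) :=
    ((tendsto_id_nhdsGT.const_sub 1).smul_const _).add (tendsto_id_nhdsGT.smul_const _)
  simpa using h1

theorem mixPath_tendsto (hz : z ∈ detFeasible D) (v : Fin N → Fin m → ℝ)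
    (K : Fin N → Matrix (Fin m) (Fin n) ℝ) : Tendsto (mixPath D z v K) (𝓝[>] 0) (𝓝 z) := by
  refine (mixPath_v_tendsto v).prodMk_nhds (Tendsto.prodMk_nhds ?_
    ((mixPath_mu_tendsto hz v).prodMk_nhds ?_))
  · exact tendsto_pi_nhds.2 fun k => tendsto_of_sub_isBigO (mixPath_L hz v K k) tendsto_id_nhdsGT
  · exact tendsto_pi_nhds.2 fun k =>
      tendsto_of_sub_isBigO (mixPath_S hz v K k).2 tendsto_id_nhdsGT

theorem covSeq_feasible_posDef (hz : z ∈ detFeasible D) (k : Fin (N + 1)) :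
    (covSeq D z.K k).PosDef :=
  (isCholesky_covSeq hz k).posDef

variable {v : Fin N → Fin m → ℝ} {K : Fin N → Matrix (Fin m) (Fin n) ℝ}

/-! ### Feasibility and cost along the curve -/

theorem mixPath_mem (hz : z ∈ detFeasible D) (h : TerminalOK D v K) :
    ∀ᶠ t in 𝓝[>] 0, mixPath D z v K t ∈ detFeasible D := by
  filter_upwards [mixPath_posDef hz K, eventually_mem_Ioo] with t ht ht01
  exact ofController_mem ht (terminalOK_mix (covSeq_feasible_posDef hz) ht01.1.le ht01.2
    (terminalOK_of_feasible hz) h)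

theorem detCost_mixPath_le (hz : z ∈ detFeasible D) : ∀ᶠ t in 𝓝[>] 0,
    detCost D (mixPath D z v K t) ≤ (1 - t) * detCost D z + t * ctrlCost D v K := by
  filter_upwards [mixPath_posDef hz K, eventually_mem_Ioo] with t ht ht01
  rw [mixPath, detCost_ofController ht, detCost_eq hz]
  exact ctrlCost_mix_le (covSeq_feasible_posDef hz) ht01.1.le ht01.2

/-- A local minimizer is not worse than any controller. -/
theorem detCost_le_of_isLocalMinOn (hz : z ∈ detFeasible D)
    (hmin : IsLocalMinOn (detCost D) (detFeasible D) z)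
    (h : TerminalOK D v K) : detCost D z ≤ ctrlCost D v K := by
  have h1 : Tendsto (mixPath D z v K) (𝓝[>] 0) (𝓝[detFeasible D] z) :=
    tendsto_nhdsWithin_iff.2 ⟨mixPath_tendsto hz v K, mixPath_mem hz h⟩
  obtain ⟨t, h2, h3, h4⟩ :=
    -- Local minimality gives `J(z) ≤ (1 - t) J(z) + t J(v, K)` for some small `t > 0`, which is
    -- then divided by `t`.
    ((h1.eventually hmin).and ((detCost_mixPath_le hz).and eventually_mem_Ioo)).exists
  have h5 := h2.trans h3
  have h6 : t * detCost D z ≤ t * ctrlCost D v K := by linarith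
  exact le_of_mul_le_mul_left h6 h4.1

/-- If a strictly feasible controller exists, then a feasible point that is beaten by some
controller is also beaten by a strictly feasible one. -/
theorem exists_strict_better (hz : z ∈ detFeasible D) {vs : Fin N → Fin m → ℝ}
    {Ks : Fin N → Matrix (Fin m) (Fin n) ℝ}
    (hs : meanSeq D vs (Fin.last N) = D.muFin)
    (hs' : (D.PFin - covSeq D Ks (Fin.last N)).PosDef)
    (h : TerminalOK D v K) (hlt : ctrlCost D v K < detCost D z) :
    ∃ v' K', meanSeq D v' (Fin.last N) = D.muFin ∧
      (D.PFin - covSeq D K' (Fin.last N)).PosDef ∧ ctrlCost D v' K' < detCost D z := by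
  -- First a slight admixture of the strictly feasible controller to `z`, at almost no cost, then an
  -- equal mixture with the better controller. Starting from `z` matters: each mixture needs a
  -- nondegenerate first controller.
  have hlim : Tendsto (fun t : ℝ => (1 - 1 / 2) * ((1 - t) * ctrlCost D z.v z.K +
      t * ctrlCost D vs Ks) + 1 / 2 * ctrlCost D v K) (𝓝[>] 0)
      (𝓝 ((1 - 1 / 2) * ((1 - 0) * ctrlCost D z.v z.K + 0 * ctrlCost D vs Ks) +
        1 / 2 * ctrlCost D v K)) :=
    ((((tendsto_id_nhdsGT.const_sub 1).mul_const _).add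
      (tendsto_id_nhdsGT.mul_const _)).const_mul _).add_const _
  have hev := hlim.eventually_lt_const (u := detCost D z) (by
    rw [← detCost_eq hz]
    linarith)
  obtain ⟨t, h1, h2, h3⟩ :=
    (hev.and ((mixPath_posDef hz Ks).and eventually_mem_Ioo)).exists
  have hso : TerminalOK D vs Ks := ⟨hs, hs'.posSemidef⟩
  have hz1 := covSeq_feasible_posDef hz
  have ho := terminalOK_of_feasible hz
  have hmix := terminalOK_mix hz1 h3.1.le h3.2 ho hso
  have hhalf : (0 : ℝ) ≤ 1 / 2 := by norm_num
  have hhalf' : (1 / 2 : ℝ) < 1 := by norm_num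
  refine ⟨mixControl (mixControl z.v vs t) v (1 / 2),
    mixGain D (mixGain D z.K Ks t) K (1 / 2),
    (terminalOK_mix h2 hhalf hhalf' hmix h).1, ?_, ?_⟩
  · have g1 := posSemidef_sub_mix (C := D.PFin) (K₂ := Ks) hz1 h3.1.le h3.2 (Fin.last N)
    have g2 := posSemidef_sub_mix (C := D.PFin) (K₂ := K) h2 hhalf hhalf' (Fin.last N)
    -- The small admixture contributes `t` times its strict margin.
    have g3 : (D.PFin - covSeq D (mixGain D z.K Ks t) (Fin.last N)).PosDef := by
      have g4 := ((hs'.smul h3.1).posSemidef_add (ho.2.smul (sub_nonneg.2 h3.2.le)))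
      have g5 := g4.posSemidef_add g1
      rwa [sub_add_cancel] at g5
    have g6 := (g3.smul (show (0 : ℝ) < 1 - 1 / 2 by norm_num)).add_posSemidef (h.2.smul hhalf)
    have g7 := g6.posSemidef_add g2
    rwa [sub_add_cancel] at g7
  · refine lt_of_le_of_lt (ctrlCost_mix_le h2 hhalf hhalf') (lt_of_le_of_lt ?_ h1)
    have := ctrlCost_mix_le (v₁ := z.v) (v₂ := vs) (K₂ := Ks) hz1 h3.1.le h3.2
    linarith

end Path

/-! ## The convex subproblem -/

section Subproblem

variable {N n m p : ℕ} {D : Problem N n m p} {prm : Params n}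

/-- The slack of the dynamics linearized at `a`, as a function of the variables. -/
def linSlack (D : Problem N n m p) (a z : Vars N n m) : Slack N n :=
  fun k => vectril (z.S k.succ - (qrR (X D a k)ᵀ)ᵀ
    - (dR (X D z k - X D a k)ᵀ (qrQ (X D a k)ᵀ) (qrR (X D a k)ᵀ))ᵀ)

theorem linSlack_self (D : Problem N n m p) (z : Vars N n m) : linSlack D z z = infeas D z := by
  ext1 k
  simp only [linSlack, infeas, sub_self, transpose_zero, dR_zero, sub_zero]

theorem SubFeasible.slack_eq {s : AlgState N n m} {y : Vars N n m × Slack N n}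
    (h : SubFeasible D prm s y) : y.2 = linSlack D s.ref y.1 :=
  funext fun k => (h.linearized k).symm

/-- The linearized dynamics determine the slack, so the subproblem is a minimization over the
variables alone. -/
theorem SolvesSub.le {s : AlgState N n m} {y : Vars N n m × Slack N n}
    (h : SolvesSub D prm s y) {z : Vars N n m} (hz : ConvexFeasible D z)
    (htr : ∀ (k : Fin N) (i : Fin n) (j : Fin n ⊕ Fin p),
      |(prm.DX * (X D z k - X D s.ref k)) i j| ≤ s.r) :
    augLin D y.1 y.2 s.wt s.lam ≤ augLin D z (linSlack D s.ref z) s.wt s.lam :=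
  isMinOn_iff.1 h.2 (z, linSlack D s.ref z) ⟨hz, fun _ => rfl, htr⟩

theorem vectril_injOn {S T : Matrix (Fin n) (Fin n) ℝ} (hS : IsLT S) (hT : IsLT T)
    (h : vectril S = vectril T) : S = T := by
  ext i j
  rcases lt_or_ge i j with hij | hij
  · rw [hS i j hij, hT i j hij]
  · exact congrFun h ⟨(i, j), hij⟩

theorem vectril_sub (S T : Matrix (Fin n) (Fin n) ℝ) :
    vectril (S - T) = vectril S - vectril T := rfl

theorem mem_detFeasible_of_infeas {z : Vars N n m} (hz : ConvexFeasible D z)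
    (hr : ∀ k, (X D z k).rank = n) (h : infeas D z = 0) : z ∈ detFeasible D := by
  refine ⟨hz, fun k => ?_⟩
  have hQR := isQR_qr_of_rank (hr k)
  have h1 : z.S k.succ = (qrR (X D z k)ᵀ)ᵀ :=
    vectril_injOn (hz.lower _) hQR.isLT (sub_eq_zero.1 (congrFun h k))
  exact ⟨_, by rwa [h1, transpose_transpose]⟩

theorem infeas_eq_zero_of_norm {ξ : Slack N n} (h : slackNorm ξ ≤ 0) : ξ = 0 := by
  have h0 : ∀ k, 0 ≤ ∑ e, ξ k e ^ 2 := fun k => Finset.sum_nonneg fun e _ => sq_nonneg _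
  have h1 : ∑ k, ∑ e, ξ k e ^ 2 = 0 :=
    le_antisymm (Real.sqrt_eq_zero'.1 (le_antisymm h (Real.sqrt_nonneg _)))
      (Finset.sum_nonneg fun k _ => h0 k)
  ext k e
  have h2 := (Finset.sum_eq_zero_iff_of_nonneg fun k _ => h0 k).1 h1 k (Finset.mem_univ k)
  have h3 := (Finset.sum_eq_zero_iff_of_nonneg fun e _ => sq_nonneg (ξ k e)).1 h2 e
    (Finset.mem_univ e)
  exact pow_eq_zero_iff two_ne_zero |>.1 h3

theorem abs_le_slackNorm (ξ : Slack N n) (k : Fin N) (e : TrilIdx n) : |ξ k e| ≤ slackNorm ξ := by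
  refine Real.abs_le_sqrt ?_
  exact (Finset.single_le_sum (f := fun e => ξ k e ^ 2) (fun _ _ => sq_nonneg _)
    (Finset.mem_univ e)).trans (Finset.single_le_sum (f := fun k => ∑ e, ξ k e ^ 2)
      (fun _ _ => Finset.sum_nonneg fun _ _ => sq_nonneg _) (Finset.mem_univ k))

/-! ### Strict convexity -/

theorem X_affine (a b c : Vars N n m) (k : Fin N) :
    X D ((1 / 2 : ℝ) • (a + b)) k - X D c k =
      (1 / 2 : ℝ) • (X D a k - X D c k) + (1 / 2 : ℝ) • (X D b k - X D c k) := by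
  have hS : ((1 / 2 : ℝ) • (a + b)).S k.castSucc =
    (1 / 2 : ℝ) • (a.S k.castSucc + b.S k.castSucc) := rfl
  have hL : ((1 / 2 : ℝ) • (a + b)).L k = (1 / 2 : ℝ) • (a.L k + b.L k) := rfl
  ext i (j | j)
  · simp only [X, hS, hL, Matrix.sub_apply, Matrix.add_apply, Matrix.smul_apply,
      fromCols_apply_inl, Matrix.mul_smul, Matrix.mul_add, smul_eq_mul]
    ring
  · simp [X]

/-- The linearized dynamics are affine in the variables, because `dR` is linear in its first
argument. -/
theorem linSlack_midpoint (a b c : Vars N n m) :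
    linSlack D c ((1 / 2 : ℝ) • (a + b)) =
      (1 / 2 : ℝ) • (linSlack D c a + linSlack D c b) := by
  ext k e
  have hS : ((1 / 2 : ℝ) • (a + b)).S k.succ = (1 / 2 : ℝ) • (a.S k.succ + b.S k.succ) := rfl
  have hd : ∀ (M₁ M₂ : Matrix (Fin n ⊕ Fin p) (Fin n) ℝ) (Q : Matrix (Fin n ⊕ Fin p) (Fin n) ℝ)
      (R : Matrix (Fin n) (Fin n) ℝ), dR ((1 / 2 : ℝ) • M₁ + (1 / 2 : ℝ) • M₂) Q R =
        (1 / 2 : ℝ) • dR M₁ Q R + (1 / 2 : ℝ) • dR M₂ Q R := by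
    intro M₁ M₂ Q R
    have h1 := dR_sub (Q := Q) (R := R) ((1 / 2 : ℝ) • M₁) ((-1 / 2 : ℝ) • M₂)
    have h2 : (1 / 2 : ℝ) • M₁ - (-1 / 2 : ℝ) • M₂ = (1 / 2 : ℝ) • M₁ + (1 / 2 : ℝ) • M₂ := by
      module
    rw [h2, dR_smul, dR_smul] at h1
    rw [h1]
    module
  simp only [linSlack, vectril, X_affine, hS, transpose_add, transpose_smul, hd, Pi.smul_apply,
    Pi.add_apply, Matrix.sub_apply, Matrix.add_apply, Matrix.smul_apply, smul_eq_mul]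
  ring

theorem ConvexFeasible.midpoint {a b : Vars N n m} (ha : ConvexFeasible D a)
    (hb : ConvexFeasible D b) : ConvexFeasible D ((1 / 2 : ℝ) • (a + b)) where
  lower k i j hij := by
    change (1 / 2 : ℝ) * (a.S k i j + b.S k i j) = 0
    rw [ha.lower k i j hij, hb.lower k i j hij]
    norm_num
  diag_nonneg k i := by
    change 0 ≤ (1 / 2 : ℝ) * (a.S k i i + b.S k i i)
    have h1 := ha.diag_nonneg k i
    have h2 := hb.diag_nonneg k i
    positivity
  mean_dyn k := by
    change (1 / 2 : ℝ) • (a.mu k.succ + b.mu k.succ) =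
      D.A k *ᵥ ((1 / 2 : ℝ) • (a.mu k.castSucc + b.mu k.castSucc)) +
        D.B k *ᵥ ((1 / 2 : ℝ) • (a.v k + b.v k))
    rw [ha.mean_dyn, hb.mean_dyn]
    simp only [mulVec_smul, mulVec_add, smul_add]
    abel
  init_mean := by
    change (1 / 2 : ℝ) • (a.mu 0 + b.mu 0) = _
    rw [ha.init_mean, hb.init_mean]
    module
  init_cov := by
    change (1 / 2 : ℝ) • (a.S 0 + b.S 0) = _
    rw [ha.init_cov, hb.init_cov]
    module
  terminal_mean := by
    change (1 / 2 : ℝ) • (a.mu (Fin.last N) + b.mu (Fin.last N)) = _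
    rw [ha.terminal_mean, hb.terminal_mean]
    module
  terminal_cov := by
    change ‖Matrix.toEuclideanCLM (n := Fin n) (𝕜 := ℝ)
      ((chol D.PFin)⁻¹ * ((1 / 2 : ℝ) • (a.S (Fin.last N) + b.S (Fin.last N))))‖ - 1 ≤ 0
    have h1 := ha.terminal_cov
    have h2 := hb.terminal_cov
    rw [Matrix.mul_smul, Matrix.mul_add, map_smul, map_add, norm_smul]
    have h3 := norm_add_le
      (Matrix.toEuclideanCLM (n := Fin n) (𝕜 := ℝ) ((chol D.PFin)⁻¹ * a.S (Fin.last N)))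
      (Matrix.toEuclideanCLM (n := Fin n) (𝕜 := ℝ) ((chol D.PFin)⁻¹ * b.S (Fin.last N)))
    have h4 : ‖(1 / 2 : ℝ)‖ = 1 / 2 := by norm_num
    rw [h4]
    linarith

/-- The cost is a quadratic form without linear part, so the convexity gap at the midpoint is
exactly the cost of the half difference. -/
theorem detCost_parallelogram (D : Problem N n m p) (a b : Vars N n m) :
    detCost D ((1 / 2 : ℝ) • (a + b)) + detCost D ((1 / 2 : ℝ) • (a - b)) =
      1 / 2 * detCost D a + 1 / 2 * detCost D b := by
  simp only [detCost, Finset.mul_sum, ← Finset.sum_add_distrib]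
  refine Finset.sum_congr rfl fun k _ => ?_
  have hvec : ∀ {d : ℕ} (Q : Matrix (Fin d) (Fin d) ℝ) (x y : Fin d → ℝ),
      ((1 / 2 : ℝ) • (x + y)) ⬝ᵥ Q *ᵥ ((1 / 2 : ℝ) • (x + y)) +
        ((1 / 2 : ℝ) • (x - y)) ⬝ᵥ Q *ᵥ ((1 / 2 : ℝ) • (x - y)) =
      1 / 2 * (x ⬝ᵥ Q *ᵥ x) + 1 / 2 * (y ⬝ᵥ Q *ᵥ y) := by
    intro d Q x y
    simp only [mulVec_add, mulVec_sub, mulVec_smul, dotProduct_add, dotProduct_sub,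
      add_dotProduct, sub_dotProduct, dotProduct_smul, smul_dotProduct, smul_eq_mul]
    ring
  have hmat : ∀ {d e : ℕ} (Q : Matrix (Fin d) (Fin d) ℝ) (x y : Matrix (Fin d) (Fin e) ℝ),
      (Q * (((1 / 2 : ℝ) • (x + y)) * ((1 / 2 : ℝ) • (x + y))ᵀ)).trace +
        (Q * (((1 / 2 : ℝ) • (x - y)) * ((1 / 2 : ℝ) • (x - y))ᵀ)).trace =
      1 / 2 * (Q * (x * xᵀ)).trace + 1 / 2 * (Q * (y * yᵀ)).trace := by
    intro d e Q x y
    simp only [transpose_smul, transpose_add, transpose_sub, Matrix.mul_smul, Matrix.smul_mul,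
      Matrix.mul_add, Matrix.mul_sub, Matrix.add_mul, Matrix.sub_mul, trace_add, trace_sub,
      trace_smul, smul_eq_mul]
    ring
  have h1 := hvec (D.Q k) (a.mu k.castSucc) (b.mu k.castSucc)
  have h2 := hvec (D.R k) (a.v k) (b.v k)
  have h3 := hmat (D.Q k) (a.S k.castSucc) (b.S k.castSucc)
  have h4 := hmat (D.R k) (a.L k) (b.L k)
  change ((((1 / 2 : ℝ) • (a.mu k.castSucc + b.mu k.castSucc)) ⬝ᵥ
        D.Q k *ᵥ ((1 / 2 : ℝ) • (a.mu k.castSucc + b.mu k.castSucc)) +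
      ((1 / 2 : ℝ) • (a.v k + b.v k)) ⬝ᵥ D.R k *ᵥ ((1 / 2 : ℝ) • (a.v k + b.v k)) +
      (D.Q k * (((1 / 2 : ℝ) • (a.S k.castSucc + b.S k.castSucc)) *
        ((1 / 2 : ℝ) • (a.S k.castSucc + b.S k.castSucc))ᵀ)).trace) +
      (D.R k * (((1 / 2 : ℝ) • (a.L k + b.L k)) * ((1 / 2 : ℝ) • (a.L k + b.L k))ᵀ)).trace) +
    ((((1 / 2 : ℝ) • (a.mu k.castSucc - b.mu k.castSucc)) ⬝ᵥ
        D.Q k *ᵥ ((1 / 2 : ℝ) • (a.mu k.castSucc - b.mu k.castSucc)) +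
      ((1 / 2 : ℝ) • (a.v k - b.v k)) ⬝ᵥ D.R k *ᵥ ((1 / 2 : ℝ) • (a.v k - b.v k)) +
      (D.Q k * (((1 / 2 : ℝ) • (a.S k.castSucc - b.S k.castSucc)) *
        ((1 / 2 : ℝ) • (a.S k.castSucc - b.S k.castSucc))ᵀ)).trace) +
      (D.R k * (((1 / 2 : ℝ) • (a.L k - b.L k)) * ((1 / 2 : ℝ) • (a.L k - b.L k))ᵀ)).trace) = _
  linarith

/-- The multiplier part is linear and has no convexity gap, hence the zero multiplier in the
difference term. -/
theorem penalty_parallelogram (ξ η lam : Slack N n) (wt : ℝ) :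
    penalty ((1 / 2 : ℝ) • (ξ + η)) wt lam + penalty ((1 / 2 : ℝ) • (ξ - η)) wt 0 =
      1 / 2 * penalty ξ wt lam + 1 / 2 * penalty η wt lam := by
  simp only [penalty, Finset.mul_sum, ← Finset.sum_add_distrib]
  refine Finset.sum_congr rfl fun k _ => Finset.sum_congr rfl fun e _ => ?_
  simp only [Pi.smul_apply, Pi.add_apply, Pi.sub_apply, Pi.zero_apply, smul_eq_mul]
  ring

theorem detCost_term_nonneg (D : Problem N n m p) (z : Vars N n m) (k : Fin N) :
    0 ≤ z.mu k.castSucc ⬝ᵥ D.Q k *ᵥ z.mu k.castSucc ∧ 0 ≤ z.v k ⬝ᵥ D.R k *ᵥ z.v k ∧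
      0 ≤ (D.Q k * (z.S k.castSucc * (z.S k.castSucc)ᵀ)).trace ∧
      0 ≤ (D.R k * (z.L k * (z.L k)ᵀ)).trace := by
  have h1 := (D.Q_posSemidef k).dotProduct_mulVec_nonneg (z.mu k.castSucc)
  have h2 := (D.R_posDef k).posSemidef.dotProduct_mulVec_nonneg (z.v k)
  rw [star_trivial] at h1 h2
  exact ⟨h1, h2, trace_mul_nonneg (D.Q_posSemidef k) (posSemidef_mul_transpose _),
    trace_mul_nonneg (D.R_posDef k).posSemidef (posSemidef_mul_transpose _)⟩

theorem detCost_nonneg (D : Problem N n m p) (z : Vars N n m) : 0 ≤ detCost D z := by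
  refine Finset.sum_nonneg fun k _ => ?_
  obtain ⟨h1, h2, h3, h4⟩ := detCost_term_nonneg D z k
  positivity

theorem eq_zero_of_trace_eq_zero {d e : ℕ} {R : Matrix (Fin d) (Fin d) ℝ} (hR : R.PosDef)
    {L : Matrix (Fin d) (Fin e) ℝ} (h : (R * (L * Lᵀ)).trace = 0) : L = 0 := by
  have hp := hR.posSemidef.conjTranspose_mul_mul_same L
  rw [conjTranspose_eq_transpose_of_trivial] at hp
  have h1 : Lᵀ * R * L = 0 := by
    refine hp.trace_eq_zero_iff.1 ?_
    rw [← h, Matrix.mul_assoc, trace_mul_comm, Matrix.mul_assoc]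
  ext i j
  by_contra hne
  have hcol : (fun i => L i j) ≠ 0 := fun hc => hne (congrFun hc i)
  have h2 := hR.dotProduct_mulVec_pos hcol
  have h3 : star (fun i => L i j) ⬝ᵥ R *ᵥ (fun i => L i j) = (Lᵀ * R * L) j j := by
    rw [star_trivial, Matrix.mul_assoc, Matrix.mul_apply]
    rfl
  rw [h3, h1] at h2
  exact lt_irrefl _ h2

/-- `μ` and `S` are absent from the conclusion because `Q` is only semidefinite; they are recovered
from the dynamics elsewhere. -/
theorem eq_zero_of_detCost_eq_zero {z : Vars N n m} (h : detCost D z = 0) (k : Fin N) :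
    z.v k = 0 ∧ z.L k = 0 := by
  have h0 := (Finset.sum_eq_zero_iff_of_nonneg fun k _ => by
    obtain ⟨h1, h2, h3, h4⟩ := detCost_term_nonneg D z k
    positivity).1 h k (Finset.mem_univ k)
  obtain ⟨h1, h2, h3, h4⟩ := detCost_term_nonneg D z k
  constructor
  · by_contra hne
    have := (D.R_posDef k).dotProduct_mulVec_pos hne
    rw [star_trivial] at this
    linarith
  · exact eq_zero_of_trace_eq_zero (D.R_posDef k) (by linarith)

theorem penalty_zero_mult_nonneg (ξ : Slack N n) {wt : ℝ} (hw : 0 < wt) :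
    0 ≤ penalty ξ wt 0 := by
  refine Finset.sum_nonneg fun k _ => ?_
  have h : 0 ≤ ∑ e, ξ k e ^ 2 := Finset.sum_nonneg fun e _ => sq_nonneg _
  simp only [Pi.zero_apply, zero_mul, Finset.sum_const_zero, zero_add]
  positivity

theorem eq_zero_of_penalty_eq_zero {ξ : Slack N n} {wt : ℝ} (hw : 0 < wt)
    (h : penalty ξ wt 0 = 0) : ξ = 0 := by
  refine infeas_eq_zero_of_norm (le_of_eq (Real.sqrt_eq_zero'.2 (le_of_eq ?_)))
  simp only [penalty, Pi.zero_apply, zero_mul, Finset.sum_const_zero, zero_add,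
    ← Finset.mul_sum] at h
  exact (mul_eq_zero.1 h).resolve_left (by positivity)

/-- The first component of a solution of the subproblem is unique: if the reference point attains
the optimal value with its own slack, then it is the solution. -/
theorem SolvesSub.eq_ref {s : AlgState N n m} {y : Vars N n m × Slack N n}
    (h : SolvesSub D prm s y) (href : ConvexFeasible D s.ref) (hw : 0 < s.wt) (hr : 0 ≤ s.r)
    (hval : augLin D s.ref (infeas D s.ref) s.wt s.lam = augLin D y.1 y.2 s.wt s.lam) :
    y.1 = s.ref := by
  -- The midpoint of two optimal points is a competitor, so both convexity gaps must vanish.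
  have hmid := h.le (href.midpoint h.1.convex) (fun k i j => by
    rw [X_affine, sub_self, smul_zero, zero_add, Matrix.mul_smul, Matrix.smul_apply, smul_eq_mul,
      abs_mul]
    have := h.1.trust k i j
    rw [abs_of_pos (by norm_num : (0 : ℝ) < 1 / 2)]
    linarith)
  rw [linSlack_midpoint, linSlack_self, ← h.1.slack_eq] at hmid
  have h1 := detCost_parallelogram D s.ref y.1
  have h2 := penalty_parallelogram (infeas D s.ref) y.2 s.lam s.wt
  have h3 := detCost_nonneg D ((1 / 2 : ℝ) • (s.ref - y.1))
  have h4 := penalty_zero_mult_nonneg ((1 / 2 : ℝ) • (infeas D s.ref - y.2)) hw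
  simp only [augLin] at hmid hval
  have h5 : detCost D ((1 / 2 : ℝ) • (s.ref - y.1)) = 0 := by linarith
  have h6 : penalty ((1 / 2 : ℝ) • (infeas D s.ref - y.2)) s.wt 0 = 0 := by linarith
  have hv : y.1.v = s.ref.v := by
    ext1 k
    have h7 : (1 / 2 : ℝ) • (s.ref.v k - y.1.v k) = 0 := (eq_zero_of_detCost_eq_zero h5 k).1
    exact (sub_eq_zero.1 ((smul_eq_zero.1 h7).resolve_left (by norm_num))).symm
  have hL : y.1.L = s.ref.L := by
    ext1 k
    have h7 : (1 / 2 : ℝ) • (s.ref.L k - y.1.L k) = 0 := (eq_zero_of_detCost_eq_zero h5 k).2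
    exact (sub_eq_zero.1 ((smul_eq_zero.1 h7).resolve_left (by norm_num))).symm
  have hξ : y.2 = infeas D s.ref := by
    have h7 := eq_zero_of_penalty_eq_zero hw h6
    exact (sub_eq_zero.1 ((smul_eq_zero.1 h7).resolve_left (by norm_num))).symm
  -- Means and square roots follow by recursion from `v`, `L`, the slack and the common initial
  -- values.
  have hmu : y.1.mu = s.ref.mu := by
    ext1 k
    rw [← h.1.convex.meanSeq_eq, ← href.meanSeq_eq, hv]
  have hS : y.1.S = s.ref.S := by
    ext1 k
    induction k using Fin.induction with
    | zero => rw [h.1.convex.init_cov, href.init_cov]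
    | succ k ih =>
      have hX : X D y.1 k = X D s.ref k := by rw [X, X, ih, hL]
      have h8 := h.1.linearized k
      rw [hX, hξ, sub_self, transpose_zero, dR_zero, transpose_zero, sub_zero] at h8
      refine vectril_injOn (h.1.convex.lower _) (href.lower _) ?_
      have h9 : vectril (y.1.S k.succ - (qrR (X D s.ref k)ᵀ)ᵀ) =
        vectril (s.ref.S k.succ - (qrR (X D s.ref k)ᵀ)ᵀ) := h8
      rw [vectril_sub, vectril_sub] at h9
      exact sub_left_injective h9
  exact Prod.ext hv (Prod.ext hL (Prod.ext hmu hS))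

/-! ### Invariants of the loop -/

/-- The properties of the algorithm state that every iteration preserves. -/
structure LoopInvariant (D : Problem N n m p) (prm : Params n) (s : AlgState N n m) : Prop where
  convex : ConvexFeasible D s.ref
  wt_pos : 0 < s.wt
  radius_mem : s.r ∈ Set.Icc prm.rMin prm.rMax

theorem IsInit.loopInvariant {s : AlgState N n m} (h : IsInit D prm s) :
    LoopInvariant D prm s :=
  ⟨h.convex, h.wt_eq ▸ prm.wInit_pos, h.r_eq ▸ ⟨prm.rMin_le, prm.le_rMax⟩⟩

theorem Step.loopInvariant {rules : UpdateRules N prm} {s s' : AlgState N n m}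
    {y : Vars N n m × Slack N n} (h : Step D prm rules s y s') (hs : LoopInvariant D prm s) :
    LoopInvariant D prm s' := by
  refine ⟨?_, ?_, h.radius_eq ▸ rules.radius_mem _ _ hs.radius_mem⟩
  · rw [h.ref_eq]
    split_ifs
    · exact h.solves.1.convex
    · exact hs.convex
  · have h1 : s'.wt = (s'.lam, s'.delta, s'.wt).2.2 := rfl
    rw [h1, h.mult_eq]
    split_ifs
    · exact rules.weight_pos _ _ _ hs.wt_pos
    · exact hs.wt_pos

theorem LoopInvariant.radius_pos {s : AlgState N n m} (h : LoopInvariant D prm s) : 0 < s.r :=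
  prm.rMin_pos.trans_le h.radius_mem.1

/-! ### Termination with tolerances zero -/

theorem mixPath_trust {z : Vars N n m} (hz : z ∈ detFeasible D) (v : Fin N → Fin m → ℝ)
    (K : Fin N → Matrix (Fin m) (Fin n) ℝ) {r : ℝ} (hr : 0 < r) (DX : Matrix (Fin n) (Fin n) ℝ) :
    ∀ᶠ t in 𝓝[>] 0, ∀ (k : Fin N) (i : Fin n) (j : Fin n ⊕ Fin p),
      |(DX * (X D (mixPath D z v K t) k - X D z k)) i j| ≤ r := by
  refine eventually_all.2 fun k => eventually_all.2 fun i => eventually_all.2 fun j => ?_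
  have h1 := (mixPath_X hz v K k).const_mul DX
  have h2 := (tendsto_matrix_iff.1 (h1.tendsto_zero tendsto_id_nhdsGT) i j).abs
  simp only [Matrix.zero_apply, abs_zero] at h2
  exact (h2.eventually_lt_const hr).mono fun t ht => ht.le

theorem penalty_isBigO {α : Type*} {l : Filter α} {ξ : α → Slack N n} {g : α → ℝ}
    (h : ∀ k e, (fun a => ξ a k e) =O[l] g) (hg : Tendsto g l (𝓝 0)) (wt : ℝ)
    (lam : Slack N n) : (fun a => penalty (ξ a) wt lam) =O[l] g := by
  have hg2 : (fun a => g a * g a) =O[l] g := by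
    simpa using (hg.isBigO_one ℝ).mul (Asymptotics.isBigO_refl g l)
  refine Asymptotics.IsBigO.fun_sum fun k _ => Asymptotics.IsBigO.add
    (Asymptotics.IsBigO.fun_sum fun e _ => (h k e).const_mul_left _)
    ((Asymptotics.IsBigO.fun_sum fun e _ => ?_).const_mul_left _)
  simpa only [sq] using ((h k e).mul (h k e)).trans hg2

/-- A feasible point that solves the subproblem linearized at itself is not worse than any
controller. -/
theorem detCost_le_of_solvesSub {s : AlgState N n m} {y : Vars N n m × Slack N n}
    (h : SolvesSub D prm s y) (hy : y.1 = s.ref) (hz : s.ref ∈ detFeasible D) (hr : 0 < s.r)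
    {v : Fin N → Fin m → ℝ} {K : Fin N → Matrix (Fin m) (Fin n) ℝ} (ho : TerminalOK D v K) :
    detCost D s.ref ≤ ctrlCost D v K := by
  by_contra! hlt
  have hRS : ∀ k, (qrR (X D s.ref k)ᵀ)ᵀ = s.ref.S k.succ := fun k => by
    rw [(feasible_isQR hz k).qrR_eq, transpose_transpose]
  have hy2 : y.2 = 0 := by
    rw [h.1.slack_eq, hy, linSlack_self]
    ext1 k
    rw [infeas, hRS, sub_self]
    rfl
  -- The curve obeys the nonlinear dynamics, so its slack in the linearized dynamics is only the
  -- second-order remainder.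
  have hslack : ∀ k e, (fun t => linSlack D s.ref (mixPath D s.ref v K t) k e)
      =O[𝓝[>] 0] fun t => t * t := by
    intro k e
    have h1 := mixPath_defect hz v K k e.1.1 e.1.2
    simpa only [linSlack, vectril, hRS k] using h1
  have hg : Tendsto (fun t : ℝ => t * t) (𝓝[>] 0) (𝓝 0) := by
    simpa using tendsto_id_nhdsGT.mul tendsto_id_nhdsGT
  have hsq : (fun t : ℝ => t * t) =o[𝓝[>] 0] fun t => t := by
    simpa using ((Asymptotics.isLittleO_one_iff ℝ).2 tendsto_id_nhdsGT).mul_isBigO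
      (Asymptotics.isBigO_refl (fun t : ℝ => t) (𝓝[>] 0))
  have hpen := (penalty_isBigO hslack hg s.wt s.lam).trans_isLittleO hsq
  -- Half of the gap: for small `t` the penalty costs at most half of the linear decrease along the
  -- curve.
  have hgap : 0 < (detCost D s.ref - ctrlCost D v K) / 2 := by linarith
  obtain ⟨t, h1, h2, h3, h4, h5⟩ := ((hpen.bound hgap).and ((mixPath_mem hz ho).and
    ((detCost_mixPath_le hz (v := v) (K := K)).and ((mixPath_trust hz v K hr prm.DX).and
      eventually_mem_Ioo)))).exists
  have h6 := h.le h2.1 h4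
  rw [Real.norm_eq_abs, Real.norm_eq_abs, abs_of_pos h5.1] at h1
  have h7 := (abs_le.1 h1).2
  simp only [augLin, hy, hy2] at h6
  have h8 : penalty (0 : Slack N n) s.wt s.lam = 0 := by simp [penalty]
  rw [h8] at h6
  have h9 : 0 < t * (detCost D s.ref - ctrlCost D v K) := mul_pos h5.1 (by linarith)
  nlinarith

theorem TerminatesAt.globallyOptimal {rules : UpdateRules N prm} {s : ℕ → AlgState N n m}
    {y : ℕ → Vars N n m × Slack N n} {T : ℕ} (h : TerminatesAt D prm rules s y T)
    {Ω : Type*} [MeasurableSpace Ω] {P : Measure Ω} [IsProbabilityMeasure P]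
    {x₀ : Ω → Fin n → ℝ} {w : Fin N → Ω → Fin p → ℝ} (hnoise : IsNoise D P x₀ w) :
    GloballyOptimal D P x₀ w (y T).1 := by
  have hinv : ∀ i ≤ T, LoopInvariant D prm (s i) := by
    intro i hi
    induction i with
    | zero => exact h.init.loopInvariant
    | succ i ih => exact (h.step i (by omega)).loopInvariant (ih (by omega))
  have hT := hinv T le_rfl
  have hstep := h.step T le_rfl
  have hdJ : deltaJ D (s T) (y T) = 0 := abs_nonpos_iff.1 h.stops.1
  -- Otherwise the acceptance ratio would be `0`, below the positive threshold.
  have hdL : deltaL D (s T) (y T) = 0 := by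
    by_contra hne
    have hacc := h.accepted
    rw [Accepted, ratio, if_neg hne, hdJ, zero_div] at hacc
    exact hacc.not_gt prm.rho0_pos
  have heq : (y T).1 = (s T).ref :=
    hstep.solves.eq_ref hT.convex hT.wt_pos hT.radius_pos.le (sub_eq_zero.1 hdL)
  have hmem : (y T).1 ∈ detFeasible D := mem_detFeasible_of_infeas hstep.solves.1.convex
    hstep.rank_sol (infeas_eq_zero_of_norm h.stops.2)
  refine globallyOptimal_of_le hnoise hmem fun v K ho => ?_
  rw [heq]
  exact detCost_le_of_solvesSub hstep.solves heq (heq ▸ hmem) hT.radius_pos ho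

end Subproblem

/-! ## Propagation of the linearized dynamics -/

section Propagation

variable {N n m p : ℕ} {D : Problem N n m p}

/-- Square roots propagated by the dynamics linearized at `a`, with prescribed slack. -/
def linProp (D : Problem N n m p) (a : Vars N n m) (ξ : Slack N n)
    (L : Fin N → Matrix (Fin m) (Fin n) ℝ) : Fin (N + 1) → Matrix (Fin n) (Fin n) ℝ :=
  fun k => Fin.induction (motive := fun _ => Matrix (Fin n) (Fin n) ℝ) (chol D.PInit)
    (fun k S => Matrix.of fun i j => if h : j ≤ i then
      ((qrR (X D a k)ᵀ)ᵀ + (dR (Matrix.fromCols (D.A k * S + D.B k * L k) (D.G k) - X D a k)ᵀ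
        (qrQ (X D a k)ᵀ) (qrR (X D a k)ᵀ))ᵀ) i j + ξ k ⟨(i, j), h⟩ else 0) k

/-- The variables with given nominal controls and `L`, with propagated means and square roots. -/
def linVars (D : Problem N n m p) (a : Vars N n m) (ξ : Slack N n) (v : Fin N → Fin m → ℝ)
    (L : Fin N → Matrix (Fin m) (Fin n) ℝ) : Vars N n m :=
  (v, L, meanSeq D v, linProp D a ξ L)

theorem linVars_S_succ (a : Vars N n m) (ξ : Slack N n) (v : Fin N → Fin m → ℝ)
    (L : Fin N → Matrix (Fin m) (Fin n) ℝ) (k : Fin N) {i j : Fin n} (h : j ≤ i) :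
    (linVars D a ξ v L).S k.succ i j = ((qrR (X D a k)ᵀ)ᵀ + (dR
      (X D (linVars D a ξ v L) k - X D a k)ᵀ (qrQ (X D a k)ᵀ) (qrR (X D a k)ᵀ))ᵀ) i j +
        ξ k ⟨(i, j), h⟩ :=
  dif_pos h

theorem linVars_S_isLT (a : Vars N n m) (ξ : Slack N n) (v : Fin N → Fin m → ℝ)
    (L : Fin N → Matrix (Fin m) (Fin n) ℝ) (k : Fin (N + 1)) :
    IsLT ((linVars D a ξ v L).S k) := by
  induction k using Fin.cases with
  | zero => exact (isCholesky_chol D.PInit_posDef).lower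
  | succ k => exact fun i j hij => dif_neg (not_le.2 hij)

/-- The slack can be prescribed freely, so a competitor can be given exactly the penalty of a
subproblem solution. -/
theorem linSlack_linVars (a : Vars N n m) (ξ : Slack N n) (v : Fin N → Fin m → ℝ)
    (L : Fin N → Matrix (Fin m) (Fin n) ℝ) : linSlack D a (linVars D a ξ v L) = ξ := by
  ext k ⟨⟨i, j⟩, h⟩
  have h1 := linVars_S_succ (D := D) a ξ v L k (i := i) (j := j) h
  simp only [linSlack, vectril, Matrix.sub_apply]
  rw [h1, Matrix.add_apply]
  ring

theorem tendsto_X {α : Type*} {l : Filter α} {f : α → Vars N n m} {z : Vars N n m} {k : Fin N}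
    (hS : Tendsto (fun a => (f a).S k.castSucc) l (𝓝 (z.S k.castSucc)))
    (hL : Tendsto (fun a => (f a).L k) l (𝓝 (z.L k))) :
    Tendsto (fun a => X D (f a) k) l (𝓝 (X D z k)) := by
  have h := (tendsto_mul (tendsto_const_nhds (x := D.A k)) hS).add
    (tendsto_mul (tendsto_const_nhds (x := D.B k)) hL)
  refine tendsto_matrix_iff.2 fun i j => ?_
  rcases j with j | j
  · exact tendsto_matrix_iff.1 h i j
  · exact tendsto_const_nhds

/-- Continuity of the propagation in the linearization point and the slack. -/
theorem tendsto_linVars {α : Type*} {l : Filter α} {a : α → Vars N n m} {z : Vars N n m}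
    {ξ : α → Slack N n} {ξ₀ : Slack N n} (v : Fin N → Fin m → ℝ)
    (L : Fin N → Matrix (Fin m) (Fin n) ℝ)
    (hX : ∀ k, Tendsto (fun i => X D (a i) k) l (𝓝 (X D z k)))
    (hQ : ∀ k, Tendsto (fun i => qrQ (X D (a i) k)ᵀ) l (𝓝 (qrQ (X D z k)ᵀ)))
    (hR : ∀ k, Tendsto (fun i => qrR (X D (a i) k)ᵀ) l (𝓝 (qrR (X D z k)ᵀ)))
    (hu : ∀ k, IsUnit (qrR (X D z k)ᵀ).det) (hξ : Tendsto ξ l (𝓝 ξ₀)) :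
    Tendsto (fun i => linVars D (a i) (ξ i) v L) l (𝓝 (linVars D z ξ₀ v L)) := by
  have hS : ∀ k, Tendsto (fun i => (linVars D (a i) (ξ i) v L).S k) l
      (𝓝 ((linVars D z ξ₀ v L).S k)) := by
    intro k
    induction k using Fin.induction with
    | zero => exact tendsto_const_nhds
    | succ k ih =>
      have h1 : Tendsto (fun i => X D (linVars D (a i) (ξ i) v L) k) l
          (𝓝 (X D (linVars D z ξ₀ v L) k)) := tendsto_X ih tendsto_const_nhds
      have h2 := (tendsto_transpose (hR k)).add (tendsto_transpose
        (tendsto_dR (tendsto_transpose (h1.sub (hX k))) (hQ k) (hR k) (hu k)))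
      refine tendsto_matrix_iff.2 fun i j => ?_
      by_cases hij : j ≤ i
      · simp only [linVars_S_succ _ _ _ _ _ hij]
        exact (tendsto_matrix_iff.1 h2 i j).add
          (tendsto_pi_nhds.1 (tendsto_pi_nhds.1 hξ k) ⟨(i, j), hij⟩)
      · simp only [linVars_S_isLT _ _ _ _ k.succ i j (not_le.1 hij)]
        exact tendsto_const_nhds
  exact tendsto_const_nhds.prodMk_nhds (tendsto_const_nhds.prodMk_nhds
    (tendsto_const_nhds.prodMk_nhds (tendsto_pi_nhds.2 hS)))

theorem EntryO.dR {ι α : Type*} [Fintype ι] {l : Filter α} {f : α → Matrix ι (Fin n) ℝ}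
    {g : α → ℝ} (hf : EntryO l f g) (Q : Matrix ι (Fin n) ℝ) (R : Matrix (Fin n) (Fin n) ℝ) :
    EntryO l (fun a => dR (f a) Q R) g := by
  have h1 := hf.const_mul Qᵀ
  have h2 := h1.mul_const R⁻¹
  have h3 : EntryO l (fun a => strictLower (Qᵀ * f a * R⁻¹)) g := by
    intro i j
    by_cases hij : j < i
    · simpa [strictLower, hij] using h2 i j
    · simpa [strictLower, hij] using Asymptotics.isBigO_zero _ _
  exact h1.sub ((h3.sub h3.transpose).mul_const R)

/-- Along the curve of mixtures, the linearized dynamics reproduce the square roots to second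
order. -/
theorem linVars_sub_mixPath {z : Vars N n m} (hz : z ∈ detFeasible D)
    (v : Fin N → Fin m → ℝ) (K : Fin N → Matrix (Fin m) (Fin n) ℝ) (k : Fin (N + 1)) :
    EntryO (𝓝[>] 0) (fun t => (linVars D z 0 (mixControl z.v v t) (mixPath D z v K t).L).S k -
      (mixPath D z v K t).S k) (fun t => t * t) := by
  induction k using Fin.induction with
  | zero =>
    have : ∀ t, (linVars D z 0 (mixControl z.v v t) (mixPath D z v K t).L).S 0 -
        (mixPath D z v K t).S 0 = 0 := fun t => sub_self _
    simp only [this]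
    exact fun i j => Asymptotics.isBigO_zero _ _
  | succ k ih =>
    have hL : EntryO (𝓝[>] 0) (fun t =>
        (linVars D z 0 (mixControl z.v v t) (mixPath D z v K t).L).L k -
          (mixPath D z v K t).L k) (fun t => t * t) := by
      have : ∀ t, (linVars D z 0 (mixControl z.v v t) (mixPath D z v K t).L).L k -
          (mixPath D z v K t).L k = 0 := fun t => sub_self _
      simp only [this]
      exact fun i j => Asymptotics.isBigO_zero _ _
    have h1 := ((X_sub_isBigO (D := D) ih hL).transpose.dR (qrQ (X D z k)ᵀ)
      (qrR (X D z k)ᵀ)).transpose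
    -- The new error is the linearized propagation of the old error minus the defect of the curve.
    have h2 := h1.sub (mixPath_defect hz v K k)
    intro i j
    by_cases hij : j ≤ i
    · refine (h2 i j).congr' (Eventually.of_forall fun t => ?_) EventuallyEq.rfl
      have hRS : (qrR (X D z k)ᵀ)ᵀ = z.S k.succ := by
        rw [(feasible_isQR hz k).qrR_eq, transpose_transpose]
      have hsplit : dR (X D (linVars D z 0 (mixControl z.v v t) (mixPath D z v K t).L) k -
          X D (mixPath D z v K t) k)ᵀ (qrQ (X D z k)ᵀ) (qrR (X D z k)ᵀ) =
          dR (X D (linVars D z 0 (mixControl z.v v t) (mixPath D z v K t).L) k -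
            X D z k)ᵀ (qrQ (X D z k)ᵀ) (qrR (X D z k)ᵀ) -
          dR (X D (mixPath D z v K t) k - X D z k)ᵀ (qrQ (X D z k)ᵀ) (qrR (X D z k)ᵀ) := by
        rw [← dR_sub, ← transpose_sub, sub_sub_sub_cancel_right]
      have h3 := linVars_S_succ (D := D) z 0 (mixControl z.v v t) (mixPath D z v K t).L k hij
      rw [hRS] at h3
      beta_reduce
      rw [hsplit]
      simp only [Matrix.sub_apply, Matrix.add_apply, transpose_apply, Pi.zero_apply] at h3 ⊢
      rw [h3]
      ring
    · refine (Asymptotics.isBigO_zero _ _).congr' ?_ EventuallyEq.rfl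
      filter_upwards [(mixPath_S hz v K k.succ).1] with t ht
      have h3 : (mixPath D z v K t).S k.succ i j = 0 :=
        (isCholesky_chol ht).lower i j (not_le.1 hij)
      rw [Matrix.sub_apply, h3, linVars_S_isLT _ _ _ _ k.succ i j (not_le.1 hij), sub_zero]

theorem linVars_tendsto {z : Vars N n m} (hz : z ∈ detFeasible D)
    (v : Fin N → Fin m → ℝ) (K : Fin N → Matrix (Fin m) (Fin n) ℝ) (k : Fin (N + 1)) :
    Tendsto (fun t => (linVars D z 0 (mixControl z.v v t) (mixPath D z v K t).L).S k) (𝓝[>] 0)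
      (𝓝 (z.S k)) := by
  have hg : Tendsto (fun t : ℝ => t * t) (𝓝[>] 0) (𝓝 0) := by
    simpa using tendsto_id_nhdsGT.mul tendsto_id_nhdsGT
  have h1 := (linVars_sub_mixPath hz v K k).tendsto_zero hg
  have h2 := h1.add (tendsto_of_sub_isBigO (mixPath_S hz v K k).2 tendsto_id_nhdsGT)
  simpa using h2

theorem gram_linVars_sub_mixPath {z : Vars N n m} (hz : z ∈ detFeasible D)
    (v : Fin N → Fin m → ℝ) (K : Fin N → Matrix (Fin m) (Fin n) ℝ) (k : Fin (N + 1)) :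
    EntryO (𝓝[>] 0) (fun t =>
      (linVars D z 0 (mixControl z.v v t) (mixPath D z v K t).L).S k *
        ((linVars D z 0 (mixControl z.v v t) (mixPath D z v K t).L).S k)ᵀ -
      (mixPath D z v K t).S k * ((mixPath D z v K t).S k)ᵀ) (fun t => t * t) := by
  have h0 := linVars_sub_mixPath hz v K k
  have h1 := h0.mul_tendsto (tendsto_transpose (linVars_tendsto hz v K k))
  have h2 := h0.transpose.tendsto_mul
    (tendsto_of_sub_isBigO (mixPath_S hz v K k).2 tendsto_id_nhdsGT)
  refine (h1.add h2).congr' (Eventually.of_forall fun t => ?_)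
  simp only [Matrix.sub_mul, Matrix.mul_sub, transpose_sub]
  abel

/-- The propagated square roots meet the terminal bound strictly. -/
theorem linVars_terminal {z : Vars N n m} (hz : z ∈ detFeasible D)
    {v : Fin N → Fin m → ℝ} {K : Fin N → Matrix (Fin m) (Fin n) ℝ}
    (hK : (D.PFin - covSeq D K (Fin.last N)).PosDef) :
    ∀ᶠ t in 𝓝[>] 0, (D.PFin -
      (linVars D z 0 (mixControl z.v v t) (mixPath D z v K t).L).S (Fin.last N) *
        ((linVars D z 0 (mixControl z.v v t) (mixPath D z v K t).L).S (Fin.last N))ᵀ).PosDef := by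
  set E : ℝ → Matrix (Fin n) (Fin n) ℝ := fun t =>
    (linVars D z 0 (mixControl z.v v t) (mixPath D z v K t).L).S (Fin.last N) *
        ((linVars D z 0 (mixControl z.v v t) (mixPath D z v K t).L).S (Fin.last N))ᵀ -
      (mixPath D z v K t).S (Fin.last N) * ((mixPath D z v K t).S (Fin.last N))ᵀ with hE
  have hEO : EntryO (𝓝[>] 0) E (fun t => t * t) := gram_linVars_sub_mixPath hz v K _
  -- The target's strict margin enters with weight `t`. After division by `t` the error `E = O(t²)`
  -- vanishes in the limit, so the margin outweighs it.
  have hlim : Tendsto (fun t => (D.PFin - covSeq D K (Fin.last N)) - t⁻¹ • E t) (𝓝[>] 0)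
      (𝓝 (D.PFin - covSeq D K (Fin.last N))) := by
    have h1 : EntryO (𝓝[>] 0) (fun t => t⁻¹ • E t) (fun t => t) := by
      intro i j
      have h2 := (Asymptotics.isBigO_refl (fun t : ℝ => t⁻¹) (𝓝[>] 0)).mul (hEO i j)
      refine h2.congr' (Eventually.of_forall fun t => rfl) ?_
      filter_upwards [eventually_mem_Ioo] with t ht
      exact inv_mul_cancel_left₀ ht.1.ne' t
    simpa using (h1.tendsto_zero tendsto_id_nhdsGT).const_sub
      (D.PFin - covSeq D K (Fin.last N))
  have hpd := eventually_posDef hlim hK (Eventually.of_forall fun t => by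
    have h1 := hK.1
    have h2 := (posSemidef_mul_transpose
      ((linVars D z 0 (mixControl z.v v t) (mixPath D z v K t).L).S (Fin.last N))).1
    have h3 := (posSemidef_mul_transpose ((mixPath D z v K t).S (Fin.last N))).1
    have h4 : (t⁻¹ • E t).IsHermitian := by
      rw [IsHermitian, conjTranspose_smul, star_trivial, (h2.sub h3).eq]
    exact h1.sub h4)
  filter_upwards [hpd, eventually_mem_Ioo, (mixPath_S hz v K (Fin.last N)).1] with t h1 ht h2
  have h3 := posSemidef_sub_mix (C := D.PFin) (K₂ := K) (covSeq_feasible_posDef hz) ht.1.le ht.2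
    (Fin.last N)
  have h4 := (terminalOK_of_feasible hz).2
  have h5 := ((h1.smul ht.1).posSemidef_add (h4.smul (sub_nonneg.2 ht.2.le))).posSemidef_add h3
  convert h5 using 1
  have h6 : covSeq D (mixGain D z.K K t) (Fin.last N) =
      (mixPath D z v K t).S (Fin.last N) * ((mixPath D z v K t).S (Fin.last N))ᵀ :=
    (isCholesky_chol h2).eq
  rw [h6, smul_sub t _ (t⁻¹ • E t), smul_inv_smul₀ ht.1.ne']
  simp only [hE]
  abel

/-- The propagated point differs from the curve only in `S`, with an effect `O(t²)` on the cost,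
whereas the curve gains order `t`. -/
theorem detCost_linVars_lt {z : Vars N n m} (hz : z ∈ detFeasible D)
    {v : Fin N → Fin m → ℝ} {K : Fin N → Matrix (Fin m) (Fin n) ℝ}
    (hlt : ctrlCost D v K < detCost D z) :
    ∀ᶠ t in 𝓝[>] 0,
      detCost D (linVars D z 0 (mixControl z.v v t) (mixPath D z v K t).L) < detCost D z := by
  have hdiff : ∀ t, detCost D (linVars D z 0 (mixControl z.v v t) (mixPath D z v K t).L) -
      detCost D (mixPath D z v K t) = ∑ k : Fin N, (D.Q k *
        ((linVars D z 0 (mixControl z.v v t) (mixPath D z v K t).L).S k.castSucc *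
          ((linVars D z 0 (mixControl z.v v t) (mixPath D z v K t).L).S k.castSucc)ᵀ -
        (mixPath D z v K t).S k.castSucc * ((mixPath D z v K t).S k.castSucc)ᵀ)).trace := by
    intro t
    rw [detCost, detCost, ← Finset.sum_sub_distrib]
    refine Finset.sum_congr rfl fun k _ => ?_
    rw [Matrix.mul_sub, trace_sub]
    have e₁ : (linVars D z 0 (mixControl z.v v t) (mixPath D z v K t).L).mu =
      (mixPath D z v K t).mu := rfl
    have e₂ : (linVars D z 0 (mixControl z.v v t) (mixPath D z v K t).L).v =
      (mixPath D z v K t).v := rfl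
    have e₃ : (linVars D z 0 (mixControl z.v v t) (mixPath D z v K t).L).L =
      (mixPath D z v K t).L := rfl
    rw [e₁, e₂, e₃]
    ring
  have hO : (fun t => detCost D (linVars D z 0 (mixControl z.v v t) (mixPath D z v K t).L) -
      detCost D (mixPath D z v K t)) =O[𝓝[>] 0] fun t => t * t := by
    simp only [hdiff, Matrix.trace, Matrix.diag]
    exact Asymptotics.IsBigO.fun_sum fun k _ => Asymptotics.IsBigO.fun_sum fun i _ =>
      (gram_linVars_sub_mixPath hz v K k.castSucc).const_mul (D.Q k) i i
  have hsq : (fun t : ℝ => t * t) =o[𝓝[>] 0] fun t => t := by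
    simpa using ((Asymptotics.isLittleO_one_iff ℝ).2 tendsto_id_nhdsGT).mul_isBigO
      (Asymptotics.isBigO_refl (fun t : ℝ => t) (𝓝[>] 0))
  have hgap : 0 < (detCost D z - ctrlCost D v K) / 2 := by linarith
  filter_upwards [(hO.trans_isLittleO hsq).bound hgap,
    detCost_mixPath_le hz (v := v) (K := K), eventually_mem_Ioo] with t h1 h2 ht
  rw [Real.norm_eq_abs, Real.norm_eq_abs, abs_of_pos ht.1] at h1
  have h3 := (abs_le.1 h1).2
  have h4 : 0 < t * (detCost D z - ctrlCost D v K) := mul_pos ht.1 (by linarith)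
  nlinarith

theorem continuous_detCost (D : Problem N n m p) : Continuous (detCost D) := by
  have hv : Continuous fun z : Vars N n m => z.v := continuous_fst
  have hL : Continuous fun z : Vars N n m => z.L := continuous_fst.comp continuous_snd
  have hmu : Continuous fun z : Vars N n m => z.mu :=
    continuous_fst.comp (continuous_snd.comp continuous_snd)
  have hS : Continuous fun z : Vars N n m => z.S :=
    continuous_snd.comp (continuous_snd.comp continuous_snd)
  have hv' := fun k => (continuous_apply k).comp hv
  have hL' := fun k => (continuous_apply k).comp hL
  have hmu' := fun k => (continuous_apply k).comp hmu
  have hS' := fun k => (continuous_apply k).comp hS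
  refine continuous_finsetSum _ fun k _ => ((Continuous.add ?_ ?_).add ?_).add ?_
  · exact (hmu' _).dotProduct (continuous_const.matrix_mulVec (hmu' _))
  · exact (hv' _).dotProduct (continuous_const.matrix_mulVec (hv' _))
  · exact (continuous_const.matrix_mul ((hS' _).matrix_mul (hS' _).matrix_transpose)).matrix_trace
  · exact (continuous_const.matrix_mul ((hL' _).matrix_mul (hL' _).matrix_transpose)).matrix_trace

end Propagation

/-! ## Limits of the algorithm -/

section Limits

variable {N n m p : ℕ} {D : Problem N n m p} {α : Type*} {l : Filter α}

theorem tendsto_vars {f : α → Vars N n m} {z : Vars N n m} (h : Tendsto f l (𝓝 z)) :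
    (∀ k, Tendsto (fun a => (f a).v k) l (𝓝 (z.v k))) ∧
    (∀ k, Tendsto (fun a => (f a).L k) l (𝓝 (z.L k))) ∧
    (∀ k, Tendsto (fun a => (f a).mu k) l (𝓝 (z.mu k))) ∧
    ∀ k, Tendsto (fun a => (f a).S k) l (𝓝 (z.S k)) := by
  have h1 := (continuous_fst.tendsto z).comp h
  have h2 := (continuous_snd.tendsto z).comp h
  have h3 := (continuous_fst.tendsto _).comp h2
  have h4 := (continuous_snd.tendsto _).comp h2
  have h5 := (continuous_fst.tendsto _).comp h4
  have h6 := (continuous_snd.tendsto _).comp h4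
  exact ⟨tendsto_pi_nhds.1 h1, tendsto_pi_nhds.1 h3, tendsto_pi_nhds.1 h5, tendsto_pi_nhds.1 h6⟩

theorem convexFeasible_of_tendsto [l.NeBot] {f : α → Vars N n m} {z : Vars N n m}
    (h : Tendsto f l (𝓝 z)) (hf : ∀ a, ConvexFeasible D (f a)) : ConvexFeasible D z := by
  obtain ⟨hv, -, hmu, hS⟩ := tendsto_vars h
  refine ⟨fun k i j hij => ?_, fun k i => ?_, fun k => ?_, ?_, ?_, ?_, ?_⟩
  · refine tendsto_nhds_unique (tendsto_matrix_iff.1 (hS k) i j) ?_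
    simp only [(hf _).lower k i j hij]
    exact tendsto_const_nhds
  · exact ge_of_tendsto' (tendsto_matrix_iff.1 (hS k) i i) fun a => (hf a).diag_nonneg k i
  · refine tendsto_nhds_unique (hmu k.succ) ?_
    simp only [(hf _).mean_dyn k]
    exact (tendsto_mulVec tendsto_const_nhds (hmu _)).add
      (tendsto_mulVec tendsto_const_nhds (hv _))
  · refine tendsto_nhds_unique (hmu 0) ?_
    simp only [(hf _).init_mean]
    exact tendsto_const_nhds
  · refine tendsto_nhds_unique (hS 0) ?_
    simp only [(hf _).init_cov]
    exact tendsto_const_nhds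
  · refine tendsto_nhds_unique (hmu _) ?_
    simp only [(hf _).terminal_mean]
    exact tendsto_const_nhds
  · refine (terminal_norm_iff D.PFin_posDef).2 (posSemidef_of_tendsto
      ((tendsto_mul (hS _) (tendsto_transpose (hS _))).const_sub D.PFin)
      (Eventually.of_forall fun a => (terminal_norm_iff D.PFin_posDef).1 (hf a).terminal_cov))

/-- Continuity of the QR decomposition. -/
theorem tendsto_qr {ι : Type*} [Fintype ι] {X : α → Matrix (Fin n) ι ℝ}
    {X₀ : Matrix (Fin n) ι ℝ} {Q : Matrix ι (Fin n) ℝ} {R : Matrix (Fin n) (Fin n) ℝ}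
    (h₀ : IsQR X₀ᵀ Q R) (hX : Tendsto X l (𝓝 X₀)) (hr : ∀ a, (X a).rank = n) :
    Tendsto (fun a => qrQ (X a)ᵀ) l (𝓝 Q) ∧ Tendsto (fun a => qrR (X a)ᵀ) l (𝓝 R) := by
  have hQR := fun a => isQR_qr_of_rank (hr a)
  have hR : Tendsto (fun a => qrR (X a)ᵀ) l (𝓝 R) := by
    have h1 : Tendsto (fun a => (qrR (X a)ᵀ)ᵀ) l (𝓝 Rᵀ) := by
      refine tendsto_of_mul_transpose h₀.isLT h₀.diag_pos
        (Eventually.of_forall fun a => ⟨(hQR a).isLT, fun i => ((hQR a).diag_pos i).le⟩) ?_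
      simp only [transpose_transpose, ← (hQR _).gram, ← h₀.gram]
      exact tendsto_mul hX (tendsto_transpose hX)
    simpa using tendsto_transpose h1
  refine ⟨?_, hR⟩
  rw [h₀.eq_mul_inv]
  refine (tendsto_mul (tendsto_transpose hX) (tendsto_matrix_inv hR h₀.isUnit_det)).congr
    fun a => ((hQR a).eq_mul_inv).symm

/-- A limit of points whose infeasibility vanishes asymptotically is feasible. -/
theorem mem_detFeasible_of_tendsto [l.NeBot] {f : α → Vars N n m} {z : Vars N n m}
    (h : Tendsto f l (𝓝 z)) (hf : ∀ a, ConvexFeasible D (f a))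
    (hr : ∀ a k, (X D (f a) k).rank = n) (hd : ∀ k i, 0 < z.S k i i)
    (hχ : Tendsto (fun a => slackNorm (infeas D (f a))) l (𝓝 0)) : z ∈ detFeasible D := by
  have hz := convexFeasible_of_tendsto h hf
  obtain ⟨-, hL, -, hS⟩ := tendsto_vars h
  -- Full rank of `X` could be lost in the limit. Instead the Gram identity passes to the limit, and
  -- the positive diagonal of `S` then supplies the QR factorization.
  refine ⟨hz, fun k => ⟨_, isQR_of_gram (hz.lower _) (hd _) ?_⟩⟩
  have hX : Tendsto (fun a => X D (f a) k) l (𝓝 (X D z k)) := tendsto_X (hS _) (hL _)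
  have hQR := fun a => isQR_qr_of_rank (hr a k)
  have hR : Tendsto (fun a => (qrR (X D (f a) k)ᵀ)ᵀ) l (𝓝 (z.S k.succ)) := by
    have h1 : Tendsto (fun a => (f a).S k.succ - (qrR (X D (f a) k)ᵀ)ᵀ) l (𝓝 0) := by
      refine tendsto_matrix_iff.2 fun i j => ?_
      rcases lt_or_ge i j with hij | hij
      · simp only [Matrix.sub_apply, (hf _).lower _ i j hij, (hQR _).isLT i j hij, sub_self]
        exact tendsto_const_nhds
      · exact squeeze_zero_norm
          (fun a => abs_le_slackNorm (infeas D (f a)) k ⟨(i, j), hij⟩) hχ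
    simpa using (hS k.succ).sub h1
  have h2 := tendsto_mul hR (tendsto_transpose hR)
  have h3 := tendsto_mul hX (tendsto_transpose hX)
  rw [transpose_transpose]
  refine tendsto_nhds_unique h3 (h2.congr fun a => ?_)
  have h4 := (hQR a).gram
  rw [transpose_transpose] at h4
  rw [transpose_transpose, h4]

/-- A feasible limit of reference points and of subproblem solutions is not worse than any
controller, if the terminal bound can be met strictly. -/
theorem detCost_le_of_tendsto [l.NeBot] {prm : Params n} {s : α → AlgState N n m}
    {y : α → Vars N n m × Slack N n} {z : Vars N n m} (hz : z ∈ detFeasible D)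
    (hs : Tendsto (fun a => (s a).ref) l (𝓝 z)) (hy : Tendsto (fun a => (y a).1) l (𝓝 z))
    (hr : ∀ a k, (X D (s a).ref k).rank = n) (hinv : ∀ a, LoopInvariant D prm (s a))
    (hsol : ∀ a, SolvesSub D prm (s a) (y a))
    {vs : Fin N → Fin m → ℝ} {Ks : Fin N → Matrix (Fin m) (Fin n) ℝ}
    (hvs : meanSeq D vs (Fin.last N) = D.muFin)
    (hKs : (D.PFin - covSeq D Ks (Fin.last N)).PosDef)
    {v : Fin N → Fin m → ℝ} {K : Fin N → Matrix (Fin m) (Fin n) ℝ} (ho : TerminalOK D v K) :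
    detCost D z ≤ ctrlCost D v K := by
  by_contra! hlt
  obtain ⟨v', K', hv', hK', hlt'⟩ := exists_strict_better hz hvs hKs ho hlt
  obtain ⟨-, hLs, -, hSs⟩ := tendsto_vars hs
  obtain ⟨-, hLy, -, hSy⟩ := tendsto_vars hy
  have hQRz : ∀ k, IsQR (X D z k)ᵀ (qrQ (X D z k)ᵀ) (qrR (X D z k)ᵀ) :=
    fun k => (feasible_isQR hz k).isQR_qrPair
  have hXs : ∀ k, Tendsto (fun a => X D (s a).ref k) l (𝓝 (X D z k)) :=
    fun k => tendsto_X (hSs _) (hLs _)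
  have hXy : ∀ k, Tendsto (fun a => X D (y a).1 k) l (𝓝 (X D z k)) :=
    fun k => tendsto_X (hSy _) (hLy _)
  have hqr := fun k => tendsto_qr (hQRz k) (hXs k) (fun a => hr a k)
  -- Reference points and solutions have the same limit, where the dynamics hold exactly, so the
  -- linearization residuals vanish.
  have hξ : Tendsto (fun a => (y a).2) l (𝓝 0) := by
    refine tendsto_pi_nhds.2 fun k => tendsto_pi_nhds.2 fun e => ?_
    have h1 := ((hSy k.succ).sub (tendsto_transpose (hqr k).2)).sub (tendsto_transpose
      (tendsto_dR (tendsto_transpose ((hXy k).sub (hXs k))) (hqr k).1 (hqr k).2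
        (hQRz k).isUnit_det))
    rw [sub_self, transpose_zero, dR_zero, transpose_zero, sub_zero,
      (feasible_isQR hz k).qrR_eq, transpose_transpose, sub_self] at h1
    refine (tendsto_matrix_iff.1 h1 e.1.1 e.1.2).congr fun a => ?_
    rw [(hsol a).1.slack_eq]
    rfl
  have hdiag : ∀ᶠ t in 𝓝[>] 0, ∀ k i,
      0 < (linVars D z 0 (mixControl z.v v' t) (mixPath D z v' K' t).L).S k i i :=
    eventually_all.2 fun k => eventually_all.2 fun i =>
      (tendsto_matrix_iff.1 (linVars_tendsto hz v' K' k) i i).eventually_const_lt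
        ((isCholesky_covSeq hz k).diag_pos i)
  have htrust : ∀ᶠ t in 𝓝[>] 0, ∀ (k : Fin N) (i : Fin n) (j : Fin n ⊕ Fin p),
      |(prm.DX * (X D (linVars D z 0 (mixControl z.v v' t) (mixPath D z v' K' t).L) k -
        X D z k)) i j| < prm.rMin := by
    refine eventually_all.2 fun k => eventually_all.2 fun i => eventually_all.2 fun j => ?_
    have h1 : Tendsto (fun t => X D (linVars D z 0 (mixControl z.v v' t)
        (mixPath D z v' K' t).L) k) (𝓝[>] 0) (𝓝 (X D z k)) :=
      tendsto_X (linVars_tendsto hz v' K' _)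
        (tendsto_of_sub_isBigO (mixPath_L hz v' K' k) tendsto_id_nhdsGT)
    have h2 := tendsto_mul (tendsto_const_nhds (x := prm.DX)) (h1.sub_const (X D z k))
    rw [sub_self, Matrix.mul_zero] at h2
    have h3 := (tendsto_matrix_iff.1 h2 i j).abs
    rw [Matrix.zero_apply, abs_zero] at h3
    exact h3.eventually_lt_const prm.rMin_pos
  -- From here on `t` is fixed. Its inequalities are strict, so they survive a small change of the
  -- linearization point and the slack; `rMin` bounds all trust region radii from below.
  obtain ⟨t, ht1, ht2, ht3, ht4⟩ := (hdiag.and (htrust.and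
    ((linVars_terminal hz (v := v') hK').and (detCost_linVars_lt hz hlt')))).exists
  set v₁ := mixControl z.v v' t with hv₁
  set L₁ := (mixPath D z v' K' t).L with hL₁
  have hlin : Tendsto (fun a => linVars D (s a).ref (y a).2 v₁ L₁) l
      (𝓝 (linVars D z 0 v₁ L₁)) :=
    tendsto_linVars v₁ L₁ hXs (fun k => (hqr k).1) (fun k => (hqr k).2)
      (fun k => (hQRz k).isUnit_det) hξ
  obtain ⟨-, hLlin, -, hSlin⟩ := tendsto_vars hlin
  have hXlin : ∀ k, Tendsto (fun a => X D (linVars D (s a).ref (y a).2 v₁ L₁) k) l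
      (𝓝 (X D (linVars D z 0 v₁ L₁) k)) := fun k => tendsto_X (hSlin _) (hLlin _)
  have e1 : ∀ᶠ a in l, ∀ k i, 0 < (linVars D (s a).ref (y a).2 v₁ L₁).S k i i :=
    eventually_all.2 fun k => eventually_all.2 fun i =>
      (tendsto_matrix_iff.1 (hSlin k) i i).eventually_const_lt (ht1 k i)
  have e2 : ∀ᶠ a in l, ∀ (k : Fin N) (i : Fin n) (j : Fin n ⊕ Fin p),
      |(prm.DX * (X D (linVars D (s a).ref (y a).2 v₁ L₁) k - X D (s a).ref k)) i j| <
        prm.rMin := by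
    refine eventually_all.2 fun k => eventually_all.2 fun i => eventually_all.2 fun j => ?_
    have h2 := tendsto_mul (tendsto_const_nhds (x := prm.DX)) ((hXlin k).sub (hXs k))
    exact (tendsto_matrix_iff.1 h2 i j).abs.eventually_lt_const (ht2 k i j)
  have e3 := eventually_posDef
    ((tendsto_mul (hSlin (Fin.last N)) (tendsto_transpose (hSlin (Fin.last N)))).const_sub D.PFin)
    ht3 (Eventually.of_forall fun a => D.PFin_posDef.1.sub (posSemidef_mul_transpose _).1)
  have hmean : meanSeq D v₁ (Fin.last N) = D.muFin := by
    rw [hv₁, meanSeq_mix, hv', (terminalOK_of_feasible hz).1, ← add_smul, sub_add_cancel, one_smul]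
  have e4 : ∀ᶠ a in l, detCost D (y a).1 ≤
      detCost D (linVars D (s a).ref (y a).2 v₁ L₁) := by
    filter_upwards [e1, e2, e3] with a h1 h2 h3
    have hconv : ConvexFeasible D (linVars D (s a).ref (y a).2 v₁ L₁) :=
      ⟨linVars_S_isLT _ _ _ _, fun k i => (h1 k i).le, fun k => rfl, rfl, rfl, hmean,
        (terminal_norm_iff D.PFin_posDef).2 h3.posSemidef⟩
    have h4 := (hsol a).le hconv
      fun k i j => (h2 k i j).le.trans (hinv a).radius_mem.1
    -- Both points carry the same slack, so the penalties cancel whatever the weight and the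
    -- multipliers are.
    rw [linSlack_linVars] at h4
    exact le_of_add_le_add_right h4
  have h5 := le_of_tendsto_of_tendsto (((continuous_detCost D).tendsto z).comp hy)
    (((continuous_detCost D).tendsto _).comp hlin) e4
  exact absurd ht4 (not_lt.2 h5)

theorem ConvergesTo.globallyOptimal {prm : Params n} {rules : UpdateRules N prm}
    {s : ℕ → AlgState N n m} {y : ℕ → Vars N n m × Slack N n} {z : Vars N n m}
    (h : ConvergesTo D prm rules s y z) (hd : ∀ k i, 0 < z.S k i i)
    {Ω : Type*} [MeasurableSpace Ω] {P : Measure Ω} [IsProbabilityMeasure P]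
    {x₀ : Ω → Fin n → ℝ} {w : Fin N → Ω → Fin p → ℝ} (hnoise : IsNoise D P x₀ w)
    (hfeas : StrictlyFeasible D P x₀ w) : GloballyOptimal D P x₀ w z := by
  have hinv : ∀ i, LoopInvariant D prm (s i) := by
    intro i
    induction i with
    | zero => exact h.init.loopInvariant
    | succ i ih => exact (h.step i).loopInvariant ih
  have hpos : ∀ j : ℕ, (0 : ℝ) < 1 / ((j : ℝ) + 1) := fun j => by positivity
  -- A subsequence of accepted steps that pass the test with tolerances tending to zero.
  obtain ⟨φ, hφ, hφs⟩ := extraction_forall_of_frequently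
    fun j : ℕ => h.stops (1 / ((j : ℝ) + 1)) (hpos j) (1 / ((j : ℝ) + 1)) (hpos j)
  -- An accepted solution is the next reference point, so the solutions along the subsequence
  -- converge to `z` too.
  have hy : Tendsto (fun j => (y (φ j)).1) atTop (𝓝 z) := by
    have h1 : Tendsto (fun j => (s (φ j + 1)).ref) atTop (𝓝 z) :=
      h.tendsto.comp ((tendsto_add_atTop_nat 1).comp hφ.tendsto_atTop)
    refine h1.congr fun j => ?_
    rw [(h.step (φ j)).ref_eq, if_pos (hφs j).1]
  have hz : z ∈ detFeasible D := by
    refine mem_detFeasible_of_tendsto hy (fun j => (h.step (φ j)).solves.1.convex)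
      (fun j => (h.step (φ j)).rank_sol) hd ?_
    exact squeeze_zero (fun j => Real.sqrt_nonneg _) (fun j => (hφs j).2.2)
      tendsto_one_div_add_atTop_nhds_zero_nat
  obtain ⟨vs, Ks, hvs, hKs⟩ := hfeas
  obtain ⟨-, h2, h3, -⟩ := hnoise.state_moments vs Ks (Fin.last N)
  rw [h2] at hvs
  rw [h3] at hKs
  exact globallyOptimal_of_le hnoise hz fun v K ho =>
    detCost_le_of_tendsto (s := fun j => s (φ j)) (y := fun j => y (φ j)) hz
      (h.tendsto.comp hφ.tendsto_atTop) hy (fun j => (h.step (φ j)).rank_ref)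
      (fun j => hinv (φ j)) (fun j => (h.step (φ j)).solves) hvs hKs ho

end Limits

end

end CovSteer

/-- Global optimality without chance constraints and with expectation-of-quadratic cost:
(i) every local minimizer of the square root formulation is globally optimal;
(ii) so is the output of the algorithm when it terminates with tolerances zero;
(iii) so is every limit of the algorithm with positive definite covariances, provided the
terminal covariance bound can be met strictly. -/
theorem theorem2 {N n m p : ℕ} (D : CovSteer.Problem N n m p)
    {Ω : Type*} [MeasurableSpace Ω] (P : Measure Ω) [IsProbabilityMeasure P]
    (x₀ : Ω → Fin n → ℝ) (w : Fin N → Ω → Fin p → ℝ) (hnoise : CovSteer.IsNoise D P x₀ w) :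
    (∀ z ∈ CovSteer.detFeasible D,
      IsLocalMinOn (CovSteer.detCost D) (CovSteer.detFeasible D) z →
        CovSteer.GloballyOptimal D P x₀ w z) ∧
    (∀ (prm : CovSteer.Params n) (rules : CovSteer.UpdateRules N prm)
      (s : ℕ → CovSteer.AlgState N n m) (y : ℕ → CovSteer.Vars N n m × CovSteer.Slack N n)
      (T : ℕ), CovSteer.TerminatesAt D prm rules s y T →
        CovSteer.GloballyOptimal D P x₀ w (y T).1) ∧
    (CovSteer.StrictlyFeasible D P x₀ w →
      ∀ (prm : CovSteer.Params n) (rules : CovSteer.UpdateRules N prm)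
        (s : ℕ → CovSteer.AlgState N n m) (y : ℕ → CovSteer.Vars N n m × CovSteer.Slack N n)
        (z : CovSteer.Vars N n m), CovSteer.ConvergesTo D prm rules s y z →
          (∀ k i, 0 < z.S k i i) → CovSteer.GloballyOptimal D P x₀ w z) := by
  refine ⟨fun z hz hmin => CovSteer.globallyOptimal_of_le hnoise hz fun v K ho =>
      CovSteer.detCost_le_of_isLocalMinOn hz hmin ho,
    fun prm rules s y T h => h.globallyOptimal hnoise,
    fun hfeas prm rules s y z h hd => h.globallyOptimal hd hnoise hfeas⟩
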